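/- **Theorem 6.1.** Let $(\mathcal M,g)$ be a smooth four-dimensional spacetime (signature $(-,+,+,+)$) satisfying the vacuum Einstein equations with cosmological constant, $R_{\mu\nu}-\tfrac12 R\,g_{\mu\nu}+\Lambda g_{\mu\nu}=0$, and let $\Sigma\subset\mathcal M$ be a spacelike hypersurface covered near infinity by coordinates $x\in\mathbb R^3$, $r=|x|>R_0>0$; near $\Sigma$ use spacetime coordinates $(t,x)$ with $\Sigma=\{t=0\}$. Let $n$ be the unit normal of $\Sigma$, $\gamma_{ij}$ the induced Riemannian metric, $K_{ij}=-\nabla_i n_j$ the extrinsic curvature, and $E_{ij}=W_{i\mu\nu j}n^\mu n^\nu$, $B_{ij}=W^*{}_{i\mu\nu j}n^\mu n^\nu$ the electric and magnetic parts of the Weyl tensor $W$ of $g$, where $W^*{}_{\alpha\beta\mu\nu}=\tfrac12W_{\alpha\beta\rho\sigma}\varepsilon^{\rho\sigma}{}_{\mu\nu}$. Suppose that $$\gamma_{ij}=\Bigl(1+\frac{M}{2r}\Bigr)^4(\eta_{ij}+h_{ij}),\qquad M\in\mathbb R,$$ with $\eta_{ij}=\delta_{ij}$ the Euclidean metric and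 $h_{ij}\to0$ as $r\to\infty$ (asymptotic flatness). Let $X$ be a smooth conformal Killing field of $\eta$ on $\{r>R_0\}$, i.e. $\mathcal L_X\eta=\lambda\eta$ for some function $\lambda$. Assume that, in these coordinates, as $r\to\infty$, $$h_{ij}=O(r^d),\quad (\Gamma_{\eta+h})^a{}_{ij}=O(r^c),\quad K_{ij}=O(r^k),\quad E_{ij}=O(r^e),\quad B_{ij}=O(r^b),\quad X=O(r^q),$$ where $\Gamma_{\eta+h}$ are the Christoffel symbols of $\eta+h$, $c,d,k,e,b$ are real numbers with $c<d<1$, and $q\in\{0,1,2\}$. For a tensor field $T_{ij}$ put $$I_{as}(T,X)=\lim_{r\to\infty}\int_{S(r)}T^i{}_jX^j\,dS_i,\qquad dS_i=\sqrt{\det\gamma}\;\frac{x^i}{r}\,dA,$$ where $S(r)=\{|x|=r\}$, $dA$ is its Euclidean area element, and the index of $T$ is raised with $\gamma$. (i) If $e+c+q<-3$, $e+q+d<-3$ and $q+k+b<-3$, then the limit $I_{as}(E,X)$ exists and is finite. (ii) If $b+c+q<-3$, $b+q+d<-3$ and $q+k+e<-3$, then the limit $I_{as}(B,X)$ exists and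 is finite. -/

import Mathlib

noncomputable section

namespace GravCharge

open MeasureTheory Filter Topology

/-! ## Tensor calculus in a coordinate domain of `ℝⁿ` -/

/-- Coordinate space `ℝⁿ` with its Euclidean norm. -/
abbrev Coord (n : ℕ) := EuclideanSpace ℝ (Fin n)

/-- A covariant two-tensor field, given by its matrix of components. -/
abbrev TwoTensor (n : ℕ) := Coord n → Matrix (Fin n) (Fin n) ℝ

/-- The partial derivative `∂ᵢ f` at `x`. -/
def pd {n : ℕ} (i : Fin n) (f : Coord n → ℝ) (x : Coord n) : ℝ :=
  fderiv ℝ f x (EuclideanSpace.single i 1)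

/-- Christoffel symbols `Γᵃᵢⱼ = ½ gᵃˡ (∂ᵢ gₗⱼ + ∂ⱼ gₗᵢ - ∂ₗ gᵢⱼ)` of the Levi-Civita connection. -/
def christoffel {n : ℕ} (g : TwoTensor n) (a i j : Fin n) (x : Coord n) : ℝ :=
  (1 / 2) * ∑ l, (g x)⁻¹ a l *
    (pd i (fun y => g y l j) x + pd j (fun y => g y l i) x - pd l (fun y => g y i j) x)

/-- Riemann tensor
`Rᵃ_{bcd} = ∂_c Γᵃ_{db} - ∂_d Γᵃ_{cb} + Γᵃ_{ce} Γᵉ_{db} - Γᵃ_{de} Γᵉ_{cb}`. -/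
def riemannUp {n : ℕ} (g : TwoTensor n) (a b c d : Fin n) (x : Coord n) : ℝ :=
  pd c (christoffel g a d b) x - pd d (christoffel g a c b) x
    + ∑ e, (christoffel g a c e x * christoffel g e d b x
      - christoffel g a d e x * christoffel g e c b x)

/-- Fully covariant Riemann tensor `R_{abcd}`. -/
def riemann {n : ℕ} (g : TwoTensor n) (a b c d : Fin n) (x : Coord n) : ℝ :=
  ∑ e, g x a e * riemannUp g e b c d x

/-- Ricci tensor `R_{bd} = Rᵃ_{bad}`. -/
def ricci {n : ℕ} (g : TwoTensor n) (b d : Fin n) (x : Coord n) : ℝ :=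
  ∑ a, riemannUp g a b a d x

/-- Scalar curvature. -/
def scalarCurv {n : ℕ} (g : TwoTensor n) (x : Coord n) : ℝ :=
  ∑ b, ∑ d, (g x)⁻¹ b d * ricci g b d x

/-! ## Spacetime: index `0` is the time coordinate -/

/-- The Weyl tensor in dimension four,
`W_{abcd} = R_{abcd} - (g_{a[c} R_{d]b} - g_{b[c} R_{d]a}) + ⅓ R g_{a[c} g_{d]b}`. -/
def weyl (g : TwoTensor 4) (a b c d : Fin 4) (p : Coord 4) : ℝ :=
  riemann g a b c d p
    - (1 / 2) * (g p a c * ricci g d b p - g p a d * ricci g c b p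
        - g p b c * ricci g d a p + g p b d * ricci g c a p)
    + (1 / 6) * scalarCurv g p * (g p a c * g p d b - g p a d * g p c b)

/-- The alternating symbol `[abcd]`, with `[0123] = 1`. -/
def altSymbol (a b c d : Fin 4) : ℝ :=
  (Matrix.of fun i j : Fin 4 => if ![a, b, c, d] i = j then (1 : ℝ) else 0).det

/-- The Levi-Civita tensor `ε^{ab}_{cd}`, normalized by `√|det g| ε^{1230} = 1` (time index last),
that is `ε_{0123} = √|det g|`; then `n^a ε_{abcd}` is the volume form of the level sets of `t`
with `ε_{123} > 0`. -/
def leviCivitaMixed (g : TwoTensor 4) (a b c d : Fin 4) (p : Coord 4) : ℝ :=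
  ∑ s, ∑ t, -altSymbol a b s t / √|(g p).det| * g p s c * g p t d

/-- The dual Weyl tensor `W*_{abcd} = ½ W_{abst} ε^{st}_{cd}`. -/
def dualWeyl (g : TwoTensor 4) (a b c d : Fin 4) (p : Coord 4) : ℝ :=
  (1 / 2) * ∑ s, ∑ t, weyl g a b s t p * leviCivitaMixed g s t c d p

/-- A smooth Lorentzian metric of signature `(-,+,+,+)` on the open set `U ⊆ ℝ⁴` solving the
vacuum Einstein equations with cosmological constant `Λ`,
`R_{μν} - ½ R g_{μν} + Λ g_{μν} = 0`. -/
structure IsVacuumSpacetime (Λ : ℝ) (U : Set (Coord 4)) (g : TwoTensor 4) : Prop where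
  isOpen : IsOpen U
  smooth : ∀ μ ν, ContDiffOn ℝ ((⊤ : ℕ∞) : WithTop ℕ∞) (fun p => g p μ ν) U
  symm : ∀ p ∈ U, (g p).IsSymm
  lorentzian : ∀ p ∈ U, ∃ P : Matrix (Fin 4) (Fin 4) ℝ,
    IsUnit P.det ∧ P.transpose * g p * P = Matrix.diagonal ![-1, 1, 1, 1]
  einstein : ∀ p ∈ U, ∀ μ ν,
    ricci g μ ν p - (1 / 2) * scalarCurv g p * g p μ ν + Λ * g p μ ν = 0

/-! ## The hypersurface `Σ = {t = 0}` -/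

/-- The embedding `x ↦ (0, x)` of the hypersurface `t = 0`. -/
def slice (x : Coord 3) : Coord 4 := WithLp.toLp 2 (Fin.cons 0 (fun i => x i))

/-- The metric induced on the hypersurface. -/
def inducedMetric (g : TwoTensor 4) : TwoTensor 3 :=
  fun x => Matrix.of fun i j => g (slice x) i.succ j.succ

/-- The lapse `N = (-g^{00})^{-1/2}` of the foliation by the level sets of `t`. -/
def lapse (g : TwoTensor 4) (p : Coord 4) : ℝ := (√(-((g p)⁻¹ 0 0)))⁻¹

/-- The unit conormal `n_μ = -N ∂_μ t` of the level sets of `t`. -/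
def conormal (g : TwoTensor 4) (μ : Fin 4) (p : Coord 4) : ℝ :=
  if μ = 0 then -lapse g p else 0

/-- The (future directed) unit normal `n^μ = g^{μν} n_ν`. -/
def unitNormal (g : TwoTensor 4) (μ : Fin 4) (p : Coord 4) : ℝ :=
  ∑ ν, (g p)⁻¹ μ ν * conormal g ν p

/-- Extrinsic curvature `K_{ij} = -∇_i n_j` of the hypersurface. -/
def extrinsicCurv (g : TwoTensor 4) : TwoTensor 3 :=
  fun x => Matrix.of fun i j =>
    -(pd i.succ (conormal g j.succ) (slice x)
      - ∑ μ, christoffel g μ i.succ j.succ (slice x) * conormal g μ (slice x))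

/-- Electric part of the Weyl tensor, `E_{ij} = W_{iμνj} n^μ n^ν`. -/
def electricPart (g : TwoTensor 4) : TwoTensor 3 :=
  fun x => Matrix.of fun i j => ∑ μ, ∑ ν, weyl g i.succ μ ν j.succ (slice x)
    * unitNormal g μ (slice x) * unitNormal g ν (slice x)

/-- Magnetic part of the Weyl tensor, `B_{ij} = W*_{iμνj} n^μ n^ν`. -/
def magneticPart (g : TwoTensor 4) : TwoTensor 3 :=
  fun x => Matrix.of fun i j => ∑ μ, ∑ ν, dualWeyl g i.succ μ ν j.succ (slice x)
    * unitNormal g μ (slice x) * unitNormal g ν (slice x)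

/-! ## Conformal Killing fields and charges on the exterior region -/

/-- The exterior region `r > R₀` of `ℝ³`. -/
def exterior (R₀ : ℝ) : Set (Coord 3) := {x | R₀ < ‖x‖}

/-- `X` is a smooth conformal Killing field of the Euclidean metric on `S`:
`L_X η = lam η`, that is `∂_i X_j + ∂_j X_i = lam δ_{ij}`, for some function `lam`. -/
structure IsFlatConformalKilling (S : Set (Coord 3)) (X : Coord 3 → Coord 3) : Prop where
  smooth : ContDiffOn ℝ ((⊤ : ℕ∞) : WithTop ℕ∞) X S
  killing : ∃ lam : Coord 3 → ℝ, ∀ x ∈ S, ∀ i j,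
    pd i (fun y => X y j) x + pd j (fun y => X y i) x = lam x * (if i = j then 1 else 0)

/-- The charge `∫_{S(r)} Tⁱⱼ Xʲ dSᵢ` through the coordinate sphere `S(r)`, for the Riemannian
metric `γ`. Here `dSᵢ = ½ √(det γ) [ijk] dxʲ ∧ dxᵏ`, which on `S(r)` equals
`√(det γ) (xⁱ / r) dA` with `dA = r² du` the Euclidean area element; the index of `T` is raised
with `γ`. -/
def sphereCharge (γ T : TwoTensor 3) (X : Coord 3 → Coord 3) (r : ℝ) : ℝ :=
  ∫ u : Metric.sphere (0 : Coord 3) 1,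
    (∑ i, ∑ j, ((γ (r • (u : Coord 3)))⁻¹ * T (r • (u : Coord 3))) i j
      * X (r • (u : Coord 3)) j
      * (√(γ (r • (u : Coord 3))).det * (u : Coord 3) i * r ^ 2))
    ∂(volume : Measure (Coord 3)).toSphere

/-- `f = O(r^s)` as `r → ∞`. -/
def IsBigOPow {F : Type*} [Norm F] (f : Coord 3 → F) (s : ℝ) : Prop :=
  f =O[Bornology.cobounded (Coord 3)] fun x => ‖x‖ ^ s

/-- The asymptotic charge `lim_{r → ∞} ∫_{S(r)} Tⁱⱼ Xʲ dSᵢ` exists and is finite. -/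
def HasFiniteAsymptoticCharge (γ T : TwoTensor 3) (X : Coord 3 → Coord 3) : Prop :=
  ∃ I : ℝ, Tendsto (sphereCharge γ T X) atTop (𝓝 I)

end GravCharge

end

/-! Weighted by √det γ, the vector field Tⁱⱼ Xʲ becomes a density Fⁱ whose ordinary coordinate
divergence is meaningful, and I_as(T, X) is the limit of the Euclidean flux of F through S(r). The
r-derivative of that flux is the integral of ∂ᵢFⁱ over S(r). If ∂ᵢFⁱ = O(r^s) with s < -3, this
derivative is O(r^(s+2)), hence integrable at infinity, and the flux converges
(`exists_tendsto_sphereFlux`). Everything therefore reduces to the decay of ∂ᵢFⁱ.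

In vacuum the Riemann tensor is the Weyl tensor plus a constant-curvature part. The contracted
Bianchi identity makes the Weyl tensor divergence free. Evaluated on the slice with one index
normal, this is the constraint for E; the uncontracted identity, contracted with the normal and
summed cyclically over spatial indices, is the constraint for B. With X inserted
(`divergence_flux_electricPart`, `divergence_flux_magneticPart`), ∂ᵢFⁱ is √det γ Tⁱᵏ∇ᵢX_k plus a
term of the shape K · W · X. In the electric case W has one normal index and is dual to B; in the
magnetic case W is tangential and, in dimension three, algebraically determined by E. This yields
the rates q + k + b and q + k + e.

The other term is small because T is symmetric and trace free: it only sees the trace-free symmetric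
part of ∇ᵢX_k, which vanishes for a conformal Killing field of η when γ is conformal to η. What
survives is linear in h and ∂h (`sum_symm_traceFree_mul`), with rates t + d + q and t + c + q for T
= O(r^t). Two derivative bounds are needed. ∂h is recovered from the Christoffel symbols of η + h by
metric compatibility. ∂X = O(r^q) holds because conformal Killing fields in dimension three have
vanishing third derivatives, so that ∂X is an exact central difference of X. -/

noncomputable section

namespace GravCharge

open MeasureTheory Filter Topology Matrix

/-! ## Partial derivatives -/

/-- Smoothness on a set. -/
abbrev SmoothOn {n : ℕ} {F : Type*} [NormedAddCommGroup F] [NormedSpace ℝ F]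
    (f : Coord n → F) (U : Set (Coord n)) : Prop :=
  ContDiffOn ℝ ((⊤ : ℕ∞) : WithTop ℕ∞) f U

section pd

variable {n : ℕ} {U : Set (Coord n)} {f g : Coord n → ℝ} {x : Coord n}

theorem SmoothOn.contDiffAt {F : Type*} [NormedAddCommGroup F] [NormedSpace ℝ F]
    {f : Coord n → F} (hf : SmoothOn f U) (hU : IsOpen U) (hx : x ∈ U) :
    ContDiffAt ℝ ((⊤ : ℕ∞) : WithTop ℕ∞) f x :=
  ContDiffOn.contDiffAt hf (hU.mem_nhds hx)

theorem SmoothOn.differentiableAt {F : Type*} [NormedAddCommGroup F] [NormedSpace ℝ F]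
    {f : Coord n → F} (hf : SmoothOn f U) (hU : IsOpen U) (hx : x ∈ U) :
    DifferentiableAt ℝ f x :=
  (SmoothOn.contDiffAt hf hU hx).differentiableAt (by simp)

theorem SmoothOn.pd (hf : SmoothOn f U) (hU : IsOpen U) (i : Fin n) :
    SmoothOn (pd i f) U := by
  have h := ContDiffOn.fderiv_of_isOpen (m := ((⊤ : ℕ∞) : WithTop ℕ∞)) hf hU (by simp)
  exact ContDiffOn.clm_apply h contDiffOn_const

theorem pd_add (hf : DifferentiableAt ℝ f x) (hg : DifferentiableAt ℝ g x) (i : Fin n) :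
    pd i (fun y => f y + g y) x = pd i f x + pd i g x := by
  simp only [pd, fderiv_fun_add hf hg, _root_.add_apply]

theorem pd_sub (hf : DifferentiableAt ℝ f x) (hg : DifferentiableAt ℝ g x) (i : Fin n) :
    pd i (fun y => f y - g y) x = pd i f x - pd i g x := by
  simp only [pd, fderiv_fun_sub hf hg, _root_.sub_apply]

theorem pd_neg (i : Fin n) : pd i (fun y => -f y) x = -pd i f x := by
  simp only [pd, fderiv_fun_neg, _root_.neg_apply]

theorem pd_mul (hf : DifferentiableAt ℝ f x) (hg : DifferentiableAt ℝ g x) (i : Fin n) :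
    pd i (fun y => f y * g y) x = pd i f x * g x + f x * pd i g x := by
  simp only [pd, fderiv_fun_mul hf hg, _root_.add_apply,
    _root_.smul_apply, smul_eq_mul]
  ring

theorem pd_const_mul (hf : DifferentiableAt ℝ f x) (c : ℝ) (i : Fin n) :
    pd i (fun y => c * f y) x = c * pd i f x := by
  simp only [pd, fderiv_const_mul hf c, _root_.smul_apply, smul_eq_mul]

theorem pd_const (c : ℝ) (i : Fin n) : pd i (fun _ => c) x = 0 := by
  simp [pd]

theorem pd_sum {ι : Type*} {s : Finset ι} {f : ι → Coord n → ℝ}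
    (hf : ∀ j ∈ s, DifferentiableAt ℝ (f j) x) (i : Fin n) :
    pd i (fun y => ∑ j ∈ s, f j y) x = ∑ j ∈ s, pd i (f j) x := by
  simp only [pd, fderiv_fun_sum hf, _root_.sum_apply]

theorem pd_congr (h : f =ᶠ[𝓝 x] g) (i : Fin n) : pd i f x = pd i g x := by
  simp only [pd, h.fderiv_eq]

theorem pd_congr_on (hU : IsOpen U) (hx : x ∈ U) (h : ∀ y ∈ U, f y = g y) (i : Fin n) :
    pd i f x = pd i g x :=
  pd_congr (by filter_upwards [hU.mem_nhds hx] with y hy using h y hy) i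

theorem pd_pd_comm (hf : SmoothOn f U) (hU : IsOpen U) (hx : x ∈ U) (i j : Fin n) :
    pd i (pd j f) x = pd j (pd i f) x := by
  have hs : IsSymmSndFDerivAt ℝ f x :=
    (SmoothOn.contDiffAt hf hU hx).isSymmSndFDerivAt
      (by simpa using (WithTop.coe_le_coe.2 (le_top : (2 : ℕ∞) ≤ ⊤)))
  have hd : DifferentiableAt ℝ (fderiv ℝ f) x :=
    ((ContDiffOn.fderiv_of_isOpen (m := ((⊤ : ℕ∞) : WithTop ℕ∞)) hf hU (by simp)).contDiffAt
      (hU.mem_nhds hx)).differentiableAt (by simp)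
  have key : ∀ i j : Fin n, pd i (pd j f) x =
      fderiv ℝ (fderiv ℝ f) x (EuclideanSpace.single i 1) (EuclideanSpace.single j 1) := by
    intro i j
    have : pd j f = fun y => fderiv ℝ f y (EuclideanSpace.single j 1) := rfl
    rw [this]
    simp only [pd]
    rw [fderiv_clm_apply hd (differentiableAt_const _)]
    simp
  rw [key, key]
  exact hs _ _

theorem fderiv_apply_eq_sum_pd (v : Coord n) : fderiv ℝ f x v = ∑ i, v i * pd i f x := by
  have hv : v = ∑ i, v i • (EuclideanSpace.single i (1 : ℝ) : Coord n) := by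
    ext j
    simp [Finset.sum_apply, Pi.single_apply]
  conv_lhs => rw [hv]
  simp [map_sum, pd]

end pd

/-! ## Entrywise partial derivatives of matrix-valued functions -/

section pdM

variable {n m : ℕ} {U : Set (Coord n)} {x : Coord n}

/-- Entrywise smoothness. -/
def SmoothMat (A : Coord n → Matrix (Fin m) (Fin m) ℝ) (U : Set (Coord n)) : Prop :=
  ∀ i j, SmoothOn (fun x => A x i j) U

/-- Entrywise partial derivative. -/
def pdM (c : Fin n) (A : Coord n → Matrix (Fin m) (Fin m) ℝ) (x : Coord n) :
    Matrix (Fin m) (Fin m) ℝ :=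
  Matrix.of fun i j => pd c (fun y => A y i j) x

variable {A B : Coord n → Matrix (Fin m) (Fin m) ℝ}

theorem SmoothMat.differentiableAt (hA : SmoothMat A U) (hU : IsOpen U) (hx : x ∈ U)
    (i j : Fin m) : DifferentiableAt ℝ (fun x => A x i j) x :=
  SmoothOn.differentiableAt (hA i j) hU hx

theorem SmoothMat.add (hA : SmoothMat A U) (hB : SmoothMat B U) :
    SmoothMat (fun x => A x + B x) U := fun i j => ContDiffOn.add (hA i j) (hB i j)

theorem SmoothMat.sub (hA : SmoothMat A U) (hB : SmoothMat B U) :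
    SmoothMat (fun x => A x - B x) U := fun i j => ContDiffOn.sub (hA i j) (hB i j)

theorem SmoothMat.mul (hA : SmoothMat A U) (hB : SmoothMat B U) :
    SmoothMat (fun x => A x * B x) U := fun i j => by
  simp only [Matrix.mul_apply]
  exact ContDiffOn.sum fun k _ => ContDiffOn.mul (hA i k) (hB k j)

theorem SmoothMat.transpose (hA : SmoothMat A U) : SmoothMat (fun x => (A x)ᵀ) U :=
  fun i j => hA j i

theorem SmoothMat.pdM (hA : SmoothMat A U) (hU : IsOpen U) (c : Fin n) :
    SmoothMat (pdM c A) U := fun i j => SmoothOn.pd (hA i j) hU c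

theorem SmoothMat.det (hA : SmoothMat A U) : SmoothOn (fun x => (A x).det) U := by
  simp only [Matrix.det_apply]
  exact ContDiffOn.sum fun σ _ => ContDiffOn.const_smul _ (contDiffOn_prod fun i _ => hA _ _)

theorem SmoothMat.inv (hA : SmoothMat A U) (h0 : ∀ x ∈ U, (A x).det ≠ 0) :
    SmoothMat (fun x => (A x)⁻¹) U := by
  intro i j
  -- Cramer's rule: each entry of the inverse is a quotient of two determinants, hence of
  -- polynomials in entries of `A`.
  have h : ∀ x, (A x)⁻¹ i j = ((A x).det)⁻¹ * ((A x).updateRow j (Pi.single i 1)).det := by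
    intro x
    rw [Matrix.inv_def, Matrix.smul_apply, Matrix.adjugate_apply, Ring.inverse_eq_inv, smul_eq_mul]
  simp only [h]
  refine ContDiffOn.mul (ContDiffOn.inv hA.det h0) (SmoothMat.det ?_)
  intro k l
  by_cases hk : k = j
  · subst hk
    simpa using contDiffOn_const
  · simpa [Matrix.updateRow_ne hk] using hA k l

theorem pdM_congr_on (hU : IsOpen U) (hx : x ∈ U) (h : ∀ y ∈ U, A y = B y) (c : Fin n) :
    pdM c A x = pdM c B x := by
  ext i j
  exact pd_congr_on hU hx (fun y hy => by rw [h y hy]) c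

theorem pdM_add (hA : SmoothMat A U) (hB : SmoothMat B U) (hU : IsOpen U) (hx : x ∈ U)
    (c : Fin n) : pdM c (fun y => A y + B y) x = pdM c A x + pdM c B x := by
  ext i j
  exact pd_add (hA.differentiableAt hU hx i j) (hB.differentiableAt hU hx i j) c

theorem pdM_sub (hA : SmoothMat A U) (hB : SmoothMat B U) (hU : IsOpen U) (hx : x ∈ U)
    (c : Fin n) : pdM c (fun y => A y - B y) x = pdM c A x - pdM c B x := by
  ext i j
  exact pd_sub (hA.differentiableAt hU hx i j) (hB.differentiableAt hU hx i j) c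

theorem pdM_mul (hA : SmoothMat A U) (hB : SmoothMat B U) (hU : IsOpen U) (hx : x ∈ U)
    (c : Fin n) : pdM c (fun y => A y * B y) x = pdM c A x * B x + A x * pdM c B x := by
  ext i j
  simp only [pdM, Matrix.mul_apply, Matrix.of_apply, Matrix.add_apply]
  rw [pd_sum (f := fun k y => A y i k * B y k j)
    (fun k _ => (hA.differentiableAt hU hx i k).mul (hB.differentiableAt hU hx k j)),
    ← Finset.sum_add_distrib]
  exact Finset.sum_congr rfl fun k _ =>
    pd_mul (hA.differentiableAt hU hx i k) (hB.differentiableAt hU hx k j) c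

theorem pdM_transpose (c : Fin n) : pdM c (fun y => (A y)ᵀ) x = (pdM c A x)ᵀ := rfl

theorem pdM_pdM_comm (hA : SmoothMat A U) (hU : IsOpen U) (hx : x ∈ U) (c d : Fin n) :
    pdM c (pdM d A) x = pdM d (pdM c A) x := by
  ext i j
  exact pd_pd_comm (hA i j) hU hx c d

theorem pdM_inv (hA : SmoothMat A U) (hU : IsOpen U) (hx : x ∈ U)
    (h0 : ∀ x ∈ U, (A x).det ≠ 0) (c : Fin n) :
    pdM c (fun y => (A y)⁻¹) x = -((A x)⁻¹ * pdM c A x * (A x)⁻¹) := by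
  have hu : IsUnit (A x).det := (h0 x hx).isUnit
  have h1 := pdM_mul hA (hA.inv h0) hU hx c
  have h2 : pdM c (fun y => A y * (A y)⁻¹) x = 0 := by
    rw [pdM_congr_on (B := fun _ => 1) hU hx
      (fun y hy => Matrix.mul_nonsing_inv _ (h0 y hy).isUnit)]
    ext i j
    exact pd_const _ _
  rw [h2] at h1
  have h3 := congrArg (fun B => (A x)⁻¹ * B) h1
  simp only [Matrix.mul_zero, Matrix.mul_add, ← Matrix.mul_assoc,
    Matrix.nonsing_inv_mul _ hu, Matrix.one_mul] at h3
  exact eq_neg_of_add_eq_zero_right h3.symm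

/-- Jacobi's formula. -/
theorem pd_det (hA : SmoothMat A U) (hU : IsOpen U) (hx : x ∈ U) (c : Fin n) :
    pd c (fun y => (A y).det) x = ((A x).adjugate * pdM c A x).trace := by
  have hd : ∀ i, HasFDerivAt (fun y => A y i) (ContinuousLinearMap.pi fun j =>
      fderiv ℝ (fun y => A y i j) x) x := fun i =>
    hasFDerivAt_pi.2 fun j => (hA.differentiableAt hU hx i j).hasFDerivAt
  let D : ContinuousMultilinearMap ℝ (fun _ : Fin m => Fin m → ℝ) ℝ :=
    { toMultilinearMap := (Matrix.detRowAlternating (n := Fin m) (R := ℝ)).toMultilinearMap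
      cont := Continuous.matrix_det continuous_id }
  have h : HasFDerivAt (fun y => (A y).det) _ x := HasFDerivAt.multilinear_comp (f := D) hd
  simp only [pd, h.fderiv, _root_.sum_apply, ContinuousLinearMap.comp_apply, Matrix.trace,
    Matrix.diag_apply, Matrix.mul_apply]
  rw [Finset.sum_comm]
  refine Finset.sum_congr rfl fun i _ => ?_
  -- The derivative of the determinant replaces one row at a time by its derivative; a determinant
  -- with a replaced row is a Cramer entry, which brings in the adjugate.
  have h2 := congrFun (Matrix.cramer_eq_adjugate_mulVec (A x)ᵀ (pdM c A x i)) i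
  rw [Matrix.cramer_transpose_apply, ← Matrix.adjugate_transpose] at h2
  exact h2

end pdM

/-! ## Connection and curvature matrices -/

section curvature

variable {n : ℕ}

/-- The connection matrices `(Γ_c)^a_b`. -/
def conn (g : TwoTensor n) (c : Fin n) (x : Coord n) : Matrix (Fin n) (Fin n) ℝ :=
  Matrix.of fun a b => christoffel g a c b x

/-- The curvature matrices `(R_{cd})^a_b`. -/
def curv (g : TwoTensor n) (c d : Fin n) (x : Coord n) : Matrix (Fin n) (Fin n) ℝ :=
  Matrix.of fun a b => riemannUp g a b c d x

/-- With the connection as a matrix-valued one-form Γ, the curvature is dΓ + [Γ, Γ]. In this form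
the differential Bianchi identity and the antisymmetry in the first pair become identities in a
noncommutative ring. -/
theorem curv_eq (g : TwoTensor n) (c d : Fin n) (x : Coord n) :
    curv g c d x = pdM c (conn g d) x - pdM d (conn g c) x
      + (conn g c x * conn g d x - conn g d x * conn g c x) := by
  ext a b
  simp only [curv, riemannUp, conn, pdM, Matrix.of_apply, Matrix.add_apply, Matrix.sub_apply,
    Matrix.mul_apply, Finset.sum_sub_distrib]

/-- A smooth nondegenerate metric on an open set. -/
structure IsSmoothMetric (U : Set (Coord n)) (g : TwoTensor n) : Prop where
  isOpen : IsOpen U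
  smooth : SmoothMat g U
  symm : ∀ x ∈ U, (g x).IsSymm
  det_ne_zero : ∀ x ∈ U, (g x).det ≠ 0

variable {U : Set (Coord n)} {g : TwoTensor n} {x : Coord n}

/-- Lowering the index cancels the inverse metric and leaves the Christoffel symbols of the first
kind, which are linear in the derivatives of the metric. -/
theorem sum_metric_mul_christoffel (h0 : (g x).det ≠ 0) (a i j : Fin n) :
    ∑ e, g x a e * christoffel g e i j x =
      (1 / 2) * (pd i (fun y => g y a j) x + pd j (fun y => g y a i) x
        - pd a (fun y => g y i j) x) := by
  have h1 : ∀ e, g x a e * christoffel g e i j x = ∑ l, (1 / 2) * ((g x a e * (g x)⁻¹ e l) *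
      (pd i (fun y => g y l j) x + pd j (fun y => g y l i) x - pd l (fun y => g y i j) x)) := by
    intro e
    simp only [christoffel, Finset.mul_sum]
    exact Finset.sum_congr rfl fun l _ => by ring
  have h2 : ∀ l, ∑ e, g x a e * (g x)⁻¹ e l = if a = l then 1 else 0 := by
    intro l
    rw [← Matrix.mul_apply, Matrix.mul_nonsing_inv _ h0.isUnit, Matrix.one_apply]
  simp only [h1]
  rw [Finset.sum_comm]
  simp only [← Finset.mul_sum, ← Finset.sum_mul, h2]
  simp

theorem SmoothMat.christoffel (hs : SmoothMat g U) (hU : IsOpen U)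
    (h0 : ∀ x ∈ U, (g x).det ≠ 0) (a i j : Fin n) : SmoothOn (christoffel g a i j) U := by
  have h : GravCharge.christoffel g a i j = fun x => (1 / 2) * ∑ l, (g x)⁻¹ a l *
    (pd i (fun y => g y l j) x + pd j (fun y => g y l i) x - pd l (fun y => g y i j) x) := rfl
  rw [h]
  refine ContDiffOn.mul contDiffOn_const (ContDiffOn.sum fun l _ => ContDiffOn.mul
    (hs.inv h0 a l) (ContDiffOn.sub (ContDiffOn.add ?_ ?_) ?_)) <;>
  exact SmoothOn.pd (hs _ _) hU _

namespace IsSmoothMetric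

theorem pd_symm (hg : IsSmoothMetric U g) (hx : x ∈ U) (c a b : Fin n) :
    pd c (fun y => g y a b) x = pd c (fun y => g y b a) x :=
  pd_congr_on hg.isOpen hx (fun y hy => (hg.symm y hy).apply b a) c

theorem smooth_conn (hg : IsSmoothMetric U g) (c : Fin n) : SmoothMat (conn g c) U :=
  fun a b => hg.smooth.christoffel hg.isOpen hg.det_ne_zero a c b

theorem christoffel_symm (hg : IsSmoothMetric U g) (hx : x ∈ U) (a i j : Fin n) :
    christoffel g a i j x = christoffel g a j i x := by
  unfold christoffel
  congr 1
  refine Finset.sum_congr rfl fun l _ => ?_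
  rw [hg.pd_symm hx l i j]
  ring

/-- Metric compatibility of the Levi-Civita connection. -/
theorem pdM_metric (hg : IsSmoothMetric U g) (hx : x ∈ U) (c : Fin n) :
    pdM c g x = g x * conn g c x + (g x * conn g c x)ᵀ := by
  ext a b
  simp only [Matrix.add_apply, Matrix.transpose_apply, Matrix.mul_apply, conn, Matrix.of_apply,
    sum_metric_mul_christoffel (hg.det_ne_zero x hx), pdM]
  rw [hg.pd_symm hx c b a, hg.pd_symm hx b c a, hg.pd_symm hx a c b]
  ring

theorem transpose_metric (hg : IsSmoothMetric U g) (hx : x ∈ U) : (g x)ᵀ = g x := hg.symm x hx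

theorem pdM_metric' (hg : IsSmoothMetric U g) (hx : x ∈ U) (c : Fin n) :
    pdM c g x = g x * conn g c x + (conn g c x)ᵀ * g x := by
  rw [hg.pdM_metric hx, Matrix.transpose_mul, hg.transpose_metric hx]

theorem pdM_inv_metric (hg : IsSmoothMetric U g) (hx : x ∈ U) (c : Fin n) :
    pdM c (fun y => (g y)⁻¹) x = -(conn g c x * (g x)⁻¹ + (g x)⁻¹ * (conn g c x)ᵀ) := by
  have hu := (hg.det_ne_zero x hx).isUnit
  rw [pdM_inv hg.smooth hg.isOpen hx hg.det_ne_zero, hg.pdM_metric' hx, Matrix.mul_add,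
    Matrix.add_mul, ← Matrix.mul_assoc, Matrix.nonsing_inv_mul _ hu, Matrix.one_mul,
    Matrix.mul_assoc, Matrix.mul_assoc, Matrix.mul_nonsing_inv _ hu, Matrix.mul_one]

/-- The Riemann tensor is antisymmetric in its first pair of indices. -/
theorem metric_mul_curv (hg : IsSmoothMetric U g) (hx : x ∈ U) (c d : Fin n) :
    g x * curv g c d x + (curv g c d x)ᵀ * g x = 0 := by
  have hG := hg.smooth_conn
  -- Metric compatibility is differentiated once more. Since ∂_c and ∂_d commute on g, the
  -- difference of the two expressions vanishes, and it regroups into g R + Rᵀ g.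
  have key : ∀ c d, pdM c (pdM d g) x
      = (g x * conn g c x + (conn g c x)ᵀ * g x) * conn g d x + g x * pdM c (conn g d) x
        + ((pdM c (conn g d) x)ᵀ * g x
          + (conn g d x)ᵀ * (g x * conn g c x + (conn g c x)ᵀ * g x)) := by
    intro c d
    rw [pdM_congr_on hg.isOpen hx (fun y hy => hg.pdM_metric' hy d),
      pdM_add (hg.smooth.mul (hG d)) ((hG d).transpose.mul hg.smooth) hg.isOpen hx,
      pdM_mul hg.smooth (hG d) hg.isOpen hx, pdM_mul (hG d).transpose hg.smooth hg.isOpen hx,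
      hg.pdM_metric' hx, pdM_transpose]
  have h := pdM_pdM_comm hg.smooth hg.isOpen hx c d
  rw [key, key] at h
  rw [curv_eq]
  simp only [Matrix.transpose_add, Matrix.transpose_sub, Matrix.transpose_mul]
  have h' := sub_eq_zero.2 h
  rw [← h']
  noncomm_ring

theorem riemann_antisymm_left (hg : IsSmoothMetric U g) (hx : x ∈ U) (a b c d : Fin n) :
    riemann g a b c d x = -riemann g b a c d x := by
  have h := congrFun (congrFun (hg.metric_mul_curv hx c d) a) b
  have h2 : ((curv g c d x)ᵀ * g x) a b = riemann g b a c d x := by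
    simp only [Matrix.mul_apply, curv, riemann, Matrix.transpose_apply, Matrix.of_apply]
    exact Finset.sum_congr rfl fun e _ => by rw [(hg.symm x hx).apply b e, mul_comm]
  rw [Matrix.add_apply, h2] at h
  exact eq_neg_of_add_eq_zero_left h

theorem smooth_curv (hg : IsSmoothMetric U g) (c d : Fin n) : SmoothMat (curv g c d) U := by
  have h : curv g c d = fun x => _ := funext fun x => curv_eq g c d x
  rw [h]
  exact (((hg.smooth_conn d).pdM hg.isOpen c).sub ((hg.smooth_conn c).pdM hg.isOpen d)).add
    (((hg.smooth_conn c).mul (hg.smooth_conn d)).sub ((hg.smooth_conn d).mul (hg.smooth_conn c)))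

/-- The differential Bianchi identity. -/
theorem bianchi (hg : IsSmoothMetric U g) (hx : x ∈ U) (c d e : Fin n) :
    (pdM e (curv g c d) x + (conn g e x * curv g c d x - curv g c d x * conn g e x))
      + (pdM c (curv g d e) x + (conn g c x * curv g d e x - curv g d e x * conn g c x))
      + (pdM d (curv g e c) x + (conn g d x * curv g e c x - curv g e c x * conn g d x)) = 0 := by
  have hG := hg.smooth_conn
  -- In the cyclic sum the second derivatives of Γ cancel in pairs because partial derivatives
  -- commute; the remaining terms cancel by expansion, including the Jacobi identity for commutators
  -- of the connection matrices.
  have key : ∀ c d e, pdM e (curv g c d) x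
      = pdM e (pdM c (conn g d)) x - pdM e (pdM d (conn g c)) x
        + ((pdM e (conn g c) x * conn g d x + conn g c x * pdM e (conn g d) x)
          - (pdM e (conn g d) x * conn g c x + conn g d x * pdM e (conn g c) x)) := by
    intro c d e
    have h : curv g c d = fun x => _ := funext fun x => curv_eq g c d x
    rw [h, pdM_add (((hG d).pdM hg.isOpen c).sub ((hG c).pdM hg.isOpen d))
      (((hG c).mul (hG d)).sub ((hG d).mul (hG c))) hg.isOpen hx,
      pdM_sub ((hG d).pdM hg.isOpen c) ((hG c).pdM hg.isOpen d) hg.isOpen hx,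
      pdM_sub ((hG c).mul (hG d)) ((hG d).mul (hG c)) hg.isOpen hx,
      pdM_mul (hG c) (hG d) hg.isOpen hx, pdM_mul (hG d) (hG c) hg.isOpen hx]
  rw [key, key, key, curv_eq, curv_eq, curv_eq, pdM_pdM_comm (hG d) hg.isOpen hx e c,
    pdM_pdM_comm (hG e) hg.isOpen hx c d, pdM_pdM_comm (hG c) hg.isOpen hx d e]
  noncomm_ring

/-- The algebraic Bianchi identity. -/
theorem riemannUp_cyclic (hg : IsSmoothMetric U g) (hx : x ∈ U) (a b c d : Fin n) :
    riemannUp g a b c d x + riemannUp g a c d b x + riemannUp g a d b c x = 0 := by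
  -- The connection is torsion free, so after exchanging lower indices every term of the cyclic sum
  -- meets its negative.
  have hs : ∀ e a i j, pd e (christoffel g a i j) x = pd e (christoffel g a j i) x :=
    fun e a i j => pd_congr_on hg.isOpen hx (fun y hy => hg.christoffel_symm hy a i j) e
  simp only [riemannUp]
  rw [hs c a b d, hs b a c d, hs d a b c]
  have h1 : ∀ e, christoffel g e b d x = christoffel g e d b x :=
    fun e => hg.christoffel_symm hx e b d
  have h2 : ∀ e, christoffel g e b c x = christoffel g e c b x :=
    fun e => hg.christoffel_symm hx e b c
  have h3 : ∀ e, christoffel g e c d x = christoffel g e d c x :=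
    fun e => hg.christoffel_symm hx e c d
  simp only [h1, h2, h3, Finset.sum_sub_distrib]
  ring

theorem riemannUp_antisymm (g : TwoTensor n) (a b c d : Fin n) (x : Coord n) :
    riemannUp g a b c d x = -riemannUp g a b d c x := by
  simp only [riemannUp, Finset.sum_sub_distrib]
  ring

/-- The derivative of the volume density. -/
theorem pd_sqrt_abs_det (hg : IsSmoothMetric U g) (hx : x ∈ U) (c : Fin n) :
    pd c (fun y => √|(g y).det|) x = √|(g x).det| * ∑ b, christoffel g b c b x := by
  have h0 := hg.det_ne_zero x hx
  -- Jacobi's formula with ∂g = gΓ + Γᵀg: each summand contributes det g · tr Γ, and the square root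
  -- later removes the factor 2.
  have h1 : pd c (fun y => (g y).det) x = 2 * (g x).det * ∑ b, christoffel g b c b x := by
    rw [pd_det hg.smooth hg.isOpen hx, hg.pdM_metric' hx, Matrix.mul_add, ← Matrix.mul_assoc,
      Matrix.adjugate_mul, Matrix.trace_add, Matrix.trace_mul_comm (g x).adjugate,
      Matrix.mul_assoc, Matrix.mul_adjugate]
    have ht : (conn g c x).trace = ∑ b, christoffel g b c b x := rfl
    simp only [Matrix.smul_mul, Matrix.one_mul, Matrix.mul_smul, Matrix.mul_one,
      Matrix.trace_smul, Matrix.trace_transpose, ht, smul_eq_mul]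
    ring
  have hd : HasFDerivAt (fun y => (g y).det) (fderiv ℝ (fun y => (g y).det) x) x :=
    (SmoothOn.differentiableAt hg.smooth.det hg.isOpen hx).hasFDerivAt
  have h2 := (hd.abs h0).sqrt (abs_pos.2 h0).ne'
  rw [pd, h2.fderiv]
  have h3 : (fderiv ℝ (fun y => (g y).det) x) (EuclideanSpace.single c 1)
    = 2 * (g x).det * ∑ b, christoffel g b c b x := h1
  simp only [_root_.smul_apply, smul_eq_mul, h3]
  have h4 : ((SignType.sign (g x).det : ℝ)) * (g x).det = |(g x).det| := sign_mul_self _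
  have h5 : √|(g x).det| * √|(g x).det| = |(g x).det| := Real.mul_self_sqrt (abs_nonneg _)
  have h6 : √|(g x).det| ≠ 0 := (Real.sqrt_pos.2 (abs_pos.2 h0)).ne'
  field_simp
  linear_combination (∑ b, christoffel g b c b x) * (h4 - h5)

end IsSmoothMetric

end curvature

/-! ## Divergence identities for the curvature -/

section divergence

variable {n : ℕ} {U : Set (Coord n)} {g : TwoTensor n} {x : Coord n}

/-- The constant curvature matrices `δ^a_c g_{bd} - δ^a_d g_{bc}`. -/
def constCurv (g : TwoTensor n) (c d : Fin n) (x : Coord n) : Matrix (Fin n) (Fin n) ℝ :=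
  Matrix.of fun a b => (if a = c then g x b d else 0) - (if a = d then g x b c else 0)

/-- `T^a_{bcd}` is covariantly divergence free at `x` in the index `a`. -/
def IsDivFreeAt (g : TwoTensor n) (T : Fin n → Fin n → Coord n → Matrix (Fin n) (Fin n) ℝ)
    (x : Coord n) : Prop :=
  ∀ b c d, ∑ a, pdM a (T c d) x a b =
    -(∑ a, (∑ e, christoffel g e a e x) * T c d x a b) + ∑ a, (T c d x * conn g a x) a b
      + ∑ a, ∑ e, (christoffel g e a c x * T e d x a b + christoffel g e a d x * T c e x a b)

namespace IsSmoothMetric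

theorem pd_metric (hg : IsSmoothMetric U g) (hx : x ∈ U) (c a b : Fin n) :
    pd c (fun y => g y a b) x =
      ∑ e, g x a e * christoffel g e c b x + ∑ e, g x b e * christoffel g e c a x := by
  have h := congrFun (congrFun (hg.pdM_metric hx c) a) b
  simpa only [Matrix.add_apply, Matrix.transpose_apply, Matrix.mul_apply, conn, pdM,
    Matrix.of_apply] using h

theorem smooth_constCurv (hg : IsSmoothMetric U g) (c d : Fin n) :
    SmoothMat (constCurv g c d) U := by
  intro a b
  simp only [constCurv, Matrix.of_apply]
  refine ContDiffOn.sub ?_ ?_ <;> split_ifs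
  exacts [hg.smooth _ _, contDiffOn_const, hg.smooth _ _, contDiffOn_const]

/-- This is the contracted Bianchi identity. Of the three cyclic terms one is the divergence, and
the other two become derivatives of the Ricci tensor; since that is Λg, they cancel by metric
compatibility. -/
theorem isDivFreeAt_curv (hg : IsSmoothMetric U g) (hx : x ∈ U) {Λ : ℝ}
    (hric : ∀ y ∈ U, ∀ b d, ricci g b d y = Λ * g y b d) : IsDivFreeAt g (curv g) x := by
  intro b c d
  have hB : ∑ a, (pdM a (curv g c d) x a b
      + ((conn g a x * curv g c d x) a b - (curv g c d x * conn g a x) a b)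
      + (pdM c (curv g d a) x a b
        + ((conn g c x * curv g d a x) a b - (curv g d a x * conn g c x) a b))
      + (pdM d (curv g a c) x a b
        + ((conn g d x * curv g a c x) a b - (curv g a c x * conn g d x) a b))) = 0 := by
    refine Finset.sum_eq_zero fun a _ => ?_
    exact congrFun (congrFun (hg.bianchi hx c d a) a) b
  have r1 : ∀ y ∈ U, ∀ b d, ∑ a, curv g a d y a b = Λ * g y b d := fun y hy b d => hric y hy b d
  have r2 : ∀ y ∈ U, ∀ b d, ∑ a, curv g d a y a b = -(Λ * g y b d) := by
    intro y hy b d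
    rw [← r1 y hy, ← Finset.sum_neg_distrib]
    exact Finset.sum_congr rfl fun a _ => riemannUp_antisymm g a b d a y
  have d1 : ∑ a, pdM c (curv g d a) x a b = -(Λ * pd c (fun y => g y b d) x) := by
    rw [← pd_const_mul (hg.smooth.differentiableAt hg.isOpen hx b d), ← pd_neg,
      ← pd_congr_on hg.isOpen hx (fun y hy => r2 y hy b d), pd_sum (fun a _ =>
        (hg.smooth_curv d a).differentiableAt hg.isOpen hx a b)]
    rfl
  have d2 : ∑ a, pdM d (curv g a c) x a b = Λ * pd d (fun y => g y b c) x := by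
    rw [← pd_const_mul (hg.smooth.differentiableAt hg.isOpen hx b c),
      ← pd_congr_on hg.isOpen hx (fun y hy => r1 y hy b c), pd_sum (fun a _ =>
        (hg.smooth_curv a c).differentiableAt hg.isOpen hx a b)]
    rfl
  have e1 : ∑ a, (curv g d a x * conn g c x) a b
      = -(Λ * ∑ e, g x d e * christoffel g e c b x) := by
    simp only [Matrix.mul_apply]
    rw [Finset.sum_comm]
    simp only [← Finset.sum_mul, r2 x hx, Finset.mul_sum, ← Finset.sum_neg_distrib]
    exact Finset.sum_congr rfl fun e _ => by
      rw [(hg.symm x hx).apply d e]; simp only [conn, Matrix.of_apply]; ring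
  have e2 : ∑ a, (curv g a c x * conn g d x) a b
      = Λ * ∑ e, g x c e * christoffel g e d b x := by
    simp only [Matrix.mul_apply]
    rw [Finset.sum_comm]
    simp only [← Finset.sum_mul, r1 x hx, Finset.mul_sum]
    exact Finset.sum_congr rfl fun e _ => by
      rw [(hg.symm x hx).apply c e]; simp only [conn, Matrix.of_apply]; ring
  have f1 : ∑ a, (conn g a x * curv g c d x) a b
      = ∑ a, (∑ e, christoffel g e a e x) * curv g c d x a b := by
    simp only [Matrix.mul_apply, Finset.sum_mul]
    rw [Finset.sum_comm]
    refine Finset.sum_congr rfl fun e _ => Finset.sum_congr rfl fun a _ => ?_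
    simp only [conn, Matrix.of_apply, hg.christoffel_symm hx a a e]
  have f2 : ∑ a, (conn g c x * curv g d a x) a b
      = -∑ a, ∑ e, christoffel g e a c x * curv g e d x a b := by
    simp only [Matrix.mul_apply, ← Finset.sum_neg_distrib]
    rw [Finset.sum_comm]
    refine Finset.sum_congr rfl fun e _ => Finset.sum_congr rfl fun a _ => ?_
    simp only [conn, curv, Matrix.of_apply]
    rw [riemannUp_antisymm, hg.christoffel_symm hx a c e]
    ring
  have f3 : ∑ a, (conn g d x * curv g a c x) a b
      = -∑ a, ∑ e, christoffel g e a d x * curv g c e x a b := by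
    simp only [Matrix.mul_apply, ← Finset.sum_neg_distrib]
    rw [Finset.sum_comm]
    refine Finset.sum_congr rfl fun e _ => Finset.sum_congr rfl fun a _ => ?_
    simp only [conn, curv, Matrix.of_apply]
    rw [riemannUp_antisymm, hg.christoffel_symm hx a d e]
    ring
  have hs : ∀ e, christoffel g e c d x = christoffel g e d c x :=
    fun e => hg.christoffel_symm hx e c d
  simp only [Finset.sum_add_distrib, Finset.sum_sub_distrib] at hB ⊢
  rw [d1, d2, e1, e2, f1, f2, f3, hg.pd_metric hx, hg.pd_metric hx] at hB
  simp only [hs] at hB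
  linear_combination hB

/-- The tensor is built from g and δ alone, so it is covariantly constant. -/
theorem isDivFreeAt_constCurv (hg : IsSmoothMetric U g) (hx : x ∈ U) :
    IsDivFreeAt g (constCurv g) x := by
  intro b c d
  have h1 : ∀ a, pdM a (constCurv g c d) x a b =
      (if a = c then pd a (fun y => g y b d) x else 0)
        - (if a = d then pd a (fun y => g y b c) x else 0) := by
    intro a
    have hd : ∀ (p : Prop) [Decidable p] (k : Fin n),
        DifferentiableAt ℝ (fun y => if p then g y b k else 0) x := by
      intro p _ k
      split_ifs
      exacts [hg.smooth.differentiableAt hg.isOpen hx _ _, differentiableAt_const _]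
    simp only [pdM, constCurv, Matrix.of_apply]
    rw [pd_sub (hd _ _) (hd _ _)]
    congr 1 <;> split_ifs <;> first | rfl | exact pd_const _ _
  have hs : ∀ e a c, christoffel g e a c x = christoffel g e c a x :=
    fun e a c => hg.christoffel_symm hx e a c
  simp only [h1, Matrix.mul_apply, constCurv, conn, Matrix.of_apply, mul_sub, sub_mul,
    Finset.sum_sub_distrib, Finset.sum_add_distrib, mul_ite, ite_mul, mul_zero, zero_mul,
    Finset.sum_ite_eq', Finset.mem_univ, if_true, hg.pd_metric hx]
  have h2 : ∀ (u : Fin n) (f : Fin n → Fin n → ℝ),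
      ∑ a, ∑ e, (if a = u then f a e else 0) = ∑ e, f u e := by
    intro u f
    rw [Finset.sum_comm]
    simp
  have h3 : ∀ (f : Fin n → Fin n → ℝ), ∑ a, ∑ e, (if a = e then f a e else 0) = ∑ a, f a a := by
    intro f
    simp
  simp only [h2, h3]
  have h4 : ∀ (u : Fin n) (f : Fin n → ℝ), ∑ e, g x e u * f e = ∑ e, g x u e * f e := fun u f =>
    Finset.sum_congr rfl fun e _ => by rw [(hg.symm x hx).apply u e]
  have h5 : ∀ (f : Fin n → ℝ) (r : ℝ), ∑ e, f e * r = (∑ e, f e) * r := fun f r =>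
    (Finset.sum_mul ..).symm
  have h6 : ∀ u, ∑ e, christoffel g e u e x = ∑ e, christoffel g e e u x := fun u =>
    Finset.sum_congr rfl fun e _ => hs e u e
  have h7 : ∀ u k l, ∑ e, christoffel g e k l x * g x u e = ∑ e, g x u e * christoffel g e k l x :=
    fun u k l => Finset.sum_congr rfl fun e _ => mul_comm _ _
  have h8 : ∀ e, christoffel g e d c x = christoffel g e c d x := fun e => hs e d c
  simp only [h4, h5, h6, h7, h8]
  ring

end IsSmoothMetric

theorem IsDivFreeAt.sub {T S : Fin n → Fin n → Coord n → Matrix (Fin n) (Fin n) ℝ}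
    (hT : IsDivFreeAt g T x) (hS : IsDivFreeAt g S x) (hU : IsOpen U) (hx : x ∈ U)
    (sT : ∀ c d, SmoothMat (T c d) U) (sS : ∀ c d, SmoothMat (S c d) U) (r : ℝ) :
    IsDivFreeAt g (fun c d y => T c d y - r • S c d y) x := by
  intro b c d
  have h : ∀ a, pdM a (fun y => T c d y - r • S c d y) x a b
      = pdM a (T c d) x a b - r * pdM a (S c d) x a b := by
    intro a
    exact (pd_sub ((sT c d).differentiableAt hU hx a b)
      (((sS c d).differentiableAt hU hx a b).const_mul r) a).trans
      (congrArg _ (pd_const_mul ((sS c d).differentiableAt hU hx a b) r a))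
  simp only [h, Finset.sum_sub_distrib, ← Finset.mul_sum, hT b c d, hS b c d, Matrix.sub_mul,
    Matrix.sub_apply, Matrix.smul_apply, smul_eq_mul, Matrix.smul_mul, mul_sub,
    Finset.sum_add_distrib, mul_left_comm _ r]
  ring

/-- Divergence of `w T^{a z}_{cd} v^c` where `w` is the volume density and `z` a fixed coordinate,
for a divergence free tensor `T` that is antisymmetric in its first two indices. -/
theorem IsDivFreeAt.divergence {T : Fin n → Fin n → Coord n → Matrix (Fin n) (Fin n) ℝ}
    (hT : IsDivFreeAt g T x) (hg : IsSmoothMetric U g) (hx : x ∈ U)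
    (sT : ∀ c d, SmoothMat (T c d) U)
    (hanti : ∀ c d a e, (T c d x * (g x)⁻¹) a e = -(T c d x * (g x)⁻¹) e a)
    {v : Fin n → Coord n → ℝ} (hv : ∀ c, SmoothOn (v c) U) (z d : Fin n) :
    ∑ a, pd a (fun y => ∑ c, √|(g y).det| * (T c d y * (g y)⁻¹) a z * v c y) x
      = √|(g x).det| * ∑ a, ∑ c, ((T c d x * (g x)⁻¹) a z
            * (pd a (v c) x + ∑ e, christoffel g c a e x * v e x)
          + ∑ e, (T c e x * (g x)⁻¹) a z * christoffel g e a d x * v c x) := by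
  have hi := hg.smooth.inv hg.det_ne_zero
  set w := fun y => √|(g y).det| with hw
  have sw : DifferentiableAt ℝ w x :=
    ((SmoothOn.differentiableAt hg.smooth.det hg.isOpen hx).abs (hg.det_ne_zero x hx)).sqrt
      (abs_pos.2 (hg.det_ne_zero x hx)).ne'
  set S : Fin n → Fin n → Coord n → Matrix (Fin n) (Fin n) ℝ :=
    fun c d y => T c d y * (g y)⁻¹ with hS
  have sS : ∀ c d, SmoothMat (S c d) U := fun c d => (sT c d).mul hi
  have dS : ∀ c d, ∑ a, pdM a (S c d) x a z =
      -(∑ a, (∑ e, christoffel g e a e x) * S c d x a z)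
      + ∑ a, ∑ e, (christoffel g e a c x * S e d x a z + christoffel g e a d x * S c e x a z) := by
    intro c d
    have h1 : ∀ a, pdM a (S c d) x a z = ∑ b, pdM a (T c d) x a b * (g x)⁻¹ b z
        - ∑ b, (T c d x * conn g a x) a b * (g x)⁻¹ b z
        - ∑ e, S c d x a e * christoffel g z a e x := by
      intro a
      rw [hS]
      simp only
      rw [pdM_mul (sT c d) hi hg.isOpen hx, hg.pdM_inv_metric hx, Matrix.add_apply,
        Matrix.mul_apply, Matrix.mul_neg, Matrix.mul_add, ← Matrix.mul_assoc, ← Matrix.mul_assoc,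
        Matrix.neg_apply, Matrix.add_apply, Matrix.mul_apply (M := T c d x * conn g a x),
        Matrix.mul_apply (M := T c d x * (g x)⁻¹)]
      simp only [Matrix.transpose_apply, conn, Matrix.of_apply]
      ring
    -- The connection term of the second upper index pairs Γ^z_{ae}, symmetric in a and e, with
    -- S^{ae}, which is antisymmetric. It drops out, which is why `z` may be frozen as if it were a
    -- mere label.
    have h2 : ∑ a, ∑ e, S c d x a e * christoffel g z a e x = 0 := by
      have : ∑ a, ∑ e, S c d x a e * christoffel g z a e x
          = -∑ a, ∑ e, S c d x a e * christoffel g z a e x := by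
        conv_lhs => rw [Finset.sum_comm]
        simp only [← Finset.sum_neg_distrib]
        refine Finset.sum_congr rfl fun a _ => Finset.sum_congr rfl fun e _ => ?_
        have he : S c d x e a = -S c d x a e := hanti c d e a
        rw [he, hg.christoffel_symm hx z e a]
        ring
      linarith
    simp only [h1, Finset.sum_sub_distrib, h2]
    have h3 : ∑ a, ∑ b, pdM a (T c d) x a b * (g x)⁻¹ b z
        = ∑ b, (∑ a, pdM a (T c d) x a b) * (g x)⁻¹ b z := by
      rw [Finset.sum_comm]
      simp only [Finset.sum_mul]
    rw [h3]
    simp only [hT _ c d, add_mul, neg_mul, Finset.sum_add_distrib, Finset.sum_neg_distrib,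
      Finset.sum_mul]
    have h4 : ∀ (f : Fin n → Fin n → ℝ) (r : Fin n → Fin n → ℝ),
        ∑ b, ∑ a, ∑ e, r e a * f a b * (g x)⁻¹ b z = ∑ a, ∑ e, r e a * ∑ b, f a b * (g x)⁻¹ b z := by
      intro f r
      rw [Finset.sum_comm]
      refine Finset.sum_congr rfl fun a _ => ?_
      rw [Finset.sum_comm]
      simp only [Finset.mul_sum, mul_assoc]
    have h5 : ∀ (f : Fin n → Fin n → Fin n → ℝ) (r : Fin n → Fin n → ℝ),
        ∑ b, ∑ a, ∑ e, r e a * f e a b * (g x)⁻¹ b z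
          = ∑ a, ∑ e, r e a * ∑ b, f e a b * (g x)⁻¹ b z := by
      intro f r
      rw [Finset.sum_comm]
      refine Finset.sum_congr rfl fun a _ => ?_
      rw [Finset.sum_comm]
      simp only [Finset.mul_sum, mul_assoc]
    rw [h4 (fun a b => T c d x a b) (fun e a => christoffel g e a e x),
      h5 (fun e a b => T e d x a b) (fun e a => christoffel g e a c x),
      h5 (fun e a b => T c e x a b) (fun e a => christoffel g e a d x)]
    rw [Finset.sum_comm (f := fun b a => (T c d x * conn g a x) a b * (g x)⁻¹ b z)]
    simp only [hS, Matrix.mul_apply (N := (g x)⁻¹)]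
    ring
  have h1 : ∀ a, pd a (fun y => ∑ c, w y * S c d y a z * v c y) x
      = ∑ c, (w x * (∑ e, christoffel g e a e x) * S c d x a z * v c x
        + w x * pdM a (S c d) x a z * v c x + w x * S c d x a z * pd a (v c) x) := by
    intro a
    have hSd : ∀ c, DifferentiableAt ℝ (fun y => S c d y a z) x := fun c =>
      (sS c d).differentiableAt hg.isOpen hx a z
    have hvd : ∀ c, DifferentiableAt ℝ (v c) x := fun c =>
      SmoothOn.differentiableAt (hv c) hg.isOpen hx
    rw [pd_sum (f := fun c y => w y * S c d y a z * v c y)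
      (fun c _ => (sw.mul (hSd c)).mul (hvd c))]
    refine Finset.sum_congr rfl fun c _ => ?_
    rw [pd_mul (f := fun y => w y * S c d y a z) (sw.mul (hSd c)) (hvd c), pd_mul sw (hSd c),
      hw, hg.pd_sqrt_abs_det hx]
    simp only [pdM, Matrix.of_apply]
    ring
  have h2 : ∑ a, ∑ c, w x * pdM a (S c d) x a z * v c x
      = ∑ c, w x * (∑ a, pdM a (S c d) x a z) * v c x := by
    rw [Finset.sum_comm]
    simp only [Finset.sum_mul, Finset.mul_sum]
  have h3 : ∑ c, ∑ a, ∑ e, w x * (christoffel g e a c x * S e d x a z) * v c x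
      = ∑ a, ∑ c, ∑ e, w x * (S c d x a z * (christoffel g c a e x * v e x)) := by
    rw [Finset.sum_comm]
    refine Finset.sum_congr rfl fun a _ => ?_
    rw [Finset.sum_comm]
    refine Finset.sum_congr rfl fun c _ => Finset.sum_congr rfl fun e _ => ?_
    ring
  have h4 : ∑ c, ∑ a, ∑ e, w x * (christoffel g e a d x * S c e x a z) * v c x
      = ∑ a, ∑ c, ∑ e, w x * (S c e x a z * christoffel g e a d x * v c x) := by
    rw [Finset.sum_comm]
    refine Finset.sum_congr rfl fun a _ => Finset.sum_congr rfl fun c _ =>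
      Finset.sum_congr rfl fun e _ => ?_
    ring
  have h5 : ∑ c, w x * (∑ a, (∑ e, christoffel g e a e x) * S c d x a z) * v c x
      = ∑ a, ∑ c, w x * (∑ e, christoffel g e a e x) * S c d x a z * v c x := by
    rw [Finset.sum_comm]
    refine Finset.sum_congr rfl fun c _ => ?_
    rw [Finset.mul_sum, Finset.sum_mul]
    exact Finset.sum_congr rfl fun a _ => by ring
  change ∑ a, pd a (fun y => ∑ c, w y * S c d y a z * v c y) x = w x * ∑ a, ∑ c, (S c d x a z
    * (pd a (v c) x + ∑ e, christoffel g c a e x * v e x)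
      + ∑ e, S c e x a z * christoffel g e a d x * v c x)
  -- The derivative of the density w cancels the trace Γ^e_{ae} in the divergence of S. The
  -- connection term of the index `c` joins ∂v to form ∇v; that of the index `d` has nothing to pair
  -- with and stays.
  simp only [h1, Finset.sum_add_distrib, h2, dS]
  simp only [mul_add, add_mul, mul_neg, neg_mul, Finset.sum_add_distrib, Finset.sum_neg_distrib,
    h5]
  simp only [Finset.mul_sum, Finset.sum_mul] at h3 h4 ⊢
  rw [h3, h4]
  simp only [mul_assoc]
  ring

/-- Cyclic derivative of `n_a R^a_{bkl}`. -/
theorem IsSmoothMetric.cyclic_derivative (hg : IsSmoothMetric U g) (hx : x ∈ U)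
    {v : Fin n → Coord n → ℝ} (hv : ∀ c, SmoothOn (v c) U) (b k l m : Fin n) :
    pd m (fun y => ∑ a, v a y * curv g k l y a b) x + pd k (fun y => ∑ a, v a y * curv g l m y a b) x
      + pd l (fun y => ∑ a, v a y * curv g m k y a b) x
    = (∑ a, (pd m (v a) x - ∑ e, v e x * christoffel g e m a x) * curv g k l x a b
        + ∑ e, (∑ a, v a x * curv g k l x a e) * christoffel g e m b x)
      + (∑ a, (pd k (v a) x - ∑ e, v e x * christoffel g e k a x) * curv g l m x a b
        + ∑ e, (∑ a, v a x * curv g l m x a e) * christoffel g e k b x)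
      + (∑ a, (pd l (v a) x - ∑ e, v e x * christoffel g e l a x) * curv g m k x a b
        + ∑ e, (∑ a, v a x * curv g m k x a e) * christoffel g e l b x) := by
  have hd : ∀ k l m b, pd m (fun y => ∑ a, v a y * curv g k l y a b) x
      = ∑ a, pd m (v a) x * curv g k l x a b + ∑ a, v a x * pdM m (curv g k l) x a b := by
    intro k l m b
    have hvd : ∀ c, DifferentiableAt ℝ (v c) x := fun c =>
      SmoothOn.differentiableAt (hv c) hg.isOpen hx
    have hRd : ∀ a, DifferentiableAt ℝ (fun y => curv g k l y a b) x := fun a =>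
      (hg.smooth_curv k l).differentiableAt hg.isOpen hx a b
    rw [pd_sum (f := fun a y => v a y * curv g k l y a b) (fun a _ => (hvd a).mul (hRd a)),
      ← Finset.sum_add_distrib]
    exact Finset.sum_congr rfl fun a _ => pd_mul (hvd a) (hRd a) m
  -- The differential Bianchi identity contracted with v. Connection matrices on the left of R turn
  -- ∂v into ∇v; those on the right remain as connection terms for `b`.
  have hB : ∑ a, v a x * ((pdM m (curv g k l) x a b
      + ((conn g m x * curv g k l x) a b - (curv g k l x * conn g m x) a b))
      + (pdM k (curv g l m) x a b
        + ((conn g k x * curv g l m x) a b - (curv g l m x * conn g k x) a b))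
      + (pdM l (curv g m k) x a b
        + ((conn g l x * curv g m k x) a b - (curv g m k x * conn g l x) a b))) = 0 := by
    refine Finset.sum_eq_zero fun a _ => ?_
    exact mul_eq_zero_of_right _ (congrFun (congrFun (hg.bianchi hx k l m) a) b)
  have h1 : ∀ k l m, ∑ a, v a x * (curv g k l x * conn g m x) a b
      = ∑ e, (∑ a, v a x * curv g k l x a e) * christoffel g e m b x := by
    intro k l m
    simp only [Matrix.mul_apply, Finset.mul_sum, Finset.sum_mul]
    rw [Finset.sum_comm]
    simp only [conn, Matrix.of_apply, mul_assoc]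
  have h2 : ∀ k l m, ∑ a, v a x * (conn g m x * curv g k l x) a b
      = ∑ a, (∑ e, v e x * christoffel g e m a x) * curv g k l x a b := by
    intro k l m
    simp only [Matrix.mul_apply, Finset.mul_sum, Finset.sum_mul]
    rw [Finset.sum_comm]
    simp only [conn, Matrix.of_apply, mul_assoc]
  simp only [mul_add, mul_sub, Finset.sum_add_distrib, Finset.sum_sub_distrib, h1, h2] at hB
  simp only [hd, sub_mul, Finset.sum_sub_distrib]
  linear_combination hB

end divergence

section

/-! ## Vacuum spacetimes foliated by spacelike hypersurfaces -/

/-- A vacuum spacetime in which the level sets of the time coordinate are spacelike. -/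
structure IsFoliatedVacuum (Λ : ℝ) (U : Set (Coord 4)) (g : TwoTensor 4) : Prop
    extends IsVacuumSpacetime Λ U g where
  inv_zero_zero_neg : ∀ p ∈ U, (g p)⁻¹ 0 0 < 0

variable {Λ : ℝ} {U : Set (Coord 4)} {g : TwoTensor 4} {p : Coord 4}

namespace IsVacuumSpacetime

theorem det_neg (hg : IsVacuumSpacetime Λ U g) (hp : p ∈ U) : (g p).det < 0 := by
  obtain ⟨P, hP, h⟩ := hg.lorentzian p hp
  have h1 := congrArg Matrix.det h
  rw [Matrix.det_mul, Matrix.det_mul, Matrix.det_transpose, Matrix.det_diagonal] at h1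
  simp only [Fin.prod_univ_four, Matrix.cons_val_zero, Matrix.cons_val_one, Matrix.cons_val] at h1
  nlinarith [sq_nonneg P.det]

theorem isSmoothMetric (hg : IsVacuumSpacetime Λ U g) : IsSmoothMetric U g where
  isOpen := hg.isOpen
  smooth := hg.smooth
  symm := hg.symm
  det_ne_zero _ hp := (hg.det_neg hp).ne

/-- Tracing the field equation in dimension four gives R - 2R + 4Λ = 0, so R = 4Λ, and substituting
back leaves Λg. -/
theorem ricci_eq (hg : IsVacuumSpacetime Λ U g) (hp : p ∈ U) (b d : Fin 4) :
    ricci g b d p = Λ * g p b d := by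
  have hu : IsUnit (g p).det := (hg.det_neg hp).ne.isUnit
  have hsym : ∀ a b, g p a b = g p b a := fun a b => (hg.symm p hp).apply b a
  have htr : ∑ b, ∑ d, (g p)⁻¹ b d * g p b d = 4 := by
    have h1 : ((g p)⁻¹ * g p).trace = 4 := by
      rw [Matrix.nonsing_inv_mul _ hu, Matrix.trace_one]; simp
    rw [← h1, Matrix.trace]
    simp only [Matrix.diag_apply, Matrix.mul_apply]
    exact Finset.sum_congr rfl fun b _ => Finset.sum_congr rfl fun d _ => by rw [hsym b d]
  have h : scalarCurv g p - (1 / 2) * scalarCurv g p * 4 + Λ * 4 = 0 := by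
    have h0 : ∑ b, ∑ d, (g p)⁻¹ b d *
        (ricci g b d p - (1 / 2) * scalarCurv g p * g p b d + Λ * g p b d) = 0 :=
      Finset.sum_eq_zero fun b _ => Finset.sum_eq_zero fun d _ => by
        rw [hg.einstein p hp, mul_zero]
    rw [← htr]
    simp only [mul_add, mul_sub, Finset.sum_add_distrib, Finset.sum_sub_distrib] at h0
    simp only [Finset.mul_sum]
    rw [← h0]
    refine congrArg₂ _ (congrArg₂ _ rfl ?_) ?_ <;>
    exact Finset.sum_congr rfl fun b _ => Finset.sum_congr rfl fun d _ => by ring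
  have h2 := hg.einstein p hp b d
  have h3 : scalarCurv g p = 4 * Λ := by linarith
  rw [h3] at h2
  linarith

/-- With Ricci tensor Λg and R = 4Λ, the Ricci terms contribute -Λ and the scalar term 2Λ/3 to the
coefficient of the constant-curvature tensor, in total -Λ/3. -/
theorem weyl_eq (hg : IsVacuumSpacetime Λ U g) (hp : p ∈ U) (a b c d : Fin 4) :
    weyl g a b c d p
      = riemann g a b c d p - Λ / 3 * (g p a c * g p b d - g p a d * g p b c) := by
  have hu : IsUnit (g p).det := (hg.det_neg hp).ne.isUnit
  have hsym : ∀ a b, g p a b = g p b a := fun a b => (hg.symm p hp).apply b a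
  have h3 : scalarCurv g p = 4 * Λ := by
    have htr : ∑ b, ∑ d, (g p)⁻¹ b d * g p b d = 4 := by
      have h1 : ((g p)⁻¹ * g p).trace = 4 := by
        rw [Matrix.nonsing_inv_mul _ hu, Matrix.trace_one]; simp
      rw [← h1, Matrix.trace]
      simp only [Matrix.diag_apply, Matrix.mul_apply]
      exact Finset.sum_congr rfl fun b _ => Finset.sum_congr rfl fun d _ => by rw [hsym b d]
    simp only [scalarCurv, hg.ricci_eq hp, mul_left_comm _ Λ, ← Finset.mul_sum, htr]
    ring
  simp only [weyl, hg.ricci_eq hp, h3]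
  rw [hsym d b, hsym c b, hsym d a, hsym c a]
  ring

/-- The Weyl tensor with first index raised, as matrices in the first two indices. -/
def _root_.GravCharge.weylUp (Λ : ℝ) (g : TwoTensor 4) (c d : Fin 4) (p : Coord 4) :
    Matrix (Fin 4) (Fin 4) ℝ := curv g c d p - (Λ / 3) • constCurv g c d p

theorem smooth_weylUp (hg : IsVacuumSpacetime Λ U g) (c d : Fin 4) :
    SmoothMat (weylUp Λ g c d) U := fun a b =>
  ContDiffOn.sub (hg.isSmoothMetric.smooth_curv c d a b)
    (ContDiffOn.const_smul (Λ / 3) (hg.isSmoothMetric.smooth_constCurv c d a b))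

/-- Both the curvature and its constant-curvature part are divergence free. This is the equation
that constrains the electric part. -/
theorem isDivFreeAt_weylUp (hg : IsVacuumSpacetime Λ U g) (hp : p ∈ U) :
    IsDivFreeAt g (weylUp Λ g) p :=
  (hg.isSmoothMetric.isDivFreeAt_curv hp fun _ hy b d => hg.ricci_eq hy b d).sub
    (hg.isSmoothMetric.isDivFreeAt_constCurv hp) hg.isOpen hp
    hg.isSmoothMetric.smooth_curv hg.isSmoothMetric.smooth_constCurv (Λ / 3)

theorem metric_mul_weylUp (hg : IsVacuumSpacetime Λ U g) (hp : p ∈ U) (a b c d : Fin 4) :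
    (g p * weylUp Λ g c d p) a b = weyl g a b c d p := by
  rw [hg.weyl_eq hp, weylUp, Matrix.mul_sub, Matrix.sub_apply, Matrix.mul_smul, Matrix.smul_apply,
    smul_eq_mul]
  congr 1
  congr 1
  simp [Matrix.mul_apply, constCurv, mul_sub]

theorem weylUp_apply (hg : IsVacuumSpacetime Λ U g) (hp : p ∈ U) (a b c d : Fin 4) :
    weylUp Λ g c d p a b = ∑ e, (g p)⁻¹ a e * weyl g e b c d p := by
  have hu : IsUnit (g p).det := (hg.det_neg hp).ne.isUnit
  have h : weylUp Λ g c d p = (g p)⁻¹ * (g p * weylUp Λ g c d p) := by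
    rw [← Matrix.mul_assoc, Matrix.nonsing_inv_mul _ hu, Matrix.one_mul]
  rw [h, Matrix.mul_apply]
  exact Finset.sum_congr rfl fun e _ => by rw [hg.metric_mul_weylUp hp]

theorem riemann_antisymm_right (g : TwoTensor 4) (a b c d : Fin 4) (p : Coord 4) :
    riemann g a b c d p = -riemann g a b d c p := by
  simp only [riemann, ← Finset.sum_neg_distrib]
  exact Finset.sum_congr rfl fun e _ => by
    rw [IsSmoothMetric.riemannUp_antisymm g e b c d]; ring

theorem weyl_antisymm_left (hg : IsVacuumSpacetime Λ U g) (hp : p ∈ U) (a b c d : Fin 4) :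
    weyl g a b c d p = -weyl g b a c d p := by
  rw [hg.weyl_eq hp, hg.weyl_eq hp, hg.isSmoothMetric.riemann_antisymm_left hp]
  ring

theorem weyl_antisymm_right (hg : IsVacuumSpacetime Λ U g) (hp : p ∈ U) (a b c d : Fin 4) :
    weyl g a b c d p = -weyl g a b d c p := by
  rw [hg.weyl_eq hp, hg.weyl_eq hp, riemann_antisymm_right]
  ring

theorem weyl_cyclic (hg : IsVacuumSpacetime Λ U g) (hp : p ∈ U) (a b c d : Fin 4) :
    weyl g a b c d p + weyl g a c d b p + weyl g a d b c p = 0 := by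
  have hsym : ∀ a b, g p a b = g p b a := fun a b => (hg.symm p hp).apply b a
  have h : riemann g a b c d p + riemann g a c d b p + riemann g a d b c p = 0 := by
    simp only [riemann, ← Finset.sum_add_distrib, ← mul_add,
      hg.isSmoothMetric.riemannUp_cyclic hp, mul_zero, Finset.sum_const_zero]
  rw [hg.weyl_eq hp, hg.weyl_eq hp, hg.weyl_eq hp, hsym d b, hsym d c, hsym c b]
  linear_combination h

/-- Exchange of pairs is not an independent symmetry: it is a linear consequence of the two
antisymmetries and the four cyclic identities obtained by rotating the indices. -/
theorem weyl_pair_symm (hg : IsVacuumSpacetime Λ U g) (hp : p ∈ U) (a b c d : Fin 4) :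
    weyl g a b c d p = weyl g c d a b p := by
  have l := hg.weyl_antisymm_left hp
  have r := hg.weyl_antisymm_right hp
  have y := hg.weyl_cyclic hp
  have y1 := y a b c d
  have y2 := y b c d a
  have y3 := y c d a b
  have y4 := y d a b c
  linarith [l a b c d, l a c d b, l a d b c, l b c d a, l b d a c, l c d a b, l c a b d, l c b d a,
    r a b c d, r a c d b, r a d b c, r b c d a, r b d a c, r b a c d, r c d a b, r c a b d,
    r c b d a, r d a b c, r d b c a, r d c a b, l d a b c, l d b c a, l d c a b, r c d b a,
    l b a c d, l b a d c, r d b a c, r d a c b, r c b a d, r c a d b, r b c a d, r a c b d]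

theorem weyl_trace (hg : IsVacuumSpacetime Λ U g) (hp : p ∈ U) (b d : Fin 4) :
    ∑ a, ∑ c, (g p)⁻¹ a c * weyl g a b c d p = 0 := by
  have hsi : ∀ a b, (g p)⁻¹ a b = (g p)⁻¹ b a := fun a b => (hg.symm p hp).inv.apply b a
  have h : ∑ a, weylUp Λ g a d p a b = 0 := by
    have h1 : ∑ a, curv g a d p a b = Λ * g p b d := hg.ricci_eq hp b d
    -- The factor 3 is n - 1 for n = 4; it matches the coefficient Λ/3, so the trace Λ - 3 · Λ/3
    -- vanishes.
    have h2 : ∑ a, constCurv g a d p a b = 3 * g p b d := by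
      simp [constCurv, Finset.sum_sub_distrib]
      ring
    simp only [weylUp, Matrix.sub_apply, Matrix.smul_apply, smul_eq_mul, Finset.sum_sub_distrib,
      ← Finset.mul_sum, h1, h2]
    ring
  simp only [hg.weylUp_apply hp] at h
  rw [Finset.sum_comm, ← h]
  exact Finset.sum_congr rfl fun a _ => Finset.sum_congr rfl fun c _ => by rw [hsi c a]

theorem weylUp_mul_inv_antisymm (hg : IsVacuumSpacetime Λ U g) (hp : p ∈ U) (c d a e : Fin 4) :
    (weylUp Λ g c d p * (g p)⁻¹) a e = -(weylUp Λ g c d p * (g p)⁻¹) e a := by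
  have hsi : ∀ a b, (g p)⁻¹ a b = (g p)⁻¹ b a := fun a b => (hg.symm p hp).inv.apply b a
  simp only [Matrix.mul_apply, hg.weylUp_apply hp, Finset.sum_mul, ← Finset.sum_neg_distrib]
  conv_lhs => rw [Finset.sum_comm]
  refine Finset.sum_congr rfl fun b _ => Finset.sum_congr rfl fun f _ => ?_
  rw [hg.weyl_antisymm_left hp b f, hsi f e, hsi a b]
  ring

end IsVacuumSpacetime

/-! ### The unit normal -/

namespace IsFoliatedVacuum

theorem lapse_pos (hg : IsFoliatedVacuum Λ U g) (hp : p ∈ U) : 0 < lapse g p :=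
  inv_pos.2 (Real.sqrt_pos.2 (neg_pos.2 (hg.inv_zero_zero_neg p hp)))

theorem lapse_sq (hg : IsFoliatedVacuum Λ U g) (hp : p ∈ U) :
    lapse g p ^ 2 * (g p)⁻¹ 0 0 = -1 := by
  have h := hg.inv_zero_zero_neg p hp
  rw [lapse, inv_pow, Real.sq_sqrt (neg_pos.2 h).le, inv_neg, neg_mul, inv_mul_cancel₀ h.ne]

theorem _root_.GravCharge.unitNormal_eq (g : TwoTensor 4) (a : Fin 4) (p : Coord 4) :
    unitNormal g a p = -(lapse g p * (g p)⁻¹ a 0) := by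
  simp [unitNormal, conormal]
  ring

/-- The induced metric at a point of the spacetime. -/
def _root_.GravCharge.spatial (A : Matrix (Fin 4) (Fin 4) ℝ) : Matrix (Fin 3) (Fin 3) ℝ :=
  Matrix.of fun i j => A i.succ j.succ

/-- The right side is the inverse of the projection g + n ⊗ n. It is verified as a right inverse
from two columns of g g⁻¹ = 1, the spatial column and column 0, which is proportional to n. -/
theorem spatial_inv (hg : IsFoliatedVacuum Λ U g) (hp : p ∈ U) (i j : Fin 3) :
    (spatial (g p))⁻¹ i j = (g p)⁻¹ i.succ j.succ
      + unitNormal g i.succ p * unitNormal g j.succ p := by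
  have hu : IsUnit (g p).det := (hg.det_neg hp).ne.isUnit
  have hsi : ∀ a b, (g p)⁻¹ a b = (g p)⁻¹ b a := fun a b => (hg.symm p hp).inv.apply b a
  have hm : ∀ a c, ∑ e, g p a e * (g p)⁻¹ e c = if a = c then 1 else 0 := by
    intro a c
    rw [← Matrix.mul_apply, Matrix.mul_nonsing_inv _ hu, Matrix.one_apply]
  have key : spatial (g p) * Matrix.of (fun i j : Fin 3 => (g p)⁻¹ i.succ j.succ
      + unitNormal g i.succ p * unitNormal g j.succ p) = 1 := by
    ext i j
    have h1 := hm i.succ j.succ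
    have h2 := hm i.succ 0
    rw [Fin.sum_univ_succ] at h1 h2
    simp only [Fin.succ_inj, Fin.succ_ne_zero, if_false] at h1 h2
    have hl := hg.lapse_sq hp
    simp only [Matrix.mul_apply, spatial, Matrix.of_apply, Matrix.one_apply, mul_add,
      Finset.sum_add_distrib, unitNormal_eq]
    have h3 : ∑ k : Fin 3, g p i.succ k.succ * (-(lapse g p * (g p)⁻¹ k.succ 0)
        * -(lapse g p * (g p)⁻¹ j.succ 0))
        = lapse g p ^ 2 * (g p)⁻¹ j.succ 0 * ∑ k : Fin 3, g p i.succ k.succ * (g p)⁻¹ k.succ 0 := by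
      rw [Finset.mul_sum]
      exact Finset.sum_congr rfl fun k _ => by ring
    rw [h3, hsi j.succ 0]
    linear_combination h1 + lapse g p ^ 2 * (g p)⁻¹ 0 j.succ * h2
      - g p i.succ 0 * (g p)⁻¹ 0 j.succ * hl
  rw [Matrix.inv_eq_right_inv key]
  rfl

/-- Splitting of a metric contraction into its tangential and normal parts. -/
theorem sum_inv_metric (hg : IsFoliatedVacuum Λ U g) (hp : p ∈ U) (f : Fin 4 → Fin 4 → ℝ) :
    ∑ a, ∑ b, (g p)⁻¹ a b * f a b
      = ∑ i, ∑ j, (spatial (g p))⁻¹ i j * f (Fin.succ i) (Fin.succ j)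
        - ∑ a, ∑ b, unitNormal g a p * unitNormal g b p * f a b := by
  have hsi : ∀ a b, (g p)⁻¹ a b = (g p)⁻¹ b a := fun a b => (hg.symm p hp).inv.apply b a
  have hl := hg.lapse_sq hp
  -- Since nᵃ = -N g^{a0} and N² g^{00} = -1, the time row and column of g⁻¹ are purely normal.
  have h0 : ∀ a, (g p)⁻¹ a 0 = -(unitNormal g a p * unitNormal g 0 p) := by
    intro a
    rw [unitNormal_eq, unitNormal_eq]
    linear_combination (g p)⁻¹ a 0 * hl
  have h0' : ∀ a, (g p)⁻¹ 0 a = -(unitNormal g 0 p * unitNormal g a p) := by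
    intro a
    rw [hsi, h0, mul_comm]
  simp only [hg.spatial_inv hp, Fin.sum_univ_succ (n := 3), h0, h0', add_mul,
    Finset.sum_add_distrib, neg_mul, Finset.sum_neg_distrib]
  ring

/-- For a covector annihilated by n the normal part of the contraction is a multiple of V · n = 0,
so the spatial metric alone raises the index. -/
theorem sum_inv_metric_succ (hg : IsFoliatedVacuum Λ U g) (hp : p ∈ U) {V : Fin 4 → ℝ}
    (hV : ∑ a, V a * unitNormal g a p = 0) (k : Fin 3) :
    ∑ b, (g p)⁻¹ k.succ b * V b = ∑ l, (spatial (g p))⁻¹ k l * V l.succ := by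
  have h := hg.sum_inv_metric hp fun a b => if a = k.succ then V b else 0
  have h2 : ∑ a, ∑ b, unitNormal g a p * unitNormal g b p * (if a = k.succ then V b else 0) = 0 := by
    have : ∀ a, ∑ b, unitNormal g a p * unitNormal g b p * (if a = k.succ then V b else 0)
        = (if a = k.succ then unitNormal g a p else 0) * ∑ b, V b * unitNormal g b p := by
      intro a
      rw [Finset.mul_sum]
      exact Finset.sum_congr rfl fun b _ => by split_ifs <;> ring
    simp only [this, hV, mul_zero, Finset.sum_const_zero]
  rw [h2, sub_zero, Finset.sum_comm] at h
  simpa [Finset.sum_comm (γ := Fin 3), Fin.succ_inj] using h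

/-- The row g^{0b} is a nonzero multiple of the unit normal, so a raised tangential covector has no
time component. -/
theorem sum_inv_metric_zero (hg : IsFoliatedVacuum Λ U g) (hp : p ∈ U) {V : Fin 4 → ℝ}
    (hV : ∑ a, V a * unitNormal g a p = 0) : ∑ b, (g p)⁻¹ 0 b * V b = 0 := by
  have hsi : ∀ a b, (g p)⁻¹ a b = (g p)⁻¹ b a := fun a b => (hg.symm p hp).inv.apply b a
  have h : -lapse g p * ∑ b, (g p)⁻¹ 0 b * V b = 0 := by
    rw [← hV, Finset.mul_sum]
    exact Finset.sum_congr rfl fun b _ => by rw [unitNormal_eq, hsi 0 b]; ring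
  exact (mul_eq_zero.1 h).resolve_left (neg_ne_zero.2 (hg.lapse_pos hp).ne')

/-- Pairing with a tangential covector only sees the spatial components of the lowered vector. This
projects spacetime covariant derivatives to the slice. -/
theorem sum_mul_eq_spatial (hg : IsFoliatedVacuum Λ U g) (hp : p ∈ U) {V : Fin 4 → ℝ}
    (hV : ∑ a, V a * unitNormal g a p = 0) (Y : Fin 4 → ℝ) :
    ∑ e, V e * Y e = ∑ k, ∑ l, (spatial (g p))⁻¹ k l * V (Fin.succ l)
      * ∑ e, g p (Fin.succ k) e * Y e := by
  have hu : IsUnit (g p).det := (hg.det_neg hp).ne.isUnit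
  have hsi : ∀ a b, (g p)⁻¹ a b = (g p)⁻¹ b a := fun a b => (hg.symm p hp).inv.apply b a
  have h1 : ∑ e, V e * Y e = ∑ f, (∑ e, (g p)⁻¹ f e * V e) * (fun f => ∑ c, g p f c * Y c) f := by
    have h2 : ∀ e, Y e = ∑ f, (g p)⁻¹ e f * (fun f => ∑ c, g p f c * Y c) f := by
      intro e
      have h3 : (g p)⁻¹ *ᵥ (g p *ᵥ Y) = Y := by
        rw [Matrix.mulVec_mulVec, Matrix.nonsing_inv_mul _ hu, Matrix.one_mulVec]
      exact (congrFun h3 e).symm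
    conv_lhs =>
      enter [2, e]
      rw [h2 e]
    generalize (fun f => ∑ c, g p f c * Y c) = Z
    simp only [Finset.mul_sum, Finset.sum_mul]
    rw [Finset.sum_comm]
    refine Finset.sum_congr rfl fun f _ => Finset.sum_congr rfl fun e _ => ?_
    rw [hsi e f]
    ring
  rw [h1, Fin.sum_univ_succ, hg.sum_inv_metric_zero hp hV, zero_mul, zero_add]
  refine Finset.sum_congr rfl fun k _ => ?_
  rw [hg.sum_inv_metric_succ hp hV, Finset.sum_mul]

/-- By Cramer's rule g^{00} det g = det γ, and g^{00} = -1/N². Positivity of det γ follows since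
g^{00} and det g are both negative. -/
theorem sqrt_abs_det (hg : IsFoliatedVacuum Λ U g) (hp : p ∈ U) :
    √|(g p).det| = lapse g p * √(spatial (g p)).det ∧ 0 < (spatial (g p)).det := by
  have hd := hg.det_neg hp
  have h1 : (g p)⁻¹ 0 0 * (g p).det = (spatial (g p)).det := by
    rw [Matrix.inv_def, Matrix.smul_apply, Ring.inverse_eq_inv, smul_eq_mul,
      Matrix.adjugate_fin_succ_eq_det_submatrix]
    have : (g p).submatrix (Fin.succAbove 0) (Fin.succAbove 0) = spatial (g p) := by
      ext i j; simp [spatial]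
    rw [this]
    field_simp [hd.ne]
    simp
  have h2 : 0 < (spatial (g p)).det := by
    rw [← h1]; exact mul_pos_of_neg_of_neg (hg.inv_zero_zero_neg p hp) hd
  refine ⟨?_, h2⟩
  have h3 : |(g p).det| = lapse g p ^ 2 * (spatial (g p)).det := by
    rw [abs_of_neg hd, ← h1]
    linear_combination (-(g p).det) * hg.lapse_sq hp
  rw [h3, Real.sqrt_mul (sq_nonneg _), Real.sqrt_sq (hg.lapse_pos hp).le]

theorem sum_conormal_mul_unitNormal (hg : IsFoliatedVacuum Λ U g) (hp : p ∈ U) :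
    ∑ a, conormal g a p * unitNormal g a p = -1 := by
  have h := hg.lapse_sq hp
  simp only [conormal, unitNormal_eq, ite_mul, zero_mul, Finset.sum_ite_eq', Finset.mem_univ,
    if_true]
  linear_combination h

end IsFoliatedVacuum

end

section

/-! ### Derivatives of the unit normal -/

/-- The covariant derivative `∇_a n_f` of the unit conormal. -/
def covNormal (g : TwoTensor 4) (a f : Fin 4) (p : Coord 4) : ℝ :=
  pd a (conormal g f) p - ∑ e, conormal g e p * christoffel g e a f p

variable {Λ : ℝ} {U : Set (Coord 4)} {g : TwoTensor 4} {p : Coord 4}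

namespace IsFoliatedVacuum

theorem smooth_inv (hg : IsFoliatedVacuum Λ U g) : SmoothMat (fun p => (g p)⁻¹) U :=
  hg.isSmoothMetric.smooth.inv hg.isSmoothMetric.det_ne_zero

theorem smooth_conormal (hg : IsFoliatedVacuum Λ U g) (a : Fin 4) : SmoothOn (conormal g a) U := by
  have h : SmoothOn (lapse g) U := by
    have h0 : ∀ p ∈ U, -(g p)⁻¹ 0 0 ≠ 0 := fun p hp => (neg_pos.2 (hg.inv_zero_zero_neg p hp)).ne'
    exact ContDiffOn.inv (ContDiffOn.sqrt (ContDiffOn.neg (hg.smooth_inv 0 0)) h0)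
      fun p hp => (Real.sqrt_pos.2 (neg_pos.2 (hg.inv_zero_zero_neg p hp))).ne'
  by_cases ha : a = 0
  · have : conormal g a = fun p => -lapse g p := funext fun p => if_pos ha
    rw [this]
    exact ContDiffOn.neg h
  · have : conormal g a = fun p => 0 := funext fun p => if_neg ha
    rw [this]
    exact contDiffOn_const

theorem smooth_unitNormal (hg : IsFoliatedVacuum Λ U g) (a : Fin 4) :
    SmoothOn (unitNormal g a) U :=
  ContDiffOn.sum fun b _ => ContDiffOn.mul (hg.smooth_inv a b) (hg.smooth_conormal b)

/-- Raising the index of `∇_a n_f`. -/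
theorem covDeriv_unitNormal (hg : IsFoliatedVacuum Λ U g) (hp : p ∈ U) (a c : Fin 4) :
    pd a (unitNormal g c) p + ∑ e, christoffel g c a e p * unitNormal g e p
      = ∑ f, (g p)⁻¹ c f * covNormal g a f p := by
  have hm := hg.isSmoothMetric
  have h1 : pd a (unitNormal g c) p
      = ∑ f, (pd a (fun q => (g q)⁻¹ c f) p * conormal g f p
        + (g p)⁻¹ c f * pd a (conormal g f) p) := by
    have hi : ∀ f, DifferentiableAt ℝ (fun q => (g q)⁻¹ c f) p := fun f =>
      hg.smooth_inv.differentiableAt hg.isOpen hp c f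
    have hn : ∀ f, DifferentiableAt ℝ (conormal g f) p := fun f =>
      SmoothOn.differentiableAt (hg.smooth_conormal f) hg.isOpen hp
    have : unitNormal g c = fun q => ∑ f, (g q)⁻¹ c f * conormal g f q := rfl
    rw [this, pd_sum (f := fun f q => (g q)⁻¹ c f * conormal g f q) fun f _ => (hi f).mul (hn f)]
    exact Finset.sum_congr rfl fun f _ => pd_mul (hi f) (hn f) a
  have h2 : ∀ f, pd a (fun q => (g q)⁻¹ c f) p
      = -(∑ e, christoffel g c a e p * (g p)⁻¹ e f + ∑ e, (g p)⁻¹ c e * christoffel g f a e p) := by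
    intro f
    have h := congrFun (congrFun (hm.pdM_inv_metric hp a) c) f
    change pdM a (fun q => (g q)⁻¹) p c f = _
    simpa only [Matrix.neg_apply, Matrix.add_apply, Matrix.mul_apply, Matrix.transpose_apply, conn,
      Matrix.of_apply] using h
  have h3 : ∑ f, (∑ e, christoffel g c a e p * (g p)⁻¹ e f) * conormal g f p
      = ∑ e, christoffel g c a e p * unitNormal g e p := by
    simp only [unitNormal, Finset.mul_sum, Finset.sum_mul, mul_assoc]
    rw [Finset.sum_comm]
  have h4 : ∑ f, (∑ e, (g p)⁻¹ c e * christoffel g f a e p) * conormal g f p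
      = ∑ f, (g p)⁻¹ c f * ∑ e, conormal g e p * christoffel g e a f p := by
    simp only [Finset.mul_sum, Finset.sum_mul]
    rw [Finset.sum_comm]
    exact Finset.sum_congr rfl fun f _ => Finset.sum_congr rfl fun e _ => by ring
  simp only [h1, h2, covNormal, mul_sub, neg_mul, add_mul, Finset.sum_add_distrib,
    Finset.sum_neg_distrib, Finset.sum_sub_distrib, h3, h4]
  ring

/-- Differentiate n_f n^f = -1: both halves of the product rule equal the same contraction, up to
Christoffel terms that cancel. -/
theorem sum_covNormal_mul_unitNormal (hg : IsFoliatedVacuum Λ U g) (hp : p ∈ U) (a : Fin 4) :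
    ∑ f, covNormal g a f p * unitNormal g f p = 0 := by
  have hsi : ∀ a b, (g p)⁻¹ a b = (g p)⁻¹ b a := fun a b => (hg.symm p hp).inv.apply b a
  have hn : ∀ f, DifferentiableAt ℝ (conormal g f) p := fun f =>
    SmoothOn.differentiableAt (hg.smooth_conormal f) hg.isOpen hp
  have hu : ∀ f, DifferentiableAt ℝ (unitNormal g f) p := fun f =>
    SmoothOn.differentiableAt (hg.smooth_unitNormal f) hg.isOpen hp
  have h1 : ∑ f, (pd a (conormal g f) p * unitNormal g f p
      + conormal g f p * pd a (unitNormal g f) p) = 0 := by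
    have h := pd_sum (f := fun f q => conormal g f q * unitNormal g f q) (s := Finset.univ)
      (fun f _ => (hn f).mul (hu f)) a
    rw [pd_congr_on hg.isOpen hp (fun q hq => hg.sum_conormal_mul_unitNormal hq), pd_const] at h
    rw [h]
    exact Finset.sum_congr rfl fun f _ => (pd_mul (hn f) (hu f) a).symm
  have h2 : ∑ f, conormal g f p * pd a (unitNormal g f) p
      = ∑ f, covNormal g a f p * unitNormal g f p
        - ∑ f, ∑ e, conormal g f p * christoffel g f a e p * unitNormal g e p := by
    have h3 : ∀ f, pd a (unitNormal g f) p = ∑ e, (g p)⁻¹ f e * covNormal g a e p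
        - ∑ e, christoffel g f a e p * unitNormal g e p := fun f => by
      rw [← hg.covDeriv_unitNormal hp]; ring
    simp only [h3, mul_sub, Finset.sum_sub_distrib, Finset.mul_sum, mul_assoc]
    congr 1
    rw [Finset.sum_comm]
    refine Finset.sum_congr rfl fun f _ => ?_
    simp only [unitNormal, Finset.mul_sum]
    exact Finset.sum_congr rfl fun e _ => by rw [hsi e f]; ring
  have h4 : ∑ f, pd a (conormal g f) p * unitNormal g f p
      = ∑ f, covNormal g a f p * unitNormal g f p
        + ∑ f, ∑ e, conormal g f p * christoffel g f a e p * unitNormal g e p := by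
    simp only [covNormal, sub_mul, Finset.sum_sub_distrib, Finset.sum_mul]
    rw [Finset.sum_comm (f := fun f e => conormal g f p * christoffel g f a e p * unitNormal g e p)]
    ring
  rw [Finset.sum_add_distrib, h2, h4] at h1
  linarith

/-- The spatial components of the conormal vanish identically, so only the Christoffel term
survives, and it is symmetric. Hence K is symmetric. -/
theorem covNormal_symm (hg : IsFoliatedVacuum Λ U g) (hp : p ∈ U) (i j : Fin 3) :
    covNormal g i.succ j.succ p = covNormal g j.succ i.succ p := by
  have h : ∀ k : Fin 3, conormal g k.succ = fun _ => 0 := fun k =>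
    funext fun q => if_neg (Fin.succ_ne_zero k)
  simp only [covNormal, h, pd_const,
    hg.isSmoothMetric.christoffel_symm hp _ i.succ j.succ]

/-! ### The electric and magnetic parts at a point of the spacetime -/

/-- The contraction `W_{jbkl} n^b` on the hypersurface. -/
def _root_.GravCharge.normalWeyl (g : TwoTensor 4) (p : Coord 4) (j k l : Fin 3) : ℝ :=
  ∑ b, weyl g j.succ b k.succ l.succ p * unitNormal g b p

/-- The contraction `W_{lbcd} n^b n^c`. -/
def _root_.GravCharge.normalWeyl₂ (g : TwoTensor 4) (p : Coord 4) (l d : Fin 4) : ℝ :=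
  ∑ b, ∑ c, weyl g l b c d p * unitNormal g b p * unitNormal g c p

theorem sum_antisymm_eq_zero {n : ℕ} {A : Fin n → Fin n → ℝ} (hA : ∀ a b, A a b = -A b a)
    (v : Fin n → ℝ) : ∑ a, ∑ b, A a b * v a * v b = 0 := by
  have h : ∑ a, ∑ b, A a b * v a * v b = -∑ a, ∑ b, A a b * v a * v b := by
    conv_lhs => rw [Finset.sum_comm]
    simp only [← Finset.sum_neg_distrib]
    exact Finset.sum_congr rfl fun a _ => Finset.sum_congr rfl fun b _ => by rw [hA b a]; ring
  linarith

theorem normalWeyl₂_mul_right (hg : IsFoliatedVacuum Λ U g) (hp : p ∈ U) (l : Fin 4) :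
    ∑ d, normalWeyl₂ g p l d * unitNormal g d p = 0 := by
  have h : ∑ d, normalWeyl₂ g p l d * unitNormal g d p
      = ∑ b, (∑ c, ∑ d, weyl g l b c d p * unitNormal g c p * unitNormal g d p)
        * unitNormal g b p := by
    simp only [normalWeyl₂, Finset.sum_mul]
    rw [Finset.sum_comm]
    refine Finset.sum_congr rfl fun b _ => ?_
    rw [Finset.sum_comm]
    exact Finset.sum_congr rfl fun c _ => Finset.sum_congr rfl fun b _ => by ring
  rw [h]
  exact Finset.sum_eq_zero fun b _ => by
    rw [sum_antisymm_eq_zero (fun c d => hg.weyl_antisymm_right hp l b c d), zero_mul]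

theorem normalWeyl₂_symm (hg : IsFoliatedVacuum Λ U g) (hp : p ∈ U) (l d : Fin 4) :
    normalWeyl₂ g p l d = normalWeyl₂ g p d l := by
  simp only [normalWeyl₂]
  rw [Finset.sum_comm]
  refine Finset.sum_congr rfl fun b _ => Finset.sum_congr rfl fun c _ => ?_
  rw [hg.weyl_pair_symm hp l c b d, hg.weyl_antisymm_left hp b d, hg.weyl_antisymm_right hp d b]
  ring

theorem _root_.GravCharge.electricPart_eq (g : TwoTensor 4) (x : Coord 3) (i j : Fin 3) :
    electricPart g x i j = normalWeyl₂ g (slice x) i.succ j.succ := rfl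

theorem sum_sum_sum_sum_comm {ι κ : Type*} [Fintype ι] [Fintype κ] (F : ι → ι → κ → κ → ℝ) :
    ∑ a, ∑ d, ∑ b, ∑ c, F a d b c = ∑ b, ∑ c, ∑ a, ∑ d, F a d b c :=
  calc ∑ a, ∑ d, ∑ b, ∑ c, F a d b c = ∑ a, ∑ b, ∑ d, ∑ c, F a d b c :=
        Finset.sum_congr rfl fun _ _ => Finset.sum_comm
    _ = ∑ b, ∑ a, ∑ d, ∑ c, F a d b c := Finset.sum_comm
    _ = ∑ b, ∑ a, ∑ c, ∑ d, F a d b c :=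
        Finset.sum_congr rfl fun b _ => Finset.sum_congr rfl fun _ _ => Finset.sum_comm
    _ = ∑ b, ∑ c, ∑ a, ∑ d, F a d b c := Finset.sum_congr rfl fun _ _ => Finset.sum_comm

/-- The electric part of the Weyl tensor is trace free. -/
theorem trace_electric (hg : IsFoliatedVacuum Λ U g) (hp : p ∈ U) :
    ∑ i, ∑ j, (spatial (g p))⁻¹ i j * normalWeyl₂ g p i.succ j.succ = 0 := by
  -- Split the spacetime trace: it vanishes because the Weyl tensor is trace free, and its normal
  -- part vanishes because W contracted with three normals is zero.
  have h := hg.sum_inv_metric hp fun a b => normalWeyl₂ g p a b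
  have h1 : ∑ a, ∑ b, unitNormal g a p * unitNormal g b p * normalWeyl₂ g p a b = 0 := by
    refine Finset.sum_eq_zero fun a _ => ?_
    have := hg.normalWeyl₂_mul_right hp a
    rw [← mul_zero (unitNormal g a p), ← this, Finset.mul_sum]
    exact Finset.sum_congr rfl fun b _ => by ring
  have h2 : ∑ a, ∑ b, (g p)⁻¹ a b * normalWeyl₂ g p a b = 0 := by
    have h3 : ∑ a, ∑ b, (g p)⁻¹ a b * normalWeyl₂ g p a b
        = ∑ b, ∑ c, (∑ a, ∑ d, (g p)⁻¹ a d * -weyl g a b d c p)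
          * unitNormal g b p * unitNormal g c p := by
      simp only [normalWeyl₂, Finset.mul_sum, Finset.sum_mul]
      rw [sum_sum_sum_sum_comm]
      refine Finset.sum_congr rfl fun b _ => Finset.sum_congr rfl fun c _ =>
        Finset.sum_congr rfl fun a _ => Finset.sum_congr rfl fun d _ => ?_
      rw [hg.weyl_antisymm_right hp a b c d]
      ring
    rw [h3]
    refine Finset.sum_eq_zero fun b _ => Finset.sum_eq_zero fun c _ => ?_
    have := hg.weyl_trace hp b c
    simp only [mul_neg, Finset.sum_neg_distrib, this, neg_zero, zero_mul]
  rw [h1, h2, sub_zero] at h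
  exact h.symm

/-- Contraction of the tangential components of the Weyl tensor. -/
theorem contract_tangential (hg : IsFoliatedVacuum Λ U g) (hp : p ∈ U) (j l : Fin 3) :
    ∑ i, ∑ k, (spatial (g p))⁻¹ i k * weyl g (Fin.succ i) j.succ (Fin.succ k) l.succ p
      = -normalWeyl₂ g p j.succ l.succ := by
  have h := hg.sum_inv_metric hp fun a c => weyl g a j.succ c l.succ p
  rw [hg.weyl_trace hp] at h
  have h1 : ∑ a, ∑ b, unitNormal g a p * unitNormal g b p * weyl g a j.succ b l.succ p
      = -normalWeyl₂ g p j.succ l.succ := by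
    simp only [normalWeyl₂, ← Finset.sum_neg_distrib]
    exact Finset.sum_congr rfl fun a _ => Finset.sum_congr rfl fun b _ => by
      rw [hg.weyl_antisymm_left hp]; ring
  linarith

/-- The dual `½ [mkl] W_{iakl} n^a` of the tangential part of `W_{iakl} n^a`. -/
def _root_.GravCharge.normalWeylDual (g : TwoTensor 4) (p : Coord 4) : Matrix (Fin 3) (Fin 3) ℝ :=
  Matrix.of fun i m => normalWeyl g p i (m + 1) (m + 2)

theorem normalWeyl_antisymm (hg : IsFoliatedVacuum Λ U g) (hp : p ∈ U) (i k l : Fin 3) :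
    normalWeyl g p i k l = -normalWeyl g p i l k := by
  simp only [normalWeyl, ← Finset.sum_neg_distrib]
  exact Finset.sum_congr rfl fun b _ => by rw [hg.weyl_antisymm_right hp]; ring

theorem normalWeyl_cyclic (hg : IsFoliatedVacuum Λ U g) (hp : p ∈ U) (i k l : Fin 3) :
    normalWeyl g p i k l + normalWeyl g p k l i + normalWeyl g p l i k = 0 := by
  simp only [normalWeyl, ← Finset.sum_add_distrib]
  refine Finset.sum_eq_zero fun b _ => ?_
  rw [← add_mul, ← add_mul, hg.weyl_antisymm_left hp i.succ, hg.weyl_antisymm_left hp k.succ,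
    hg.weyl_antisymm_left hp l.succ]
  have h := hg.weyl_cyclic hp b i.succ k.succ l.succ
  linear_combination (-unitNormal g b p) * h

/-- The spacetime trace of W is zero, and its normal part contracts n ⊗ n with the antisymmetric
first pair. -/
theorem trace_normalWeyl (hg : IsFoliatedVacuum Λ U g) (hp : p ∈ U) (q : Fin 3) :
    ∑ i, ∑ k, (spatial (g p))⁻¹ i k * normalWeyl g p i q k = 0 := by
  have h := hg.sum_inv_metric hp fun a c =>
    ∑ b, weyl g a b q.succ c p * unitNormal g b p
  have h1 : ∑ a, ∑ c, (g p)⁻¹ a c * ∑ b, weyl g a b q.succ c p * unitNormal g b p = 0 := by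
    have h2 : ∑ a, ∑ c, (g p)⁻¹ a c * ∑ b, weyl g a b q.succ c p * unitNormal g b p
        = ∑ b, (∑ a, ∑ c, (g p)⁻¹ a c * -weyl g a b c q.succ p) * unitNormal g b p := by
      simp only [Finset.mul_sum, Finset.sum_mul]
      conv_rhs => rw [Finset.sum_comm]
      refine Finset.sum_congr rfl fun a _ => ?_
      rw [Finset.sum_comm]
      exact Finset.sum_congr rfl fun b _ => Finset.sum_congr rfl fun c _ => by
        rw [hg.weyl_antisymm_right hp a b q.succ c]; ring
    rw [h2]
    refine Finset.sum_eq_zero fun b _ => ?_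
    have := hg.weyl_trace hp b q.succ
    simp only [mul_neg, Finset.sum_neg_distrib, this, neg_zero, zero_mul]
  have h3 : ∑ a, ∑ c, unitNormal g a p * unitNormal g c p
      * ∑ b, weyl g a b q.succ c p * unitNormal g b p = 0 := by
    rw [Finset.sum_comm]
    refine Finset.sum_eq_zero fun c _ => ?_
    rw [← mul_zero (unitNormal g c p),
      ← sum_antisymm_eq_zero (fun a b => hg.weyl_antisymm_left hp a b q.succ c)
      (fun a => unitNormal g a p)]
    simp only [Finset.mul_sum]
    exact Finset.sum_congr rfl fun a _ => Finset.sum_congr rfl fun b _ => by ring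
  rw [h1, h3, sub_zero] at h
  exact h.symm

/-- The trace of the dual is exactly the cyclic sum over the indices 0, 1, 2. -/
theorem trace_normalWeylDual (hg : IsFoliatedVacuum Λ U g) (hp : p ∈ U) :
    (normalWeylDual g p).trace = 0 := by
  have h := hg.normalWeyl_cyclic hp 0 1 2
  simp only [Matrix.trace, Fin.sum_univ_three, Matrix.diag_apply, normalWeylDual, Matrix.of_apply]
  simpa using h

/-- The antisymmetric part of this matrix consists of the three spatial traces of W_{iakl} nᵃ, all
of which vanish. It underlies the symmetry of B. -/
theorem inv_mul_normalWeylDual_isSymm (hg : IsFoliatedVacuum Λ U g) (hp : p ∈ U) :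
    ((spatial (g p))⁻¹ * normalWeylDual g p).IsSymm := by
  have hsym : ∀ i j, (spatial (g p))⁻¹ i j = (spatial (g p))⁻¹ j i := by
    intro i j
    have : (spatial (g p)).IsSymm := by
      ext i j; exact (hg.symm p hp).apply i.succ j.succ
    exact this.inv.apply j i
  have h0 := hg.trace_normalWeyl hp 0
  have h1 := hg.trace_normalWeyl hp 1
  have h2 := hg.trace_normalWeyl hp 2
  have ha := hg.normalWeyl_antisymm hp
  have hd : ∀ i k, normalWeyl g p i k k = 0 := fun i k => by linarith [ha i k k]
  simp only [Fin.sum_univ_three, hd, mul_zero] at h0 h1 h2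
  simp only [hsym 1 0, hsym 2 0, hsym 2 1, ha _ 1 0, ha _ 2 0, ha _ 2 1] at h0 h1 h2
  -- Addition in `Fin 3` wraps around, so (m, m + 1, m + 2) runs through the even permutations and
  -- encodes [mkl] without signs.
  have e1 : (1 : Fin 3) + 1 = 2 := rfl
  have e2 : (1 : Fin 3) + 2 = 0 := rfl
  have e3 : (2 : Fin 3) + 1 = 0 := rfl
  have e4 : (2 : Fin 3) + 2 = 1 := rfl
  refine Matrix.IsSymm.ext fun i j => ?_
  simp only [Matrix.mul_apply, Fin.sum_univ_three, normalWeylDual, Matrix.of_apply]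
  fin_cases i <;> fin_cases j <;>
  simp only [Fin.zero_eta, Fin.mk_one, Fin.reduceFinMk, zero_add, e1, e2, e3, e4, hsym 1 0,
    hsym 2 0, hsym 2 1, ha _ 1 0, ha _ 2 0, ha _ 2 1] <;>
  linarith

/-- The selection matrix times the Vandermonde matrix of 0, 1, 2, 3 is the Vandermonde matrix of a,
b, c, d. The divisor 12 is the Vandermonde determinant of 0, 1, 2, 3. -/
theorem _root_.GravCharge.altSymbol_eq (a b c d : Fin 4) :
    altSymbol a b c d = (((b : ℕ) : ℝ) - (a : ℕ)) * (((c : ℕ) : ℝ) - (a : ℕ))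
      * (((d : ℕ) : ℝ) - (a : ℕ)) * (((c : ℕ) : ℝ) - (b : ℕ))
      * (((d : ℕ) : ℝ) - (b : ℕ)) * (((d : ℕ) : ℝ) - (c : ℕ)) / 12 := by
  have h1 : (Matrix.of fun i j : Fin 4 => if ![a, b, c, d] i = j then (1 : ℝ) else 0)
      * Matrix.vandermonde (fun i : Fin 4 => ((i : ℕ) : ℝ))
      = Matrix.vandermonde (fun i => ((![a, b, c, d] i : ℕ) : ℝ)) := by
    ext i j
    simp [Matrix.mul_apply, Matrix.vandermonde]
  have h2 := congrArg Matrix.det h1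
  rw [Matrix.det_mul, Matrix.det_vandermonde, Matrix.det_vandermonde] at h2
  simp [Fin.prod_univ_succ] at h2
  rw [altSymbol]
  linear_combination h2 / 12

/-- Contracting ε with n fixes one slot of the alternating symbol to the time index, so the
remaining sum over s, t is over spatial pairs and reproduces the three-dimensional dual. -/
theorem sqrt_det_mul_magneticPart (hg : IsFoliatedVacuum Λ U g) {x : Coord 3}
    (hx : slice x ∈ U) :
    √(spatial (g (slice x))).det • magneticPart g x
      = normalWeylDual g (slice x) * spatial (g (slice x)) := by
  set p := slice x with hp
  have hu : IsUnit (g p).det := (hg.det_neg hx).ne.isUnit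
  have hn : ∀ s, ∑ ν, g p s ν * unitNormal g ν p = conormal g s p := by
    intro s
    have h : g p *ᵥ ((g p)⁻¹ *ᵥ fun ν => conormal g ν p) = fun ν => conormal g ν p := by
      rw [Matrix.mulVec_mulVec, Matrix.mul_nonsing_inv _ hu, Matrix.one_mulVec]
    exact congrFun h s
  obtain ⟨hw, hd⟩ := hg.sqrt_abs_det hx
  have hN := hg.lapse_pos hx
  have hs : 0 < √(spatial (g p)).det := Real.sqrt_pos.2 hd
  -- Lowering n gives the conormal, whose only component is -N in slot 0; the lapse then cancels
  -- against √|det g| = N √det γ.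
  have hε : ∀ s t j, ∑ ν, leviCivitaMixed g s t ν j p * unitNormal g ν p
      = (√(spatial (g p)).det)⁻¹ * ∑ u, altSymbol s t 0 u * g p u j := by
    intro s t j
    have h1 : ∀ ν, leviCivitaMixed g s t ν j p * unitNormal g ν p
        = ∑ a, ∑ u, -altSymbol s t a u / √|(g p).det| * g p u j
          * (g p a ν * unitNormal g ν p) := by
      intro ν
      simp only [leviCivitaMixed, Finset.sum_mul]
      exact Finset.sum_congr rfl fun a _ => Finset.sum_congr rfl fun u _ => by ring
    simp only [h1]
    rw [Finset.sum_comm]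
    have h2 : ∀ a, ∑ ν, ∑ u, -altSymbol s t a u / √|(g p).det| * g p u j
          * (g p a ν * unitNormal g ν p)
        = (∑ u, -altSymbol s t a u / √|(g p).det| * g p u j) * conormal g a p := by
      intro a
      rw [← hn a, Finset.sum_comm, Finset.sum_mul]
      exact Finset.sum_congr rfl fun u _ => by rw [Finset.mul_sum]
    simp only [h2, conormal, mul_ite, mul_zero, Finset.sum_ite_eq', Finset.mem_univ, if_true]
    rw [Finset.sum_mul, Finset.mul_sum, hw]
    exact Finset.sum_congr rfl fun u _ => by field_simp
  ext i j
  set A : Fin 4 → Fin 4 → ℝ := fun s t => ∑ μ, weyl g i.succ μ s t p * unitNormal g μ p with hA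
  have hanti : ∀ s t, A s t = -A t s := by
    intro s t
    simp only [hA, ← Finset.sum_neg_distrib]
    exact Finset.sum_congr rfl fun b _ => by rw [hg.weyl_antisymm_right hx]; ring
  have h1 : magneticPart g x i j = (1 / 2) * ∑ s, ∑ t, A s t
      * ((√(spatial (g p)).det)⁻¹ * ∑ u, altSymbol s t 0 u * g p u j.succ) := by
    have h3 : magneticPart g x i j = ∑ μ, ∑ ν, ∑ s, ∑ t, (1 / 2) * (weyl g i.succ μ s t p
        * unitNormal g μ p * (leviCivitaMixed g s t ν j.succ p * unitNormal g ν p)) := by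
      simp only [magneticPart, Matrix.of_apply, dualWeyl, ← hp, Finset.mul_sum, Finset.sum_mul]
      refine Finset.sum_congr rfl fun μ _ => Finset.sum_congr rfl fun ν _ =>
        Finset.sum_congr rfl fun s _ => Finset.sum_congr rfl fun t _ => ?_
      ring
    rw [h3, sum_sum_sum_sum_comm, Finset.mul_sum]
    refine Finset.sum_congr rfl fun s _ => ?_
    rw [Finset.mul_sum]
    refine Finset.sum_congr rfl fun t _ => ?_
    rw [← hε, hA, Finset.sum_mul_sum]
    simp only [Finset.mul_sum]
  have h2 : (normalWeylDual g p * spatial (g p)) i j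
      = ∑ m : Fin 3, A (m + 1).succ (m + 2).succ * g p m.succ j.succ := by
    rw [Matrix.mul_apply]
    rfl
  rw [Matrix.smul_apply, smul_eq_mul, h1, h2]
  have hA0 := hanti 2 1
  simp only [Fin.sum_univ_four, Fin.sum_univ_three, altSymbol_eq]
  have e1 : (1 : Fin 3) + 1 = 2 := rfl
  have e2 : (1 : Fin 3) + 2 = 0 := rfl
  have e3 : (2 : Fin 3) + 1 = 0 := rfl
  have e4 : (2 : Fin 3) + 2 = 1 := rfl
  have f0 : (0 : Fin 3).succ = 1 := rfl
  have f1 : (1 : Fin 3).succ = 2 := rfl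
  have f2 : (2 : Fin 3).succ = 3 := rfl
  have v0 : ((0 : Fin 4) : ℕ) = 0 := rfl
  have v1 : ((1 : Fin 4) : ℕ) = 1 := rfl
  have v2 : ((2 : Fin 4) : ℕ) = 2 := rfl
  have v3 : ((3 : Fin 4) : ℕ) = 3 := rfl
  simp only [v0, v1, v2, v3, e1, e2, e3, e4, f0, f1, f2, zero_add]
  norm_num
  rw [hanti 2 1, hanti 3 1, hanti 3 2]
  field_simp
  ring

end IsFoliatedVacuum

end

section

/-! ### Algebraic curvature tensors in dimension three -/

/-- In dimension three an algebraic curvature tensor with vanishing Ricci contraction vanishes. -/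
theorem eq_zero_of_contraction_eq_zero {A : Matrix (Fin 3) (Fin 3) ℝ}
    (hA : A.det ≠ 0) {D : Fin 3 → Fin 3 → Fin 3 → Fin 3 → ℝ}
    (hl : ∀ i j k l, D i j k l = -D j i k l) (hr : ∀ i j k l, D i j k l = -D i j l k)
    (hD : ∀ j l, ∑ i, ∑ k, A i k * D i j k l = 0) (i j k l : Fin 3) : D i j k l = 0 := by
  have dl : ∀ i k l, D i i k l = 0 := fun i k l => by linarith [hl i i k l]
  have dr : ∀ i j k, D i j k k = 0 := fun i j k => by linarith [hr i j k k]
  simp only [Fin.sum_univ_three] at hD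
  -- In dimension three an antisymmetric pair is a vector index. S is the double dual of D, indexed
  -- by the pairs (12), (20), (01).
  set S : Matrix (Fin 3) (Fin 3) ℝ := !![D 1 2 1 2, D 1 2 2 0, D 1 2 0 1;
    D 2 0 1 2, D 2 0 2 0, D 2 0 0 1; D 0 1 1 2, D 0 1 2 0, D 0 1 0 1] with hS
  -- The vanishing contraction, multiplied by A, says that adj(A)ᵀ Sᵀ is a multiple of the identity,
  -- the factor being its own trace.
  have key : A.adjugateᵀ * Sᵀ = (∑ p, ∑ q, A.adjugate q p * S p q) • 1 := by
    ext m j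
    have h0 := hD m 0
    have h1 := hD m 1
    have h2 := hD m 2
    fin_cases m <;> fin_cases j <;>
    simp only [Fin.zero_eta, Fin.mk_one, Fin.reduceFinMk, dl, dr, hl 1 0, hl 2 1, hl 0 2,
      hr _ _ 1 0, hr _ _ 2 1, hr _ _ 0 2, mul_zero, add_zero, zero_add] at h0 h1 h2 <;>
    simp [Matrix.mul_apply, Fin.sum_univ_three, hS, Matrix.adjugate_fin_three,
      Matrix.smul_apply]
    · linear_combination -(A 0 0 * h0 + A 0 1 * h1 + A 0 2 * h2)
    · linear_combination -(A 1 0 * h0 + A 1 1 * h1 + A 1 2 * h2)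
    · linear_combination -(A 2 0 * h0 + A 2 1 * h1 + A 2 2 * h2)
    · linear_combination -(A 0 0 * h0 + A 0 1 * h1 + A 0 2 * h2)
    · linear_combination -(A 1 0 * h0 + A 1 1 * h1 + A 1 2 * h2)
    · linear_combination -(A 2 0 * h0 + A 2 1 * h1 + A 2 2 * h2)
    · linear_combination -(A 0 0 * h0 + A 0 1 * h1 + A 0 2 * h2)
    · linear_combination -(A 1 0 * h0 + A 1 1 * h1 + A 1 2 * h2)
    · linear_combination (A 2 0 * h0 + A 2 1 * h1 + A 2 2 * h2)
  -- Taking traces gives t = 3t, so t = 0 and S is annihilated by the invertible matrix adj(A).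
  have ht : ∑ p, ∑ q, A.adjugate q p * S p q = 0 := by
    have h := congrArg Matrix.trace key
    have h1 : (A.adjugateᵀ * Sᵀ).trace = ∑ p, ∑ q, A.adjugate q p * S p q := by
      simp only [Matrix.trace, Matrix.diag_apply, Matrix.mul_apply, Matrix.transpose_apply]
    rw [h1, Matrix.trace_smul, Matrix.trace_one, smul_eq_mul] at h
    norm_num at h
    linarith
  rw [ht, zero_smul] at key
  have hS0 : S = 0 := by
    have h : S * A.adjugate = 0 := by
      rw [← Matrix.transpose_eq_zero, Matrix.transpose_mul, key]
    have h2 := congrArg (fun B => B * A) h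
    simp only [Matrix.mul_assoc, Matrix.adjugate_mul, Matrix.mul_smul, Matrix.mul_one,
      Matrix.zero_mul] at h2
    exact (smul_eq_zero.1 h2).resolve_left hA
  have s : ∀ p q, S p q = 0 := fun p q => congrFun (congrFun hS0 p) q
  have s00 := s 0 0
  have s01 := s 0 1
  have s02 := s 0 2
  have s10 := s 1 0
  have s11 := s 1 1
  have s12 := s 1 2
  have s20 := s 2 0
  have s21 := s 2 1
  have s22 := s 2 2
  simp [hS] at s00 s01 s02 s10 s11 s12 s20 s21 s22
  fin_cases i <;> fin_cases j <;> fin_cases k <;> fin_cases l <;>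
  simp only [Fin.zero_eta, Fin.mk_one, Fin.reduceFinMk, dl, dr, hl 1 0, hl 2 1, hl 0 2,
      hr _ _ 1 0, hr _ _ 2 1, hr _ _ 0 2, s00, s01, s02, s10, s11, s12, s20, s21, s22, neg_zero]

variable {Λ : ℝ} {U : Set (Coord 4)} {g : TwoTensor 4} {p : Coord 4}

namespace IsFoliatedVacuum

/-- The tangential components of the Weyl tensor in terms of its electric part. -/
theorem weyl_tangential (hg : IsFoliatedVacuum Λ U g) (hp : p ∈ U) (i j k l : Fin 3) :
    weyl g i.succ j.succ k.succ l.succ p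
      = -(g p i.succ k.succ * normalWeyl₂ g p j.succ l.succ
        - g p i.succ l.succ * normalWeyl₂ g p j.succ k.succ
        - g p j.succ k.succ * normalWeyl₂ g p i.succ l.succ
        + g p j.succ l.succ * normalWeyl₂ g p i.succ k.succ) := by
  obtain ⟨-, hd⟩ := hg.sqrt_abs_det hp
  have hE := hg.normalWeyl₂_symm hp
  have hdi : (spatial (g p))⁻¹.det ≠ 0 := by
    rw [Matrix.det_nonsing_inv, Ring.inverse_eq_inv]; exact inv_ne_zero hd.ne'
  have hγ : (spatial (g p)).IsSymm := by
    ext i j; exact (hg.symm p hp).apply i.succ j.succ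
  have hm : ∀ k j, ∑ i, (spatial (g p))⁻¹ k i * g p (Fin.succ i) (Fin.succ j)
      = if k = j then 1 else 0 := by
    intro k j
    have := congrFun (congrFun (Matrix.nonsing_inv_mul (spatial (g p)) hd.ne'.isUnit) k) j
    rw [Matrix.one_apply] at this
    exact this
  have hsi : ∀ i k, (spatial (g p))⁻¹ i k = (spatial (g p))⁻¹ k i := fun i k => hγ.inv.apply k i
  have hsy : ∀ a b, g p a b = g p b a := fun a b => (hg.symm p hp).apply b a
  -- D is the difference of the two sides. Its contraction is -E + 3E - E - E + 0 = 0, the last zero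
  -- being the trace of E.
  have h := eq_zero_of_contraction_eq_zero (A := (spatial (g p))⁻¹) hdi
    (D := fun i j k l => weyl g i.succ j.succ k.succ l.succ p
      + (g p i.succ k.succ * normalWeyl₂ g p j.succ l.succ
        - g p i.succ l.succ * normalWeyl₂ g p j.succ k.succ
        - g p j.succ k.succ * normalWeyl₂ g p i.succ l.succ
        + g p j.succ l.succ * normalWeyl₂ g p i.succ k.succ))
    (fun i j k l => by rw [hg.weyl_antisymm_left hp]; ring)
    (fun i j k l => by rw [hg.weyl_antisymm_right hp]; ring)
    (fun j l => by
      have h1 : ∑ i, ∑ k, (spatial (g p))⁻¹ i k * (g p (Fin.succ i) (Fin.succ k)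
          * normalWeyl₂ g p j.succ l.succ) = 3 * normalWeyl₂ g p j.succ l.succ := by
        simp only [← mul_assoc, ← Finset.sum_mul]
        congr 1
        have : ∀ i, ∑ k, (spatial (g p))⁻¹ i k * g p (Fin.succ i) (Fin.succ k) = 1 := by
          intro i
          simp only [hsy (Fin.succ i), hm, if_true]
        simp [this]
      have h2 : ∑ i, ∑ k, (spatial (g p))⁻¹ i k * (g p (Fin.succ i) l.succ
          * normalWeyl₂ g p j.succ (Fin.succ k)) = normalWeyl₂ g p j.succ l.succ := by
        rw [Finset.sum_comm]
        simp only [← mul_assoc, ← Finset.sum_mul, hsi _, hm]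
        simp
      have h3 : ∑ i, ∑ k, (spatial (g p))⁻¹ i k * (g p j.succ (Fin.succ k)
          * normalWeyl₂ g p (Fin.succ i) l.succ) = normalWeyl₂ g p j.succ l.succ := by
        simp only [← mul_assoc, ← Finset.sum_mul, hsy j.succ, hm]
        simp
      have h4 : ∑ i, ∑ k, (spatial (g p))⁻¹ i k * (g p j.succ l.succ
          * normalWeyl₂ g p (Fin.succ i) (Fin.succ k)) = 0 := by
        rw [← mul_zero (g p j.succ l.succ), ← hg.trace_electric hp]
        simp only [Finset.mul_sum]
        exact Finset.sum_congr rfl fun i _ => Finset.sum_congr rfl fun k _ => by ring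
      have h5 := hg.contract_tangential hp j l
      simp only [mul_add, mul_sub, Finset.sum_add_distrib, Finset.sum_sub_distrib, h1, h2, h3, h4,
        h5]
      ring) i j k l
  linarith

end IsFoliatedVacuum

/-! ### Fields on the hypersurface -/

/-- The slice embedding as a continuous linear map. -/
def sliceL : Coord 3 →L[ℝ] Coord 4 :=
  LinearMap.toContinuousLinearMap
    { toFun := slice
      map_add' := fun x y => by ext i; refine Fin.cases ?_ (fun j => ?_) i <;> simp [slice]
      map_smul' := fun c x => by ext i; refine Fin.cases ?_ (fun j => ?_) i <;> simp [slice] }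

theorem sliceL_apply (x : Coord 3) : sliceL x = slice x := rfl

theorem slice_single (i : Fin 3) :
    slice (EuclideanSpace.single i 1) = EuclideanSpace.single i.succ 1 := by
  ext j
  refine Fin.cases ?_ (fun j => ?_) j
  · simp [slice, (Fin.succ_ne_zero i).symm]
  · simp [slice]

theorem pd_comp_slice {f : Coord 4 → ℝ} {x : Coord 3} (hf : DifferentiableAt ℝ f (slice x))
    (i : Fin 3) : pd i (fun y => f (slice y)) x = pd i.succ f (slice x) := by
  have h : HasFDerivAt (fun y => f (slice y)) ((fderiv ℝ f (slice x)).comp sliceL) x :=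
    HasFDerivAt.comp x (f := fun y => slice y) hf.hasFDerivAt sliceL.hasFDerivAt
  rw [pd, h.fderiv, ContinuousLinearMap.comp_apply, sliceL_apply, slice_single, pd]

theorem SmoothOn.comp_slice {f : Coord 4 → ℝ} {U : Set (Coord 4)} {S : Set (Coord 3)}
    (hf : SmoothOn f U) (hS : ∀ x ∈ S, slice x ∈ U) : SmoothOn (fun y => f (slice y)) S :=
  ContDiffOn.comp (g := f) (f := slice) hf (sliceL.contDiff.contDiffOn) hS

/-- The charge density `√(det γ) Tⁱⱼ Xʲ`. -/
def flux (γ T : TwoTensor 3) (X : Coord 3 → Coord 3) (i : Fin 3) (x : Coord 3) : ℝ :=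
  √(γ x).det * ∑ j, ((γ x)⁻¹ * T x) i j * X x j

/-- The covariant derivative `∇_i X_k`. -/
def covVec (γ : TwoTensor 3) (X : Coord 3 → Coord 3) (i k : Fin 3) (x : Coord 3) : ℝ :=
  ∑ j, ((1 / 2) * (pd i (fun y => γ y k j) x + pd j (fun y => γ y k i) x
    - pd k (fun y => γ y i j) x) * X x j + γ x k j * pd i (fun y => X y j) x)

theorem inducedMetric_eq (g : TwoTensor 4) (x : Coord 3) :
    inducedMetric g x = spatial (g (slice x)) := rfl

variable {S : Set (Coord 3)} {X : Coord 3 → Coord 3} {x : Coord 3}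

namespace IsFoliatedVacuum

theorem extrinsicCurv_eq (g : TwoTensor 4) (x : Coord 3) (i j : Fin 3) :
    extrinsicCurv g x i j = -covNormal g i.succ j.succ (slice x) := by
  simp only [extrinsicCurv, covNormal, Matrix.of_apply, mul_comm]

/-- `∇_i n^c` is tangential and given by the extrinsic curvature. -/
theorem covDeriv_unitNormal_succ (hg : IsFoliatedVacuum Λ U g) (hx : slice x ∈ U) (i k : Fin 3) :
    pd i.succ (unitNormal g k.succ) (slice x)
      + ∑ e, christoffel g k.succ i.succ e (slice x) * unitNormal g e (slice x)
    = -∑ l, (inducedMetric g x)⁻¹ k l * extrinsicCurv g x i l := by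
  rw [hg.covDeriv_unitNormal hx, hg.sum_inv_metric_succ hx (hg.sum_covNormal_mul_unitNormal hx _),
    ← Finset.sum_neg_distrib]
  exact Finset.sum_congr rfl fun l _ => by rw [extrinsicCurv_eq, inducedMetric_eq]; ring

theorem covDeriv_unitNormal_zero (hg : IsFoliatedVacuum Λ U g) (hx : p ∈ U) (a : Fin 4) :
    pd a (unitNormal g 0) p + ∑ e, christoffel g 0 a e p * unitNormal g e p = 0 := by
  rw [hg.covDeriv_unitNormal hx, hg.sum_inv_metric_zero hx (hg.sum_covNormal_mul_unitNormal hx _)]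

/-- Lowering the index of the spacetime covariant derivative of a tangential field. -/
theorem sum_metric_covVec (hg : IsFoliatedVacuum Λ U g) (hx : slice x ∈ U) (i k : Fin 3) :
    ∑ e, g (slice x) k.succ e * (∑ j : Fin 3, christoffel g e i.succ j.succ (slice x) * X x j
      + ∑ j : Fin 3, if e = j.succ then pd i (fun y => X y j) x else 0)
    = covVec (inducedMetric g) X i k x := by
  have hd : ∀ a b, DifferentiableAt ℝ (fun q => g q a b) (slice x) := fun a b =>
    hg.isSmoothMetric.smooth.differentiableAt hg.isOpen hx a b
  have hp : ∀ (m a b : Fin 3), pd m (fun y => inducedMetric g y a b) x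
      = pd m.succ (fun q => g q a.succ b.succ) (slice x) := fun m a b => pd_comp_slice (hd _ _) m
  simp only [mul_add, Finset.sum_add_distrib, covVec, hp]
  congr 1
  · simp only [Finset.mul_sum, ← mul_assoc]
    rw [Finset.sum_comm]
    simp only [← Finset.sum_mul,
      sum_metric_mul_christoffel (hg.isSmoothMetric.det_ne_zero _ hx)]
  · simp only [Finset.mul_sum]
    rw [Finset.sum_comm]
    simp [inducedMetric]

end IsFoliatedVacuum

end

section

/-! ### Divergence of the electric flux -/

variable {Λ : ℝ} {U : Set (Coord 4)} {g : TwoTensor 4} {p : Coord 4}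
  {S : Set (Coord 3)} {X : Coord 3 → Coord 3} {x : Coord 3}

theorem smoothOn_component (hX : SmoothOn X S) (j : Fin 3) : SmoothOn (fun y => X y j) S :=
  (EuclideanSpace.proj (𝕜 := ℝ) j).contDiff.comp_contDiffOn hX

/-- The density `√|det g| W^{a0}_{cd} n^c`. -/
def electricDensity (Λ : ℝ) (g : TwoTensor 4) (a d : Fin 4) (p : Coord 4) : ℝ :=
  ∑ c, √|(g p).det| * (weylUp Λ g c d p * (g p)⁻¹) a 0 * unitNormal g c p

namespace IsFoliatedVacuum

theorem spatial_isSymm (hg : IsFoliatedVacuum Λ U g) (hp : p ∈ U) : (spatial (g p)).IsSymm := by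
  ext i j; exact (hg.symm p hp).apply i.succ j.succ

theorem density_zero (hg : IsFoliatedVacuum Λ U g) (hp : p ∈ U) (c d : Fin 4) :
    (weylUp Λ g c d p * (g p)⁻¹) 0 0 = 0 := by
  linarith [hg.weylUp_mul_inv_antisymm hp c d 0 0]

/-- A raised index 0 is contraction with the normal divided by -N, and √|det g| = N √det γ absorbs
the lapse. -/
theorem density_succ (hg : IsFoliatedVacuum Λ U g) (hp : p ∈ U) (i : Fin 3) (c d : Fin 4) :
    √|(g p).det| * (weylUp Λ g c d p * (g p)⁻¹) i.succ 0
      = -(√(spatial (g p)).det * ∑ l, (spatial (g p))⁻¹ i l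
        * ∑ b, weyl g (Fin.succ l) b c d p * unitNormal g b p) := by
  have hV : ∑ a, (∑ b, weyl g a b c d p * unitNormal g b p) * unitNormal g a p = 0 := by
    rw [← sum_antisymm_eq_zero (fun a b => hg.weyl_antisymm_left hp a b c d)
      (fun a => unitNormal g a p)]
    simp only [Finset.sum_mul]
    exact Finset.sum_congr rfl fun a _ => Finset.sum_congr rfl fun b _ => by ring
  rw [← hg.sum_inv_metric_succ hp hV, (hg.sqrt_abs_det hp).1, Matrix.mul_apply]
  simp only [hg.weylUp_apply hp, unitNormal_eq, Finset.mul_sum, Finset.sum_mul,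
    ← Finset.sum_neg_distrib]
  rw [Finset.sum_comm]
  exact Finset.sum_congr rfl fun e _ => Finset.sum_congr rfl fun b _ => by ring

/-- By antisymmetry of the first pair the time component vanishes, so the spacetime divergence
involves only derivatives along the slice and becomes a constraint. -/
theorem electricDensity_zero (hg : IsFoliatedVacuum Λ U g) (hp : p ∈ U) (d : Fin 4) :
    electricDensity Λ g 0 d p = 0 := by
  simp only [electricDensity, hg.density_zero hp, mul_zero, zero_mul, Finset.sum_const_zero]

theorem electricDensity_succ (hg : IsFoliatedVacuum Λ U g) (hp : p ∈ U) (i : Fin 3) (d : Fin 4) :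
    electricDensity Λ g i.succ d p
      = -(√(spatial (g p)).det * ∑ l, (spatial (g p))⁻¹ i l * normalWeyl₂ g p (Fin.succ l) d) := by
  simp only [electricDensity, hg.density_succ hp, normalWeyl₂, Finset.mul_sum, Finset.sum_mul,
    ← Finset.sum_neg_distrib]
  rw [Finset.sum_comm]
  refine Finset.sum_congr rfl fun l _ => ?_
  rw [Finset.sum_comm]
  exact Finset.sum_congr rfl fun e _ => Finset.sum_congr rfl fun b _ => by ring

theorem smooth_electricDensity (hg : IsFoliatedVacuum Λ U g) (a d : Fin 4) :
    SmoothOn (electricDensity Λ g a d) U := by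
  have hm := hg.isSmoothMetric
  refine ContDiffOn.sum fun c _ => ContDiffOn.mul (ContDiffOn.mul ?_
    (((hg.smooth_weylUp c d).mul hg.smooth_inv) a 0)) (hg.smooth_unitNormal c)
  exact ContDiffOn.sqrt (ContDiffOn.abs hm.smooth.det hm.det_ne_zero)
    fun p hp => (abs_pos.2 (hm.det_ne_zero p hp)).ne'

theorem flux_electricPart (hg : IsFoliatedVacuum Λ U g) (hx : slice x ∈ U) (i : Fin 3) :
    flux (inducedMetric g) (electricPart g) X i x
      = -∑ j, electricDensity Λ g i.succ (Fin.succ j) (slice x) * X x j := by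
  simp only [flux, hg.electricDensity_succ hx, Matrix.mul_apply, electricPart_eq, inducedMetric_eq,
    Finset.mul_sum, Finset.sum_mul, ← Finset.sum_neg_distrib]
  exact Finset.sum_congr rfl fun j _ => Finset.sum_congr rfl fun l _ => by ring

theorem smooth_flux_electricPart (hg : IsFoliatedVacuum Λ U g)
    (hSU : ∀ x ∈ S, slice x ∈ U) (hX : SmoothOn X S) (i : Fin 3) :
    SmoothOn (flux (inducedMetric g) (electricPart g) X i) S := by
  refine ContDiffOn.congr ?_ fun x hx => hg.flux_electricPart (hSU x hx) i
  exact ContDiffOn.neg (ContDiffOn.sum fun j _ => ContDiffOn.mul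
    ((hg.smooth_electricDensity _ _).comp_slice hSU) (smoothOn_component hX j))

/-- The spacetime divergence identity with z = 0 and v = n. Here ∇n becomes the extrinsic curvature,
and the Christoffel term of the free index is left to be paired with X. -/
theorem divergence_electricDensity (hg : IsFoliatedVacuum Λ U g) (hx : slice x ∈ U) (j : Fin 3) :
    ∑ i : Fin 3, pd i.succ (electricDensity Λ g i.succ j.succ) (slice x)
      = √(inducedMetric g x).det * ∑ i, ∑ k,
          (∑ l, (inducedMetric g x)⁻¹ i l * normalWeyl g (slice x) l k j)
          * (∑ m, (inducedMetric g x)⁻¹ k m * extrinsicCurv g x i m)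
        + ∑ i : Fin 3, ∑ e, electricDensity Λ g i.succ e (slice x)
          * christoffel g e i.succ j.succ (slice x) := by
  have h0 : pd 0 (electricDensity Λ g 0 j.succ) (slice x) = 0 := by
    rw [pd_congr_on hg.isOpen hx (fun q hq => hg.electricDensity_zero hq j.succ), pd_const]
  have h := (hg.isDivFreeAt_weylUp hx).divergence hg.isSmoothMetric hx hg.smooth_weylUp
    (hg.weylUp_mul_inv_antisymm hx) hg.smooth_unitNormal 0 j.succ
  change ∑ a, pd a (electricDensity Λ g a j.succ) (slice x) = _ at h
  rw [Fin.sum_univ_succ, h0, zero_add] at h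
  rw [h, Fin.sum_univ_succ]
  have h1 : ∑ c, ((weylUp Λ g c j.succ (slice x) * (g (slice x))⁻¹) 0 0 *
        (pd 0 (unitNormal g c) (slice x)
          + ∑ e, christoffel g c 0 e (slice x) * unitNormal g e (slice x))
      + ∑ e, (weylUp Λ g c e (slice x) * (g (slice x))⁻¹) 0 0
        * christoffel g e 0 j.succ (slice x) * unitNormal g c (slice x)) = 0 :=
    Finset.sum_eq_zero fun c _ => by
      simp only [hg.density_zero hx, zero_mul, Finset.sum_const_zero, add_zero]
  rw [h1, zero_add]
  simp only [Finset.sum_add_distrib]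
  rw [mul_add]
  congr 1
  · rw [Finset.mul_sum, Finset.mul_sum]
    refine Finset.sum_congr rfl fun i _ => ?_
    rw [Fin.sum_univ_succ, hg.covDeriv_unitNormal_zero hx, mul_zero, zero_add, Finset.mul_sum,
      Finset.mul_sum]
    refine Finset.sum_congr rfl fun k _ => ?_
    rw [← mul_assoc, hg.density_succ hx, hg.covDeriv_unitNormal_succ hx]
    simp only [inducedMetric_eq, normalWeyl]
    ring
  · rw [Finset.mul_sum]
    refine Finset.sum_congr rfl fun i _ => ?_
    rw [Finset.sum_comm, Finset.mul_sum]
    refine Finset.sum_congr rfl fun e _ => ?_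
    rw [electricDensity, Finset.sum_mul, Finset.mul_sum]
    exact Finset.sum_congr rfl fun c _ => by ring

/-- The momentum-type constraint paired with X: the divergence of E is algebraic in K and the normal
components of W, and E contracts with ∇X. -/
theorem divergence_flux_electricPart (hg : IsFoliatedVacuum Λ U g) (hS : IsOpen S)
    (hSU : ∀ x ∈ S, slice x ∈ U) (hX : SmoothOn X S) (hx : x ∈ S) :
    ∑ i, pd i (flux (inducedMetric g) (electricPart g) X i) x
      = √(inducedMetric g x).det * ((∑ i, ∑ k, ((inducedMetric g x)⁻¹ * electricPart g x
            * (inducedMetric g x)⁻¹) i k * covVec (inducedMetric g) X i k x)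
          - ∑ j, (∑ i, ∑ k, (∑ l, (inducedMetric g x)⁻¹ i l * normalWeyl g (slice x) l k j)
          * (∑ m, (inducedMetric g x)⁻¹ k m * extrinsicCurv g x i m)) * X x j) := by
  have hp := hSU x hx
  have hsi : ∀ i k, (inducedMetric g x)⁻¹ i k = (inducedMetric g x)⁻¹ k i := fun i k =>
    (hg.spatial_isSymm hp).inv.apply k i
  have h1 : ∀ i, pd i (flux (inducedMetric g) (electricPart g) X i) x
      = -∑ j, (pd i.succ (electricDensity Λ g i.succ (Fin.succ j)) (slice x) * X x j
        + electricDensity Λ g i.succ (Fin.succ j) (slice x) * pd i (fun y => X y j) x) := by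
    intro i
    have hd : ∀ j, DifferentiableAt ℝ (electricDensity Λ g i.succ j) (slice x) := fun j =>
      SmoothOn.differentiableAt (hg.smooth_electricDensity _ _) hg.isOpen hp
    have hd' : ∀ j, DifferentiableAt ℝ (fun y => electricDensity Λ g i.succ j (slice y)) x :=
      fun j => SmoothOn.differentiableAt ((hg.smooth_electricDensity _ _).comp_slice hSU) hS hx
    have hXd : ∀ j, DifferentiableAt ℝ (fun y => X y j) x := fun j =>
      SmoothOn.differentiableAt (smoothOn_component hX j) hS hx
    rw [pd_congr_on hS hx (fun y hy => hg.flux_electricPart (hSU y hy) i), pd_neg,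
      pd_sum (f := fun j y => electricDensity Λ g i.succ (Fin.succ j) (slice y) * X y j)
        (fun j _ => (hd' _).mul (hXd j))]
    congr 1
    refine Finset.sum_congr rfl fun j _ => ?_
    rw [pd_mul (hd' _) (hXd j), pd_comp_slice (hd _)]
  have h2 : ∑ i, ∑ j, pd (Fin.succ i) (electricDensity Λ g (Fin.succ i) (Fin.succ j)) (slice x)
      * X x j = ∑ j, (∑ i : Fin 3, pd i.succ (electricDensity Λ g i.succ j.succ) (slice x))
        * X x j := by
    rw [Finset.sum_comm]
    simp only [Finset.sum_mul]
  have h3 : ∀ i : Fin 3, ∑ e, electricDensity Λ g i.succ e (slice x)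
      * (∑ j : Fin 3, christoffel g e i.succ j.succ (slice x) * X x j
        + ∑ j : Fin 3, if e = j.succ then pd i (fun y => X y j) x else 0)
      = -(√(inducedMetric g x).det * ∑ k, ((inducedMetric g x)⁻¹ * electricPart g x
            * (inducedMetric g x)⁻¹) i k * covVec (inducedMetric g) X i k x) := by
    intro i
    have h4 : ∀ e, electricDensity Λ g i.succ e (slice x) = -(√(inducedMetric g x).det
        * ∑ l, (inducedMetric g x)⁻¹ i l * normalWeyl₂ g (slice x) (Fin.succ l) e) := fun e =>
      hg.electricDensity_succ hp i e
    have h5 : ∀ (l : Fin 3) (Y : Fin 4 → ℝ), _ := fun l Y =>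
      hg.sum_mul_eq_spatial hp (hg.normalWeyl₂_mul_right hp l.succ) Y
    have h6 : ∀ Y : Fin 4 → ℝ, ∑ e, -(√(inducedMetric g x).det
        * ∑ l, (inducedMetric g x)⁻¹ i l * normalWeyl₂ g (slice x) (Fin.succ l) e) * Y e
        = -(√(inducedMetric g x).det * ∑ l, (inducedMetric g x)⁻¹ i l
          * ∑ e, normalWeyl₂ g (slice x) (Fin.succ l) e * Y e) := by
      intro Y
      simp only [Finset.mul_sum, Finset.sum_mul, ← Finset.sum_neg_distrib]
      rw [Finset.sum_comm]
      exact Finset.sum_congr rfl fun l _ => Finset.sum_congr rfl fun e _ => by ring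
    simp only [h4, h6, h5, hg.sum_metric_covVec hp]
    congr 2
    simp only [Matrix.mul_apply, Finset.mul_sum, Finset.sum_mul, electricPart_eq]
    rw [Finset.sum_comm]
    refine Finset.sum_congr rfl fun k _ => ?_
    rw [Finset.sum_comm]
    refine Finset.sum_congr rfl fun m _ => Finset.sum_congr rfl fun l _ => ?_
    rw [hsi m k, inducedMetric_eq]
    ring
  -- The leftover Christoffel term and the ∂X term combine into the spacetime covariant derivative
  -- of X, extended by zero time component. The density is tangential in `e`, so only its spatial
  -- projection counts.
  have h7 : ∑ i, ∑ j, electricDensity Λ g (Fin.succ i) (Fin.succ j) (slice x)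
        * pd i (fun y => X y j) x
      + ∑ j, (∑ i : Fin 3, ∑ e, electricDensity Λ g i.succ e (slice x)
          * christoffel g e i.succ (Fin.succ j) (slice x)) * X x j
      = ∑ i : Fin 3, ∑ e, electricDensity Λ g i.succ e (slice x)
      * (∑ j : Fin 3, christoffel g e i.succ j.succ (slice x) * X x j
        + ∑ j : Fin 3, if e = j.succ then pd i (fun y => X y j) x else 0) := by
    simp only [mul_add, Finset.sum_add_distrib]
    rw [add_comm]
    congr 1
    · simp only [Finset.mul_sum, Finset.sum_mul]
      rw [Finset.sum_comm]
      refine Finset.sum_congr rfl fun i _ => ?_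
      rw [Finset.sum_comm]
      exact Finset.sum_congr rfl fun e _ => Finset.sum_congr rfl fun j _ => by ring
    · refine Finset.sum_congr rfl fun i _ => ?_
      simp only [Finset.mul_sum]
      rw [Finset.sum_comm]
      simp
  simp only [h3] at h7
  simp only [h1, Finset.sum_neg_distrib, Finset.sum_add_distrib, h2,
    hg.divergence_electricDensity hp, add_mul]
  simp only [Finset.sum_neg_distrib, ← Finset.mul_sum] at h7
  have h8 : ∀ f : Fin 3 → ℝ, ∑ j, √(inducedMetric g x).det * f j * X x j
      = √(inducedMetric g x).det * ∑ j, f j * X x j := by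
    intro f
    rw [Finset.mul_sum]
    exact Finset.sum_congr rfl fun j _ => by ring
  rw [h8]
  linear_combination -h7

end IsFoliatedVacuum

end

section

/-! ### Divergence of the magnetic flux -/

variable {Λ : ℝ} {U : Set (Coord 4)} {g : TwoTensor 4} {p : Coord 4}
  {S : Set (Coord 3)} {X : Coord 3 → Coord 3} {x : Coord 3}

/-- The contraction `n_a R^a_{bkl}`. -/
def normalCurv (g : TwoTensor 4) (k l b : Fin 4) (p : Coord 4) : ℝ :=
  ∑ a, conormal g a p * curv g k l p a b

namespace IsFoliatedVacuum

theorem smooth_normalCurv (hg : IsFoliatedVacuum Λ U g) (k l b : Fin 4) :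
    SmoothOn (normalCurv g k l b) U :=
  ContDiffOn.sum fun a _ => ContDiffOn.mul (hg.smooth_conormal a)
    (hg.isSmoothMetric.smooth_curv k l a b)

/-- The constant-curvature part carries n_a δ^a_k with k spatial, which vanishes; for these
components Riemann and Weyl agree. -/
theorem normalCurv_succ (hg : IsFoliatedVacuum Λ U g) (hp : p ∈ U) (k l j : Fin 3) :
    normalCurv g k.succ l.succ j.succ p = -normalWeyl g p j k l := by
  have hsi : ∀ a b, (g p)⁻¹ a b = (g p)⁻¹ b a := fun a b => (hg.symm p hp).inv.apply b a
  have h1 : normalCurv g k.succ l.succ j.succ p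
      = ∑ a, conormal g a p * weylUp Λ g k.succ l.succ p a j.succ := by
    refine Finset.sum_congr rfl fun a _ => ?_
    by_cases ha : a = 0
    · subst ha
      simp [weylUp, constCurv, (Fin.succ_ne_zero _).symm]
    · simp [conormal, ha]
  rw [h1]
  simp only [hg.weylUp_apply hp, normalWeyl, Finset.mul_sum, ← Finset.sum_neg_distrib]
  rw [Finset.sum_comm]
  refine Finset.sum_congr rfl fun e _ => ?_
  rw [hg.weyl_antisymm_left hp e, unitNormal, Finset.mul_sum, ← Finset.sum_neg_distrib]
  exact Finset.sum_congr rfl fun a _ => by rw [hsi a e]; ring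

theorem sum_normalCurv_mul_unitNormal (hg : IsFoliatedVacuum Λ U g) (hp : p ∈ U) (k l : Fin 4) :
    ∑ b, normalCurv g k l b p * unitNormal g b p = 0 := by
  have hu : IsUnit (g p).det := (hg.det_neg hp).ne.isUnit
  have hsi : ∀ a b, (g p)⁻¹ a b = (g p)⁻¹ b a := fun a b => (hg.symm p hp).inv.apply b a
  have hc : ∀ a b, curv g k l p a b = ∑ e, (g p)⁻¹ a e * riemann g e b k l p := by
    intro a b
    have h : (g p)⁻¹ * (g p * curv g k l p) = curv g k l p := by
      rw [← Matrix.mul_assoc, Matrix.nonsing_inv_mul _ hu, Matrix.one_mul]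
    exact (congrFun (congrFun h a) b).symm
  have h1 : ∀ b, normalCurv g k l b p = ∑ e, riemann g e b k l p * unitNormal g e p := by
    intro b
    simp only [normalCurv, hc, unitNormal, Finset.mul_sum]
    rw [Finset.sum_comm]
    exact Finset.sum_congr rfl fun e _ => Finset.sum_congr rfl fun a _ => by rw [hsi a e]; ring
  simp only [h1, Finset.sum_mul]
  rw [Finset.sum_comm]
  exact sum_antisymm_eq_zero
    (fun e b => hg.isSmoothMetric.riemann_antisymm_left hp e b k l) (fun a => unitNormal g a p)

/-- Contraction of the extrinsic curvature with the tangential Riemann tensor. -/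
theorem sum_covNormal_mul_curv (hg : IsFoliatedVacuum Λ U g) (hx : slice x ∈ U) (m j k l : Fin 3) :
    ∑ a, covNormal g m.succ a (slice x) * curv g k.succ l.succ (slice x) a j.succ
      = -∑ i, (∑ q, (inducedMetric g x)⁻¹ i q * extrinsicCurv g x m q)
          * weyl g (Fin.succ i) j.succ k.succ l.succ (slice x)
        - Λ / 3 * (extrinsicCurv g x m k * inducedMetric g x j l
          - extrinsicCurv g x m l * inducedMetric g x j k) := by
  set p := slice x with hpx
  have hu : IsUnit (g p).det := (hg.det_neg hx).ne.isUnit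
  have hsi : ∀ a b, (g p)⁻¹ a b = (g p)⁻¹ b a := fun a b => (hg.symm p hx).inv.apply b a
  have hc : ∀ a, curv g k.succ l.succ p a j.succ = weylUp Λ g k.succ l.succ p a j.succ
      + Λ / 3 * constCurv g k.succ l.succ p a j.succ := by
    intro a
    simp [weylUp]
  have h1 : ∑ a, covNormal g m.succ a p * weylUp Λ g k.succ l.succ p a j.succ
      = ∑ e, (∑ a, (g p)⁻¹ e a * covNormal g m.succ a p)
        * weyl g e j.succ k.succ l.succ p := by
    simp only [hg.weylUp_apply hx, Finset.mul_sum, Finset.sum_mul]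
    rw [Finset.sum_comm]
    exact Finset.sum_congr rfl fun e _ => Finset.sum_congr rfl fun a _ => by rw [hsi a e]; ring
  have h2 := hg.sum_covNormal_mul_unitNormal hx m.succ
  have h3 : ∑ a, covNormal g m.succ a p * (Λ / 3 * constCurv g k.succ l.succ p a j.succ)
      = Λ / 3 * (covNormal g m.succ k.succ p * g p j.succ l.succ
        - covNormal g m.succ l.succ p * g p j.succ k.succ) := by
    simp only [constCurv, Matrix.of_apply, mul_sub, Finset.sum_sub_distrib, mul_ite, mul_zero,
      Finset.sum_ite_eq', Finset.mem_univ, if_true]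
    ring
  simp only [hc, mul_add, Finset.sum_add_distrib, h1, h3]
  rw [Fin.sum_univ_succ, hg.sum_inv_metric_zero hx h2, zero_mul, zero_add]
  simp only [hg.sum_inv_metric_succ hx h2, extrinsicCurv_eq, inducedMetric_eq, ← hpx, mul_neg,
    Finset.sum_neg_distrib, neg_mul, neg_neg, spatial, Matrix.of_apply]
  ring

theorem normalWeylDual_eq (hg : IsFoliatedVacuum Λ U g) (hx : slice x ∈ U) :
    (inducedMetric g x)⁻¹ * normalWeylDual g (slice x)
      = √(inducedMetric g x).det •
        ((inducedMetric g x)⁻¹ * magneticPart g x * (inducedMetric g x)⁻¹) := by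
  have hd : IsUnit (inducedMetric g x).det := (hg.sqrt_abs_det hx).2.ne'.isUnit
  have h := hg.sqrt_det_mul_magneticPart hx
  rw [← inducedMetric_eq] at h
  rw [← Matrix.smul_mul, ← Matrix.mul_smul, h, Matrix.mul_assoc, Matrix.mul_assoc,
    Matrix.mul_nonsing_inv _ hd, Matrix.mul_one]

/-- The density of B contains neither the metric nor its determinant: it is a component of the
two-form n_a R^a_{jkl} Xʲ. Its divergence is therefore an exterior derivative, accessible to the
uncontracted Bianchi identity. -/
theorem flux_magneticPart (hg : IsFoliatedVacuum Λ U g) (hx : slice x ∈ U) (m : Fin 3) :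
    flux (inducedMetric g) (magneticPart g) X m x
      = -∑ j, normalCurv g (m + 1).succ (m + 2).succ (Fin.succ j) (slice x) * X x j := by
  have hd : IsUnit (inducedMetric g x).det := (hg.sqrt_abs_det hx).2.ne'.isUnit
  have hγ : (inducedMetric g x)ᵀ = inducedMetric g x := hg.spatial_isSymm hx
  have hs : ((inducedMetric g x)⁻¹ * normalWeylDual g (slice x)).IsSymm :=
    hg.inv_mul_normalWeylDual_isSymm hx
  have h : √(inducedMetric g x).det • ((inducedMetric g x)⁻¹ * magneticPart g x)
      = (normalWeylDual g (slice x))ᵀ := by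
    have h1 : (normalWeylDual g (slice x))ᵀ
        = ((inducedMetric g x)⁻¹ * normalWeylDual g (slice x))ᵀ * inducedMetric g x := by
      rw [Matrix.transpose_mul, Matrix.transpose_nonsing_inv, hγ, Matrix.mul_assoc,
        Matrix.nonsing_inv_mul _ hd, Matrix.mul_one]
    rw [h1, hs.eq, hg.normalWeylDual_eq hx, Matrix.smul_mul, Matrix.mul_assoc _ _ (inducedMetric g x),
      Matrix.nonsing_inv_mul _ hd, Matrix.mul_one]
  rw [flux, Finset.mul_sum, ← Finset.sum_neg_distrib]
  refine Finset.sum_congr rfl fun j _ => ?_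
  have h2 := congrFun (congrFun h m) j
  rw [Matrix.smul_apply, smul_eq_mul] at h2
  rw [← mul_assoc, h2, hg.normalCurv_succ hx]
  simp [normalWeylDual]

theorem smooth_flux_magneticPart (hg : IsFoliatedVacuum Λ U g)
    (hSU : ∀ x ∈ S, slice x ∈ U) (hX : SmoothOn X S) (i : Fin 3) :
    SmoothOn (flux (inducedMetric g) (magneticPart g) X i) S := by
  refine ContDiffOn.congr ?_ fun x hx => hg.flux_magneticPart (hSU x hx) i
  exact ContDiffOn.neg (ContDiffOn.sum fun j _ => ContDiffOn.mul
    ((hg.smooth_normalCurv _ _ _).comp_slice hSU) (smoothOn_component hX j))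

/-- The magnetic counterpart of the electric identity, obtained from the cyclic derivative of n_a
R^a_{jkl}. The term ∇n yields K against the tangential Weyl tensor. -/
theorem divergence_flux_magneticPart (hg : IsFoliatedVacuum Λ U g) (hS : IsOpen S)
    (hSU : ∀ x ∈ S, slice x ∈ U) (hX : SmoothOn X S) (hx : x ∈ S) :
    ∑ i, pd i (flux (inducedMetric g) (magneticPart g) X i) x
      = √(inducedMetric g x).det * (∑ i, ∑ k, ((inducedMetric g x)⁻¹ * magneticPart g x
            * (inducedMetric g x)⁻¹) i k * covVec (inducedMetric g) X i k x)
          + ∑ j, (∑ m : Fin 3, ∑ i, (∑ q, (inducedMetric g x)⁻¹ i q * extrinsicCurv g x m q)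
          * weyl g (Fin.succ i) (Fin.succ j) (m + 1).succ (m + 2).succ (slice x)) * X x j := by
  have hp := hSU x hx
  set H : Fin 3 → Fin 4 → Coord 4 → ℝ := fun m b => normalCurv g (m + 1).succ (m + 2).succ b
  have sH : ∀ m b, SmoothOn (H m b) U := fun m b => hg.smooth_normalCurv _ _ _
  have h1 : ∀ i, pd i (flux (inducedMetric g) (magneticPart g) X i) x
      = -∑ j, (pd i.succ (H i (Fin.succ j)) (slice x) * X x j
        + H i (Fin.succ j) (slice x) * pd i (fun y => X y j) x) := by
    intro i
    have hd : ∀ j, DifferentiableAt ℝ (H i j) (slice x) := fun j =>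
      SmoothOn.differentiableAt (sH i j) hg.isOpen hp
    have hd' : ∀ j, DifferentiableAt ℝ (fun y => H i j (slice y)) x :=
      fun j => SmoothOn.differentiableAt ((sH i j).comp_slice hSU) hS hx
    have hXd : ∀ j, DifferentiableAt ℝ (fun y => X y j) x := fun j =>
      SmoothOn.differentiableAt (smoothOn_component hX j) hS hx
    rw [pd_congr_on hS hx (fun y hy => hg.flux_magneticPart (hSU y hy) i), pd_neg,
      pd_sum (f := fun j y => H i (Fin.succ j) (slice y) * X y j)
        (fun j _ => (hd' _).mul (hXd j))]
    congr 1
    refine Finset.sum_congr rfl fun j _ => ?_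
    rw [pd_mul (hd' _) (hXd j), pd_comp_slice (hd _)]
  have h2 : ∀ j : Fin 3, ∑ m : Fin 3, pd m.succ (H m j.succ) (slice x)
      = ∑ m : Fin 3, (∑ a, covNormal g m.succ a (slice x)
          * curv g (m + 1).succ (m + 2).succ (slice x) a j.succ
        + ∑ e, H m e (slice x) * christoffel g e m.succ j.succ (slice x)) := by
    intro j
    -- The triple (2, 3, 1) of spacetime indices makes the three cyclic terms match m = 0, 1, 2 in
    -- order.
    have h := hg.isSmoothMetric.cyclic_derivative hp hg.smooth_conormal j.succ 2 3 1
    rw [Fin.sum_univ_three, Fin.sum_univ_three]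
    exact h
  have h4 : ∑ j, ∑ m : Fin 3, (∑ a, covNormal g m.succ a (slice x)
          * curv g (m + 1).succ (m + 2).succ (slice x) a (Fin.succ j)) * X x j
      = -∑ j, (∑ m : Fin 3, ∑ i, (∑ q, (inducedMetric g x)⁻¹ i q * extrinsicCurv g x m q)
          * weyl g (Fin.succ i) (Fin.succ j) (m + 1).succ (m + 2).succ (slice x)) * X x j := by
    rw [← Finset.sum_neg_distrib]
    refine Finset.sum_congr rfl fun j _ => ?_
    simp only [hg.sum_covNormal_mul_curv hp]
    have hK : ∀ m l, extrinsicCurv g x m l = extrinsicCurv g x l m := fun m l => by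
      rw [extrinsicCurv_eq, extrinsicCurv_eq, hg.covNormal_symm hp]
    -- The cosmological term cancels because the sum antisymmetrizes the symmetric K.
    have hΛ : ∑ m : Fin 3, (extrinsicCurv g x m (m + 1) * inducedMetric g x j (m + 2)
          - extrinsicCurv g x m (m + 2) * inducedMetric g x j (m + 1)) = 0 := by
      have e1 : (1 : Fin 3) + 1 = 2 := rfl
      have e2 : (1 : Fin 3) + 2 = 0 := rfl
      have e3 : (2 : Fin 3) + 1 = 0 := rfl
      have e4 : (2 : Fin 3) + 2 = 1 := rfl
      simp only [Fin.sum_univ_three, zero_add, e1, e2, e3, e4]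
      rw [hK 1 0, hK 2 0, hK 2 1]
      ring
    rw [← Finset.sum_mul, Finset.sum_sub_distrib, ← Finset.mul_sum, hΛ, mul_zero, sub_zero,
      Finset.sum_neg_distrib, neg_mul]
  have h5 : ∀ m : Fin 3, ∑ e, H m e (slice x)
      * (∑ j : Fin 3, christoffel g e m.succ j.succ (slice x) * X x j
        + ∑ j : Fin 3, if e = j.succ then pd m (fun y => X y j) x else 0)
      = -(√(inducedMetric g x).det * ∑ k, ((inducedMetric g x)⁻¹ * magneticPart g x
            * (inducedMetric g x)⁻¹) m k * covVec (inducedMetric g) X m k x) := by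
    intro m
    rw [hg.sum_mul_eq_spatial hp (hg.sum_normalCurv_mul_unitNormal hp _ _)]
    simp only [hg.sum_metric_covVec hp]
    rw [Finset.mul_sum, ← Finset.sum_neg_distrib]
    refine Finset.sum_congr rfl fun k _ => ?_
    have hs : ((inducedMetric g x)⁻¹ * normalWeylDual g (slice x)).IsSymm :=
      hg.inv_mul_normalWeylDual_isSymm hp
    have h6 : √(inducedMetric g x).det * ((inducedMetric g x)⁻¹ * magneticPart g x
            * (inducedMetric g x)⁻¹) m k
        = ∑ l, (inducedMetric g x)⁻¹ k l * normalWeyl g (slice x) l (m + 1) (m + 2) := by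
      have := congrFun (congrFun (hg.normalWeylDual_eq hp) m) k
      rw [Matrix.smul_apply, smul_eq_mul] at this
      rw [← this, ← hs.apply m k]
      rfl
    rw [← mul_assoc, h6, ← Finset.sum_mul, ← neg_mul, ← Finset.sum_neg_distrib]
    congr 1
    exact Finset.sum_congr rfl fun l _ => by
      rw [hg.normalCurv_succ hp, inducedMetric_eq]; ring
  have h7 : ∑ i, ∑ j, H i (Fin.succ j) (slice x) * pd i (fun y => X y j) x
      + ∑ j, ∑ m : Fin 3, (∑ e, H m e (slice x)
          * christoffel g e m.succ (Fin.succ j) (slice x)) * X x j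
      = ∑ m : Fin 3, ∑ e, H m e (slice x)
      * (∑ j : Fin 3, christoffel g e m.succ j.succ (slice x) * X x j
        + ∑ j : Fin 3, if e = j.succ then pd m (fun y => X y j) x else 0) := by
    simp only [mul_add, Finset.sum_add_distrib]
    rw [add_comm]
    congr 1
    · simp only [Finset.mul_sum, Finset.sum_mul]
      rw [Finset.sum_comm]
      refine Finset.sum_congr rfl fun i _ => ?_
      rw [Finset.sum_comm]
      exact Finset.sum_congr rfl fun e _ => Finset.sum_congr rfl fun j _ => by ring
    · refine Finset.sum_congr rfl fun i _ => ?_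
      simp only [Finset.mul_sum]
      rw [Finset.sum_comm]
      simp
  simp only [h5] at h7
  have h8 : ∑ i, ∑ j, pd (Fin.succ i) (H i (Fin.succ j)) (slice x) * X x j
      = ∑ j, (∑ i : Fin 3, pd i.succ (H i j.succ) (slice x)) * X x j := by
    rw [Finset.sum_comm]
    simp only [Finset.sum_mul]
  simp only [h1, Finset.sum_neg_distrib, Finset.sum_add_distrib, h8, h2, add_mul]
  simp only [← Finset.sum_mul] at h4 h7 ⊢
  rw [h4]
  simp only [Finset.sum_neg_distrib, ← Finset.mul_sum] at h7
  linear_combination -h7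

end IsFoliatedVacuum

end

/-! ## The divergence theorem on coordinate spheres -/

/-- The unit sphere. -/
abbrev UnitSphere : Type := Metric.sphere (0 : Coord 3) 1

/-- The surface measure of the unit sphere. -/
abbrev sphereMeasure : Measure UnitSphere := (volume : Measure (Coord 3)).toSphere

/-- Differentiation under the integral over a compact space. -/
theorem hasDerivAt_integral_of_continuousOn {Ω : Type*} [TopologicalSpace Ω] [CompactSpace Ω]
    [MeasurableSpace Ω] [OpensMeasurableSpace Ω] {μ : Measure Ω} [IsFiniteMeasure μ]
    {F F' : ℝ → Ω → ℝ} {V : Set ℝ} (hV : IsOpen V) {t₀ : ℝ} (ht₀ : t₀ ∈ V)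
    (hF : ∀ t ∈ V, Continuous (F t))
    (hF' : ContinuousOn (fun q : ℝ × Ω => F' q.1 q.2) (V ×ˢ Set.univ))
    (hd : ∀ t ∈ V, ∀ u, HasDerivAt (fun t => F t u) (F' t u) t) :
    HasDerivAt (fun t => ∫ u, F t u ∂μ) (∫ u, F' t₀ u ∂μ) t₀ := by
  obtain ⟨ε, hε, hball⟩ := Metric.nhds_basis_closedBall.mem_iff.1 (hV.mem_nhds ht₀)
  have hcomp : IsCompact (Metric.closedBall t₀ ε ×ˢ (Set.univ : Set Ω)) :=
    (isCompact_closedBall t₀ ε).prod isCompact_univ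
  obtain ⟨C, hC⟩ := hcomp.exists_bound_of_continuousOn
    (hF'.mono (Set.prod_mono hball (Set.subset_univ _)))
  have hcont : Continuous (F' t₀) := by
    have h : ContinuousOn (fun u : Ω => F' t₀ u) Set.univ :=
      hF'.comp (f := fun u : Ω => (t₀, u)) (by fun_prop) (fun u _ => ⟨ht₀, Set.mem_univ _⟩)
    exact continuousOn_univ.1 h
  have hint : ∀ {f : Ω → ℝ}, Continuous f → Integrable f μ := by
    intro f hf
    obtain ⟨B, hB⟩ := isCompact_univ.exists_bound_of_continuousOn hf.continuousOn
    exact Integrable.of_bound hf.aestronglyMeasurable B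
      (Filter.Eventually.of_forall fun u => hB u (Set.mem_univ _))
  refine (hasDerivAt_integral_of_dominated_loc_of_deriv_le (bound := fun _ => C)
    (Metric.closedBall_mem_nhds t₀ hε) ?_ (hint (hF t₀ ht₀)) hcont.aestronglyMeasurable
    ?_ (integrable_const C) ?_).2
  · filter_upwards [hV.mem_nhds ht₀] with t ht using (hF t ht).aestronglyMeasurable
  · exact Filter.Eventually.of_forall fun u t ht => hC (t, u) ⟨ht, Set.mem_univ _⟩
  · exact Filter.Eventually.of_forall fun u t ht => hd t (hball ht) u

/-- The map of the unit sphere induced by a linear isometry. -/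
def sphereMap (e : Coord 3 ≃ₗᵢ[ℝ] Coord 3) (u : UnitSphere) : UnitSphere :=
  ⟨e u, by simp⟩

-- The surface measure of a set is defined by the volume of the cone over it, and an isometry
-- carries cones to cones of equal volume.
open scoped Pointwise in
theorem measurePreserving_sphereMap (e : Coord 3 ≃ₗᵢ[ℝ] Coord 3) :
    MeasurePreserving (sphereMap e) sphereMeasure sphereMeasure := by
  have hm : Continuous (sphereMap e) := by
    unfold sphereMap
    fun_prop
  refine ⟨hm.measurable, ?_⟩
  ext s hs
  rw [Measure.map_apply hm.measurable hs, Measure.toSphere_apply' _ (hm.measurable hs),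
    Measure.toSphere_apply' _ hs]
  congr 1
  have h : Set.Ioo (0 : ℝ) 1 • (Subtype.val '' (sphereMap e ⁻¹' s))
      = e ⁻¹' (Set.Ioo (0 : ℝ) 1 • (Subtype.val '' s : Set (Coord 3))) := by
    ext x
    simp only [Set.mem_smul, Set.mem_image, Set.mem_preimage]
    constructor
    · rintro ⟨r, hr, _, ⟨u, hu, rfl⟩, rfl⟩
      exact ⟨r, hr, e u, ⟨sphereMap e u, hu, rfl⟩, by simp⟩
    · rintro ⟨r, hr, _, ⟨u, hu, rfl⟩, hx⟩
      refine ⟨r, hr, e.symm u, ⟨sphereMap e.symm u, ?_, rfl⟩, ?_⟩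
      · have : sphereMap e (sphereMap e.symm u) = u := by
          ext1; simp [sphereMap]
        rwa [← this] at hu
      · apply e.injective
        rw [map_smul, e.apply_symm_apply, hx]
  rw [h]
  exact e.measurePreserving.measure_preimage_equiv (f := e.toHomeomorph.toMeasurableEquiv) _

/-- Rotation by the angle `θ` in the coordinate plane spanned by `e_i` and `e_j`. -/
def planeRotation (i j : Fin 3) (θ : ℝ) : Coord 3 →ₗ[ℝ] Coord 3 where
  toFun u := u + (Real.cos θ - 1) • (u i • EuclideanSpace.single i (1 : ℝ)
      + u j • EuclideanSpace.single j (1 : ℝ))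
    + Real.sin θ • (u i • EuclideanSpace.single j (1 : ℝ) - u j • EuclideanSpace.single i (1 : ℝ))
  map_add' u v := by simp only [PiLp.add_apply]; module
  map_smul' c u := by simp only [PiLp.smul_apply, smul_eq_mul, RingHom.id_apply]; module

theorem planeRotation_apply (i j : Fin 3) (θ : ℝ) (u : Coord 3) :
    planeRotation i j θ u = u + (Real.cos θ - 1) • (u i • EuclideanSpace.single i (1 : ℝ)
      + u j • EuclideanSpace.single j (1 : ℝ))
    + Real.sin θ • (u i • EuclideanSpace.single j (1 : ℝ)
      - u j • EuclideanSpace.single i (1 : ℝ)) := rfl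

theorem norm_planeRotation {i j : Fin 3} (hij : i ≠ j) (θ : ℝ) (u : Coord 3) :
    ‖planeRotation i j θ u‖ = ‖u‖ := by
  have h : ‖planeRotation i j θ u‖ ^ 2 = ‖u‖ ^ 2 := by
    have hcs := Real.sin_sq_add_cos_sq θ
    rw [EuclideanSpace.norm_sq_eq, EuclideanSpace.norm_sq_eq, planeRotation_apply]
    simp only [Real.norm_eq_abs, sq_abs, Fin.sum_univ_three]
    fin_cases i <;> fin_cases j <;> simp at hij ⊢ <;>
    first
      | linear_combination (u 0 ^ 2 + u 1 ^ 2) * hcs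
      | linear_combination (u 0 ^ 2 + u 2 ^ 2) * hcs
      | linear_combination (u 1 ^ 2 + u 2 ^ 2) * hcs
  exact (sq_eq_sq₀ (norm_nonneg _) (norm_nonneg _)).1 h

/-- The rotation as a linear isometry equivalence. -/
def planeRotationEquiv {i j : Fin 3} (hij : i ≠ j) (θ : ℝ) : Coord 3 ≃ₗᵢ[ℝ] Coord 3 :=
  LinearIsometry.toLinearIsometryEquiv
    ⟨planeRotation i j θ, norm_planeRotation hij θ⟩ rfl

theorem continuous_planeRotation (i j : Fin 3) :
    Continuous (fun q : ℝ × UnitSphere => planeRotation i j q.1 (q.2 : Coord 3)) := by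
  simp only [planeRotation_apply]
  fun_prop

theorem hasDerivAt_planeRotation (i j : Fin 3) (θ : ℝ) (u : Coord 3) :
    HasDerivAt (fun θ => planeRotation i j θ u)
      (-Real.sin θ • (u i • EuclideanSpace.single i (1 : ℝ)
        + u j • EuclideanSpace.single j (1 : ℝ))
      + Real.cos θ • (u i • EuclideanSpace.single j (1 : ℝ)
        - u j • EuclideanSpace.single i (1 : ℝ))) θ := by
  simp only [planeRotation_apply]
  exact ((((Real.hasDerivAt_cos θ).sub_const 1).smul_const _).const_add u).add
    ((Real.hasDerivAt_sin θ).smul_const _)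

/-- Rotational derivatives integrate to zero over the unit sphere. -/
theorem integral_rotational_derivative {f : Coord 3 → ℝ} {V : Set (Coord 3)} (hV : IsOpen V)
    (hf : SmoothOn f V) (hs : ∀ u : UnitSphere, (u : Coord 3) ∈ V) (i j : Fin 3) :
    ∫ u : UnitSphere, ((u : Coord 3) i * pd j f u - (u : Coord 3) j * pd i f u) ∂sphereMeasure
      = 0 := by
  by_cases hij : i = j
  · simp [hij]
  have hmem : ∀ (θ : ℝ) (u : UnitSphere), planeRotation i j θ (u : Coord 3) ∈ V := fun θ u =>
    hs (sphereMap (planeRotationEquiv hij θ) u)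
  have hfc : ContinuousOn (fderiv ℝ f) V :=
    (ContDiffOn.fderiv_of_isOpen (m := ((⊤ : ℕ∞) : WithTop ℕ∞)) hf hV (by simp)).continuousOn
  -- Differentiate the integral of f over the rotated sphere in the angle. At angle 0 the integrand
  -- is the rotational derivative, while rotation invariance of the measure makes the integral
  -- constant.
  have h := hasDerivAt_integral_of_continuousOn (μ := sphereMeasure) (V := Set.univ) isOpen_univ
    (F := fun θ (u : UnitSphere) => f (planeRotation i j θ (u : Coord 3)))
    (F' := fun θ (u : UnitSphere) => fderiv ℝ f (planeRotation i j θ (u : Coord 3))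
      (-Real.sin θ • ((u : Coord 3) i • EuclideanSpace.single i (1 : ℝ)
        + (u : Coord 3) j • EuclideanSpace.single j (1 : ℝ))
      + Real.cos θ • ((u : Coord 3) i • EuclideanSpace.single j (1 : ℝ)
        - (u : Coord 3) j • EuclideanSpace.single i (1 : ℝ)))) (Set.mem_univ 0)
    (fun θ _ => continuousOn_univ.1 ((ContDiffOn.continuousOn hf).comp
      ((continuous_planeRotation i j).comp (by fun_prop : Continuous fun u : UnitSphere => (θ, u))
        ).continuousOn (fun u _ => hmem θ u)))
    ((hfc.comp (continuous_planeRotation i j).continuousOn (fun q _ => hmem q.1 q.2)).clm_apply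
      (by fun_prop))
    (fun θ _ u => ((SmoothOn.differentiableAt hf hV (hmem θ u)).hasFDerivAt).comp_hasDerivAt θ
      (hasDerivAt_planeRotation i j θ u))
  have hconst : (fun θ => ∫ u : UnitSphere, f (planeRotation i j θ (u : Coord 3)) ∂sphereMeasure)
      = fun _ => ∫ u : UnitSphere, f u ∂sphereMeasure := by
    funext θ
    have hmp := measurePreserving_sphereMap (planeRotationEquiv hij θ)
    have hfs : Continuous (fun u : UnitSphere => f u) := continuousOn_univ.1
      ((ContDiffOn.continuousOn hf).comp (by fun_prop) (fun u _ => hs u))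
    have := integral_map (μ := sphereMeasure) hmp.measurable.aemeasurable
      (f := fun u : UnitSphere => f u) hfs.aestronglyMeasurable
    rw [hmp.map_eq] at this
    exact this.symm
  rw [hconst] at h
  have h0 := h.unique (hasDerivAt_const 0 _)
  rw [← h0]
  congr 1
  funext u
  have hp : planeRotation i j 0 (u : Coord 3) = u := by simp [planeRotation_apply]
  simp [hp, pd]

theorem isOpen_exterior (R₀ : ℝ) : IsOpen (exterior R₀) :=
  isOpen_lt continuous_const continuous_norm

theorem smul_mem_exterior {R₀ r : ℝ} (hR₀ : 0 < R₀) (hr : R₀ < r) (u : UnitSphere) :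
    r • (u : Coord 3) ∈ exterior R₀ := by
  simp only [exterior, Set.mem_ofPred_eq, norm_smul, Real.norm_eq_abs, norm_eq_of_mem_sphere,
    mul_one, abs_of_pos (hR₀.trans hr), hr]

theorem continuous_comp_smul {f : Coord 3 → ℝ} {R₀ : ℝ} (hR₀ : 0 < R₀)
    (hf : ContinuousOn f (exterior R₀)) :
    ContinuousOn (fun q : ℝ × UnitSphere => f (q.1 • (q.2 : Coord 3))) (Set.Ioi R₀ ×ˢ Set.univ) :=
  hf.comp (by fun_prop) fun q hq => smul_mem_exterior hR₀ hq.1 q.2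

theorem continuous_comp_smul_right {f : Coord 3 → ℝ} {R₀ r : ℝ} (hR₀ : 0 < R₀) (hr : R₀ < r)
    (hf : ContinuousOn f (exterior R₀)) :
    Continuous (fun u : UnitSphere => f (r • (u : Coord 3))) :=
  continuousOn_univ.1 (hf.comp (by fun_prop) fun u _ => smul_mem_exterior hR₀ hr u)

/-- The flux of a vector field through the coordinate sphere `S(r)`. -/
def sphereFlux (F : Fin 3 → Coord 3 → ℝ) (r : ℝ) : ℝ :=
  ∫ u : UnitSphere, r ^ 2 * ∑ i, F i (r • (u : Coord 3)) * (u : Coord 3) i ∂sphereMeasure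

/-- The derivative of the flux is the integral of the divergence. -/
theorem hasDerivAt_sphereFlux {F : Fin 3 → Coord 3 → ℝ} {R₀ r : ℝ} (hR₀ : 0 < R₀) (hr : R₀ < r)
    (hF : ∀ i, SmoothOn (F i) (exterior R₀)) :
    HasDerivAt (sphereFlux F)
      (∫ u : UnitSphere, r ^ 2 * ∑ i, pd i (F i) (r • (u : Coord 3)) ∂sphereMeasure) r := by
  have hE := isOpen_exterior R₀
  have hc : ∀ i, ContinuousOn (F i) (exterior R₀) := fun i => ContDiffOn.continuousOn (hF i)
  have hpc : ∀ i j, ContinuousOn (pd i (F j)) (exterior R₀) := fun i j =>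
    ContDiffOn.continuousOn (SmoothOn.pd (hF j) hE i)
  have h := hasDerivAt_integral_of_continuousOn (μ := sphereMeasure) (V := Set.Ioi R₀) isOpen_Ioi
    (F := fun r (u : UnitSphere) => r ^ 2 * ∑ i, F i (r • (u : Coord 3)) * (u : Coord 3) i)
    (F' := fun r (u : UnitSphere) => 2 * r * ∑ i, F i (r • (u : Coord 3)) * (u : Coord 3) i
      + r ^ 2 * ∑ i, (∑ j, (u : Coord 3) j * pd j (F i) (r • (u : Coord 3))) * (u : Coord 3) i)
    (t₀ := r) hr
    (fun t ht => continuous_const.mul (continuous_finsetSum _ fun i _ =>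
      (continuous_comp_smul_right hR₀ ht (hc i)).mul (by fun_prop)))
    (by
      refine ContinuousOn.add (ContinuousOn.mul (by fun_prop) (continuousOn_finsetSum _ fun i _ =>
        (continuous_comp_smul hR₀ (hc i)).mul (by fun_prop)))
        (ContinuousOn.mul (by fun_prop) (continuousOn_finsetSum _ fun i _ =>
        (continuousOn_finsetSum _ fun j _ => ContinuousOn.mul (by fun_prop)
          (continuous_comp_smul hR₀ (hpc j i))).mul (by fun_prop))))
    (by
      intro t ht u
      have hd : ∀ i, HasDerivAt (fun t : ℝ => F i (t • (u : Coord 3)))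
          (∑ j, (u : Coord 3) j * pd j (F i) (t • (u : Coord 3))) t := by
        intro i
        have h1 := (SmoothOn.differentiableAt (hF i) hE (smul_mem_exterior hR₀ ht u)).hasFDerivAt
        have h2 : HasDerivAt (fun t : ℝ => t • (u : Coord 3)) (u : Coord 3) t := by
          simpa using (hasDerivAt_id t).smul_const (u : Coord 3)
        have h3 := h1.comp_hasDerivAt t h2
        rwa [fderiv_apply_eq_sum_pd] at h3
      have h4 : HasDerivAt (fun t : ℝ => ∑ i, F i (t • (u : Coord 3)) * (u : Coord 3) i)
          (∑ i, (∑ j, (u : Coord 3) j * pd j (F i) (t • (u : Coord 3))) * (u : Coord 3) i) t :=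
        HasDerivAt.fun_sum fun i _ => (hd i).mul_const _
      have h5 : HasDerivAt (fun t : ℝ => t ^ 2) (2 * t) t := by simpa using hasDerivAt_pow 2 t
      exact h5.mul h4)
  have hrpos : 0 < r := hR₀.trans hr
  have hV : IsOpen {x : Coord 3 | R₀ < ‖r • x‖} := isOpen_lt continuous_const (by fun_prop)
  have hsm : ∀ i, SmoothOn (fun x => F i (r • x)) {x : Coord 3 | R₀ < ‖r • x‖} := fun i =>
    ContDiffOn.comp (hF i) (contDiff_const_smul r).contDiffOn fun x hx => hx
  have hsmp : ∀ i j, SmoothOn (fun x : Coord 3 => x j * F i (r • x)) {x : Coord 3 | R₀ < ‖r • x‖} :=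
    fun i j => ContDiffOn.mul (EuclideanSpace.proj (𝕜 := ℝ) j).contDiff.contDiffOn (hsm i)
  have hmem : ∀ u : UnitSphere, (u : Coord 3) ∈ {x : Coord 3 | R₀ < ‖r • x‖} := fun u =>
    smul_mem_exterior hR₀ hr u
  have hpd : ∀ (u : UnitSphere) (i j k : Fin 3), pd k (fun x : Coord 3 => x j * F i (r • x)) u
      = (if j = k then 1 else 0) * F i (r • (u : Coord 3))
        + (u : Coord 3) j * (r * pd k (F i) (r • (u : Coord 3))) := by
    intro u i j k
    rw [pd_mul (f := fun x : Coord 3 => x j) (g := fun x => F i (r • x))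
      (EuclideanSpace.proj (𝕜 := ℝ) j).differentiableAt
      (SmoothOn.differentiableAt (hsm i) hV (hmem u))]
    congr 2
    · have : HasFDerivAt (fun x : Coord 3 => x j) (EuclideanSpace.proj (𝕜 := ℝ) j) (u : Coord 3) :=
        (EuclideanSpace.proj (𝕜 := ℝ) j).hasFDerivAt
      rw [pd, this.fderiv]
      simp
    · have h1 := (SmoothOn.differentiableAt (hF i) hE (smul_mem_exterior hR₀ hr u)).hasFDerivAt
      have h2 : HasFDerivAt (fun x : Coord 3 => r • x)
          (r • ContinuousLinearMap.id ℝ (Coord 3)) (u : Coord 3) :=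
        (hasFDerivAt_id _).const_smul r
      have h3 : HasFDerivAt (fun x : Coord 3 => F i (r • x)) _ (u : Coord 3) :=
        HasFDerivAt.comp (u : Coord 3) h1 h2
      rw [pd, h3.fderiv]
      simp [pd]
  have hcont : ∀ i j, Continuous fun u : UnitSphere =>
      (u : Coord 3) i * pd j (fun x : Coord 3 => x j * F i (r • x)) u
        - (u : Coord 3) j * pd i (fun x : Coord 3 => x j * F i (r • x)) u := by
    intro i j
    have hp := fun (u : UnitSphere) => hpd u i j
    simp only [hp, if_true]
    generalize (if j = i then (1 : ℝ) else 0) = c₂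
    have a1 := continuous_comp_smul_right hR₀ hr (hc i)
    have a2 := continuous_comp_smul_right hR₀ hr (hpc j i)
    have a3 := continuous_comp_smul_right hR₀ hr (hpc i i)
    have hu : ∀ i, Continuous fun u : UnitSphere => (u : Coord 3) i := fun i => by fun_prop
    exact ((hu i).mul ((continuous_const.mul a1).add ((hu j).mul (continuous_const.mul a2)))).sub
      ((hu j).mul ((continuous_const.mul a1).add ((hu j).mul (continuous_const.mul a3))))
  have hint : ∀ {f : UnitSphere → ℝ}, Continuous f → Integrable f sphereMeasure := by
    intro f hf
    obtain ⟨B, hB⟩ := isCompact_univ.exists_bound_of_continuousOn hf.continuousOn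
    exact Integrable.of_bound hf.aestronglyMeasurable B
      (Filter.Eventually.of_forall fun u => hB u (Set.mem_univ _))
  -- The r-derivative of the integrand differs from r² div F by r times the sum of rotational
  -- derivatives of uⱼ Fᵢ(ru): that sum equals 2 u·F + r (uᵢuⱼ ∂ⱼFᵢ - |u|² div F), and |u| = 1.
  have hzero : ∫ u : UnitSphere, r * ∑ i, ∑ j,
      ((u : Coord 3) i * pd j (fun x : Coord 3 => x j * F i (r • x)) u
        - (u : Coord 3) j * pd i (fun x : Coord 3 => x j * F i (r • x)) u) ∂sphereMeasure = 0 := by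
    rw [integral_const_mul, integral_finsetSum _ fun i _ =>
      integrable_finsetSum _ fun j _ => hint (hcont i j)]
    rw [Finset.sum_eq_zero, mul_zero]
    intro i _
    rw [integral_finsetSum _ fun j _ => hint (hcont i j)]
    exact Finset.sum_eq_zero fun j _ => integral_rotational_derivative hV (hsmp i j) hmem i j
  have hdiv : Continuous fun u : UnitSphere => r ^ 2 * ∑ i, pd i (F i) (r • (u : Coord 3)) :=
    continuous_const.mul (continuous_finsetSum _ fun i _ =>
      continuous_comp_smul_right hR₀ hr (hpc i i))
  have hrot : Continuous fun u : UnitSphere => r * ∑ i, ∑ j,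
      ((u : Coord 3) i * pd j (fun x : Coord 3 => x j * F i (r • x)) u
        - (u : Coord 3) j * pd i (fun x : Coord 3 => x j * F i (r • x)) u) :=
    continuous_const.mul (continuous_finsetSum _ fun i _ => continuous_finsetSum _ fun j _ =>
      hcont i j)
  refine HasDerivAt.congr_deriv (f := sphereFlux F) h ?_
  symm
  rw [← add_zero (∫ u : UnitSphere, r ^ 2 * _ ∂sphereMeasure), ← hzero,
    ← integral_add (hint hdiv) (hint hrot)]
  congr 1
  funext u
  have hn : (u : Coord 3) 0 ^ 2 + (u : Coord 3) 1 ^ 2 + (u : Coord 3) 2 ^ 2 = 1 := by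
    have h1 := EuclideanSpace.norm_sq_eq (u : Coord 3)
    rw [norm_eq_of_mem_sphere u, Fin.sum_univ_three] at h1
    simpa using h1.symm
  simp only [hpd, Fin.sum_univ_three]
  simp
  linear_combination (-r ^ 2 * (pd 0 (F 0) (r • (u : Coord 3)) + pd 1 (F 1) (r • (u : Coord 3))
    + pd 2 (F 2) (r • (u : Coord 3)))) * hn

/-- The flux through large spheres converges if the divergence is integrable at infinity. -/
theorem exists_tendsto_sphereFlux {F : Fin 3 → Coord 3 → ℝ} {R₀ : ℝ} (hR₀ : 0 < R₀)
    (hF : ∀ i, SmoothOn (F i) (exterior R₀)) {s : ℝ} (hs : s < -3)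
    (hdiv : IsBigOPow (fun x => ∑ i, pd i (F i) x) s) :
    ∃ I, Tendsto (sphereFlux F) atTop (𝓝 I) := by
  obtain ⟨C, hC⟩ := Asymptotics.IsBigO.bound hdiv
  obtain ⟨R₁, -, hR₁⟩ := (Metric.hasBasis_cobounded_compl_closedBall (0 : Coord 3)).eventually_iff.1 hC
  set R := max R₀ R₁ with hR
  have hRpos : 0 < R := hR₀.trans_le (le_max_left _ _)
  have hd : ∀ r ∈ Set.Ioi R, HasDerivAt (sphereFlux F)
      (∫ u : UnitSphere, r ^ 2 * ∑ i, pd i (F i) (r • (u : Coord 3)) ∂sphereMeasure) r :=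
    fun r hr => hasDerivAt_sphereFlux hR₀ ((le_max_left _ _).trans_lt hr) hF
  refine ⟨_, tendsto_limUnder_of_hasDerivAt_of_integrableOn_Ioi hd ?_⟩
  -- The area factor r² raises the exponent to s + 2, which is below -1 exactly when s < -3.
  have hb : ∀ r ∈ Set.Ioi R,
      ‖∫ u : UnitSphere, r ^ 2 * ∑ i, pd i (F i) (r • (u : Coord 3)) ∂sphereMeasure‖
        ≤ C * sphereMeasure.real Set.univ * r ^ (s + 2) := by
    intro r hr
    have hr0 : 0 < r := hRpos.trans hr
    have h1 : ∀ u : UnitSphere, ‖r ^ 2 * ∑ i, pd i (F i) (r • (u : Coord 3))‖ ≤ C * r ^ (s + 2) := by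
      intro u
      have hn : ‖r • (u : Coord 3)‖ = r := by
        rw [norm_smul, norm_eq_of_mem_sphere u, mul_one, Real.norm_of_nonneg hr0.le]
      have h2 := hR₁ (x := r • (u : Coord 3)) (by
        simp only [Set.mem_compl_iff, Metric.mem_closedBall, dist_zero_right, hn, not_le]
        exact (le_max_right _ _).trans_lt hr)
      rw [hn, Real.norm_of_nonneg (Real.rpow_nonneg hr0.le s)] at h2
      rw [norm_mul, Real.norm_of_nonneg (sq_nonneg r), Real.rpow_add hr0, Real.rpow_two]
      nlinarith [mul_le_mul_of_nonneg_left h2 (sq_nonneg r)]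
    calc _ ≤ C * r ^ (s + 2) * sphereMeasure.real Set.univ :=
          norm_integral_le_of_norm_le_const (Filter.Eventually.of_forall h1)
      _ = _ := by ring
  have hg : IntegrableOn (fun r : ℝ => C * sphereMeasure.real Set.univ * r ^ (s + 2)) (Set.Ioi R) :=
    (integrableOn_Ioi_rpow_of_lt (by linarith) hRpos).const_mul _
  refine Integrable.mono' hg ?_ ((ae_restrict_iff' measurableSet_Ioi).2
    (Filter.Eventually.of_forall hb))
  refine (aestronglyMeasurable_deriv (sphereFlux F) _).congr ?_
  exact (ae_restrict_iff' measurableSet_Ioi).2 (Filter.Eventually.of_forall fun r hr => (hd r hr).deriv)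

section

/-! ## Conformal Killing fields of the Euclidean metric -/

/-- A trilinear array with the symmetries of the third derivatives of a conformal Killing field
vanishes. -/
theorem conformalKilling_third_order {P : Fin 3 → Fin 3 → Fin 3 → Fin 3 → ℝ}
    {L : Fin 3 → Fin 3 → ℝ}
    (h12 : ∀ m k i j, P m k i j = P k m i j) (h23 : ∀ m k i j, P m k i j = P m i k j)
    (hL : ∀ m k i j, P m k i j + P m k j i = L m k * (if i = j then 1 else 0))
    (m k i j : Fin 3) : P m k i j = 0 := by
  -- As for the Christoffel symbols, permuting the three last indices solves for P in terms of L.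
  have hP : ∀ m k i j, 2 * P m k i j = L m k * (if i = j then 1 else 0)
      + L m i * (if k = j then 1 else 0) - L m j * (if k = i then 1 else 0) := by
    intro m k i j
    linear_combination hL m k i j + hL m i k j - hL m j k i + h23 m k i j - h23 m k j i
      - h23 m i j k
  have hS : ∀ m k i j, L m k * (if i = j then 1 else 0)
      + L m i * (if k = j then 1 else 0) - L m j * (if k = i then 1 else 0)
      = L k m * (if i = j then 1 else 0)
      + L k i * (if m = j then 1 else 0) - L k j * (if m = i then 1 else 0) := by
    intro m k i j
    rw [← hP, ← hP, h12]
  -- Compatibility of this formula with symmetry in m, k kills L. Three distinct indices are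
  -- essential: they remove the off-diagonal entries, and the diagonal ones are pairwise opposite,
  -- which forces zero only with three of them.
  have hL0 : ∀ m i, L m i = 0 := by
    have hsymm : ∀ m k, L m k = L k m := by
      intro m k
      have h1 := hL m k 0 0
      have h2 := hL k m 0 0
      simp only [if_true] at h1 h2
      linear_combination -h1 + h2 + 2 * h12 m k 0 0
    have hoff : L 0 1 = 0 ∧ L 0 2 = 0 ∧ L 1 2 = 0 := by
      have h1 := hS 0 2 1 2
      have h2 := hS 0 1 2 1
      have h3 := hS 1 0 2 0
      simp at h1 h2 h3
      exact ⟨h1, h2, h3⟩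
    have hdiag : L 0 0 = -L 1 1 ∧ L 0 0 = -L 2 2 ∧ L 1 1 = -L 2 2 := by
      have h1 := hS 0 1 0 1
      have h2 := hS 0 2 0 2
      have h3 := hS 1 2 1 2
      simp at h1 h2 h3
      exact ⟨h1, h2, h3⟩
    obtain ⟨a, b, c⟩ := hoff
    obtain ⟨a', b', c'⟩ := hdiag
    have e0 : L 0 0 = 0 := by linarith
    have e1 : L 1 1 = 0 := by linarith
    have e2 : L 2 2 = 0 := by linarith
    intro m i
    fin_cases m <;> fin_cases i <;> simp [a, b, c, e0, e1, e2, hsymm 1 0, hsymm 2 0, hsymm 2 1]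
  have := hP m k i j
  simp only [hL0] at this
  linarith

/-- A central difference is exact for functions with vanishing third derivative. -/
theorem central_difference {f f₁ f₂ : ℝ → ℝ}
    (h0 : ∀ t ∈ Set.Icc (-1 : ℝ) 1, HasDerivAt f (f₁ t) t)
    (h1 : ∀ t ∈ Set.Icc (-1 : ℝ) 1, HasDerivAt f₁ (f₂ t) t)
    (h2 : ∀ t ∈ Set.Icc (-1 : ℝ) 1, HasDerivAt f₂ 0 t) : f 1 - f (-1) = 2 * f₁ 0 := by
  have key : ∀ {φ : ℝ → ℝ}, (∀ t ∈ Set.Icc (-1 : ℝ) 1, HasDerivAt φ 0 t) →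
      ∀ t ∈ Set.Icc (-1 : ℝ) 1, φ t = φ (-1) := fun {φ} hφ =>
    constant_of_has_deriv_right_zero (fun t ht => (hφ t ht).continuousAt.continuousWithinAt)
      fun t ht => (hφ t (Set.Ico_subset_Icc_self ht)).hasDerivWithinAt
  -- `f₂` is constant, so `f₁` is affine and `f` quadratic; for a quadratic function the central
  -- difference is exact.
  have k2 := key h2
  have k1 : ∀ t ∈ Set.Icc (-1 : ℝ) 1, f₁ t - f₂ (-1) * t = f₁ (-1) - f₂ (-1) * (-1) :=
    key (φ := fun t => f₁ t - f₂ (-1) * t) fun t ht => by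
      have := (h1 t ht).sub ((hasDerivAt_id t).const_mul (f₂ (-1)))
      rw [k2 t ht] at this
      exact this.congr_deriv (by simp)
  have k0 := key (φ := fun t => f t - f₁ 0 * t - f₂ (-1) / 2 * t ^ 2) (fun t ht => by
      have h3 := k1 t ht
      have h4 := k1 0 (by norm_num)
      have := ((h0 t ht).sub ((hasDerivAt_id t).const_mul (f₁ 0))).sub
        ((hasDerivAt_pow 2 t).const_mul (f₂ (-1) / 2))
      refine HasDerivAt.congr_deriv this ?_
      simp
      linarith) 1 (by norm_num)
  linarith

theorem IsBigOPow.comp_add {F : Type*} [Norm F] {f : Coord 3 → F} {q : ℝ} (hq : 0 ≤ q)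
    (hf : IsBigOPow f q) (v : Coord 3) : IsBigOPow (fun x => f (x + v)) q := by
  have ht : Tendsto (fun x : Coord 3 => x + v) (Bornology.cobounded (Coord 3))
      (Bornology.cobounded (Coord 3)) := by
    rw [← tendsto_norm_atTop_iff_cobounded]
    refine tendsto_atTop_mono (f := fun x : Coord 3 => ‖x‖ - ‖v‖) (fun x => ?_)
      (tendsto_atTop_add_const_right _ _ tendsto_norm_cobounded_atTop)
    have := norm_sub_le (x + v) v
    rw [add_sub_cancel_right] at this
    linarith
  refine Asymptotics.IsBigO.trans (Asymptotics.IsBigO.comp_tendsto hf ht) ?_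
  -- Once ‖x‖ ≥ ‖v‖ one has ‖x + v‖ ≤ 2‖x‖, and q ≥ 0 makes the power monotone.
  refine Asymptotics.IsBigO.of_bound (2 ^ q) ?_
  filter_upwards [tendsto_norm_cobounded_atTop.eventually_ge_atTop ‖v‖] with x hx
  simp only [Function.comp]
  rw [Real.norm_of_nonneg (by positivity), Real.norm_of_nonneg (by positivity),
    ← Real.mul_rpow (by norm_num) (norm_nonneg _)]
  refine Real.rpow_le_rpow (norm_nonneg _) ?_ hq
  linarith [norm_add_le x v]

theorem IsBigOPow.component {X : Coord 3 → Coord 3} {q : ℝ} (hX : IsBigOPow X q) (j : Fin 3) :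
    IsBigOPow (fun x => X x j) q :=
  Asymptotics.IsBigO.trans (Asymptotics.IsBigO.of_bound 1 (Eventually.of_forall fun x => by
    simpa using PiLp.norm_apply_le (X x) j)) hX

namespace IsFlatConformalKilling

variable {S : Set (Coord 3)} {X : Coord 3 → Coord 3}

/-- The (0, 0) component of the equation gives lam = 2 ∂₀X₀, so the unspecified factor inherits the
smoothness and growth of ∂X. -/
theorem killing_eq (hX : IsFlatConformalKilling S X) {x : Coord 3} (hx : x ∈ S) (i j : Fin 3) :
    pd i (fun y => X y j) x + pd j (fun y => X y i) x
      = 2 * pd 0 (fun y => X y 0) x * (if i = j then 1 else 0) := by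
  obtain ⟨lam, hlam⟩ := hX.killing
  have h0 := hlam x hx 0 0
  rw [if_pos rfl] at h0
  rw [hlam x hx i j]
  congr 1
  linarith

/-- Twice differentiating the Killing equation gives an array with exactly the symmetries of
`conformalKilling_third_order`. -/
theorem third_derivative (hX : IsFlatConformalKilling S X) (hS : IsOpen S) {x : Coord 3}
    (hx : x ∈ S) (m k i j : Fin 3) : pd m (pd k (pd i (fun y => X y j))) x = 0 := by
  have hc : ∀ j, SmoothOn (fun y => X y j) S := fun j => smoothOn_component hX.smooth j
  have hc1 : ∀ i j, SmoothOn (pd i (fun y => X y j)) S := fun i j => SmoothOn.pd (hc j) hS i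
  have hc2 : ∀ k i j, SmoothOn (pd k (pd i (fun y => X y j))) S :=
    fun k i j => SmoothOn.pd (hc1 i j) hS k
  have h2 : ∀ y ∈ S, ∀ k i j, pd k (pd i (fun y => X y j)) y + pd k (pd j (fun y => X y i)) y
      = 2 * (if i = j then 1 else 0) * pd k (pd 0 (fun y => X y 0)) y := by
    intro y hy k i j
    rw [← pd_add (SmoothOn.differentiableAt (hc1 i j) hS hy)
      (SmoothOn.differentiableAt (hc1 j i) hS hy),
      ← pd_const_mul (SmoothOn.differentiableAt (hc1 0 0) hS hy)]
    refine pd_congr_on hS hy (fun z hz => ?_) k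
    rw [hX.killing_eq hz]
    ring
  refine conformalKilling_third_order (P := fun m k i j => pd m (pd k (pd i (fun y => X y j))) x)
    (L := fun m k => 2 * pd m (pd k (pd 0 (fun y => X y 0))) x) ?_ ?_ ?_ m k i j
  · exact fun m k i j => pd_pd_comm (hc1 i j) hS hx m k
  · exact fun m k i j => pd_congr_on hS hx (fun y hy => pd_pd_comm (hc j) hS hy k i) m
  · intro m k i j
    rw [← pd_add (SmoothOn.differentiableAt (hc2 k i j) hS hx)
      (SmoothOn.differentiableAt (hc2 k j i) hS hx), mul_right_comm,
      ← pd_const_mul (SmoothOn.differentiableAt (hc2 k 0 0) hS hx)]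
    exact pd_congr_on hS hx (fun y hy => h2 y hy k i j) m

/-- The first derivatives of a conformal Killing field are central differences. -/
theorem pd_eq (hX : IsFlatConformalKilling S X) (hS : IsOpen S) {x : Coord 3} {i : Fin 3}
    (hx : ∀ t ∈ Set.Icc (-1 : ℝ) 1, x + t • EuclideanSpace.single i (1 : ℝ) ∈ S) (j : Fin 3) :
    pd i (fun y => X y j) x = (1 / 2) * (X (x + EuclideanSpace.single i 1) j
      - X (x + -EuclideanSpace.single i 1) j) := by
  have hc : SmoothOn (fun y => X y j) S := smoothOn_component hX.smooth j
  have hd : ∀ {f : Coord 3 → ℝ}, SmoothOn f S → ∀ t ∈ Set.Icc (-1 : ℝ) 1,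
      HasDerivAt (fun t : ℝ => f (x + t • EuclideanSpace.single i (1 : ℝ)))
        (pd i f (x + t • EuclideanSpace.single i (1 : ℝ))) t := by
    intro f hf t ht
    have h2 : HasDerivAt (fun t : ℝ => x + t • EuclideanSpace.single i (1 : ℝ))
        (EuclideanSpace.single i (1 : ℝ)) t := by
      simpa using ((hasDerivAt_id t).smul_const (EuclideanSpace.single i (1 : ℝ))).const_add x
    exact (SmoothOn.differentiableAt hf hS (hx t ht)).hasFDerivAt.comp_hasDerivAt t h2
  have h := central_difference (hd hc) (hd (SmoothOn.pd hc hS i)) fun t ht => by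
    have := hd (SmoothOn.pd (SmoothOn.pd hc hS i) hS i) t ht
    rwa [hX.third_derivative hS (hx t ht)] at this
  simp only [one_smul, neg_smul, zero_smul, add_zero] at h
  linarith

/-- The bound on X carries over to ∂X through central differences of step one. The rate r^q, rather
than r^(q-1), is enough here because ∂X is multiplied by h only. -/
theorem isBigOPow_pd {R₀ q : ℝ} (hX : IsFlatConformalKilling (exterior R₀) X) (hq : 0 ≤ q)
    (hO : IsBigOPow X q) (i j : Fin 3) : IsBigOPow (pd i (fun y => X y j)) q := by
  have h : IsBigOPow (fun x => (1 / 2) * (X (x + EuclideanSpace.single i 1) j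
      - X (x + -EuclideanSpace.single i 1) j)) q :=
    Asymptotics.IsBigO.const_mul_left (Asymptotics.IsBigO.sub ((hO.component j).comp_add hq _)
      ((hO.component j).comp_add hq _)) _
  refine Asymptotics.IsBigO.congr' h ?_ (EventuallyEq.refl _ _)
  filter_upwards [tendsto_norm_cobounded_atTop.eventually_gt_atTop (R₀ + 1)] with x hx
  refine (hX.pd_eq (isOpen_exterior R₀) (fun t ht => ?_) j).symm
  have h1 : ‖t • EuclideanSpace.single i (1 : ℝ)‖ ≤ 1 := by
    rw [norm_smul, PiLp.norm_single, norm_one, mul_one, Real.norm_eq_abs]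
    exact abs_le.2 ht
  have h2 := norm_sub_le (x + t • EuclideanSpace.single i (1 : ℝ))
    (t • EuclideanSpace.single i (1 : ℝ))
  rw [add_sub_cancel_right] at h2
  change R₀ < ‖x + t • EuclideanSpace.single i (1 : ℝ)‖
  linarith

end IsFlatConformalKilling

end

section

/-! ## Growth at infinity -/

namespace IsBigOPow

variable {f f' : Coord 3 → ℝ} {s t : ℝ}

theorem congr' (hf : IsBigOPow f s) (h : ∀ᶠ x in Bornology.cobounded (Coord 3), f x = f' x) :
    IsBigOPow f' s :=
  Asymptotics.IsBigO.congr' hf h (EventuallyEq.refl _ _)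

theorem add (hf : IsBigOPow f s) (hf' : IsBigOPow f' s) : IsBigOPow (fun x => f x + f' x) s :=
  Asymptotics.IsBigO.add hf hf'

theorem sub (hf : IsBigOPow f s) (hf' : IsBigOPow f' s) : IsBigOPow (fun x => f x - f' x) s :=
  Asymptotics.IsBigO.sub hf hf'

theorem neg (hf : IsBigOPow f s) : IsBigOPow (fun x => -f x) s :=
  Asymptotics.IsBigO.neg_left hf

theorem const_mul (c : ℝ) (hf : IsBigOPow f s) : IsBigOPow (fun x => c * f x) s :=
  Asymptotics.IsBigO.const_mul_left hf c

theorem sum {ι : Type*} {I : Finset ι} {f : ι → Coord 3 → ℝ} (hf : ∀ i ∈ I, IsBigOPow (f i) s) :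
    IsBigOPow (fun x => ∑ i ∈ I, f i x) s := by
  have := Asymptotics.IsBigO.sum hf
  simpa only [IsBigOPow, Finset.sum_fn] using this

theorem mul (hf : IsBigOPow f s) (hf' : IsBigOPow f' t) :
    IsBigOPow (fun x => f x * f' x) (s + t) := by
  refine Asymptotics.IsBigO.congr' (Asymptotics.IsBigO.mul hf hf') (EventuallyEq.refl _ _) ?_
  filter_upwards [tendsto_norm_cobounded_atTop.eventually_gt_atTop 0] with x hx
  rw [Real.rpow_add hx]

theorem mono (hf : IsBigOPow f s) (hst : s ≤ t) : IsBigOPow f t := by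
  refine Asymptotics.IsBigO.trans hf (Asymptotics.IsBigO.of_bound 1 ?_)
  filter_upwards [tendsto_norm_cobounded_atTop.eventually_ge_atTop 1] with x hx
  rw [one_mul, Real.norm_of_nonneg (by positivity), Real.norm_of_nonneg (by positivity)]
  exact Real.rpow_le_rpow_of_exponent_le hx hst

theorem of_tendsto {a : ℝ} (h : Tendsto f (Bornology.cobounded (Coord 3)) (𝓝 a)) :
    IsBigOPow f 0 := by
  unfold IsBigOPow
  simpa only [Real.rpow_zero] using h.isBigO_one ℝ

theorem bounded_mul (hf : IsBigOPow f 0) (hf' : IsBigOPow f' t) :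
    IsBigOPow (fun x => f x * f' x) t := by
  simpa using hf.mul hf'

theorem mul_bounded (hf : IsBigOPow f s) (hf' : IsBigOPow f' 0) :
    IsBigOPow (fun x => f x * f' x) s := by
  simpa using hf.mul hf'

end IsBigOPow

/-- The inverse of a matrix-valued function tending to the identity. -/
theorem tendsto_inv_one {α : Type*} {l : Filter α} {A : α → Matrix (Fin 3) (Fin 3) ℝ}
    (hA : Tendsto A l (𝓝 1)) : Tendsto (fun x => (A x)⁻¹) l (𝓝 1) := by
  have hdet : Tendsto (fun x => (A x).det) l (𝓝 1) := by
    have := (continuous_id.matrix_det (A := fun A : Matrix (Fin 3) (Fin 3) ℝ => A)).tendsto 1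
    rw [Matrix.det_one] at this
    exact this.comp hA
  have hadj : Tendsto (fun x => (A x).adjugate) l (𝓝 1) := by
    have := (continuous_id.matrix_adjugate (A := fun A : Matrix (Fin 3) (Fin 3) ℝ => A)).tendsto 1
    rw [Matrix.adjugate_one] at this
    exact this.comp hA
  have := (hdet.inv₀ one_ne_zero).smul hadj
  simpa only [Matrix.inv_def, Ring.inverse_eq_inv, inv_one, one_smul] using this

/-! ### Asymptotically flat metrics -/

/-- `γ = (1 + M / 2r)⁴ (η + h)` for `r > R₀`, with `h → 0` at infinity. -/
structure IsAsymptoticallyFlat (M R₀ : ℝ) (γ h : TwoTensor 3) : Prop where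
  pos : 0 < R₀
  eq : ∀ x ∈ exterior R₀, γ x = (1 + M / (2 * ‖x‖)) ^ 4 • (1 + h x)
  tendsto : ∀ i j, Tendsto (fun x => h x i j) (Bornology.cobounded (Coord 3)) (𝓝 0)

/-- The conformal factor of the Schwarzschild metric in isotropic coordinates. -/
def conformalFactor (M : ℝ) (x : Coord 3) : ℝ := (1 + M / (2 * ‖x‖)) ^ 4

theorem tendsto_conformalFactor (M : ℝ) :
    Tendsto (conformalFactor M) (Bornology.cobounded (Coord 3)) (𝓝 1) := by
  have h : Tendsto (fun x : Coord 3 => M / (2 * ‖x‖)) (Bornology.cobounded (Coord 3)) (𝓝 0) :=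
    (tendsto_norm_cobounded_atTop.const_mul_atTop (by norm_num : (0 : ℝ) < 2)).const_div_atTop M
  have := (h.const_add 1).pow 4
  rwa [add_zero, one_pow] at this

theorem differentiableAt_conformalFactor (M : ℝ) {x : Coord 3} (hx : x ≠ 0) :
    DifferentiableAt ℝ (conformalFactor M) x := by
  have h1 : DifferentiableAt ℝ (fun x : Coord 3 => ‖x‖) x :=
    differentiableAt_id.norm ℝ hx
  have h2 : (2 : ℝ) * ‖x‖ ≠ 0 := mul_ne_zero two_ne_zero (norm_ne_zero_iff.2 hx)
  unfold conformalFactor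
  fun_prop (disch := assumption)

theorem eventually_mem_exterior (R₀ : ℝ) :
    ∀ᶠ x in Bornology.cobounded (Coord 3), x ∈ exterior R₀ :=
  tendsto_norm_cobounded_atTop.eventually_gt_atTop R₀

namespace IsAsymptoticallyFlat

variable {M R₀ : ℝ} {γ h : TwoTensor 3}

theorem tendsto_one_add (hγ : IsAsymptoticallyFlat M R₀ γ h) :
    Tendsto (fun x => 1 + h x) (Bornology.cobounded (Coord 3)) (𝓝 1) := by
  have : Tendsto h (Bornology.cobounded (Coord 3)) (𝓝 0) :=
    tendsto_pi_nhds.2 fun i => tendsto_pi_nhds.2 fun j => hγ.tendsto i j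
  simpa using this.const_add (1 : Matrix (Fin 3) (Fin 3) ℝ)

theorem tendsto_metric (hγ : IsAsymptoticallyFlat M R₀ γ h) :
    Tendsto γ (Bornology.cobounded (Coord 3)) (𝓝 1) := by
  have h1 := (tendsto_conformalFactor M).smul hγ.tendsto_one_add
  rw [one_smul] at h1
  refine h1.congr' ?_
  filter_upwards [eventually_mem_exterior R₀] with x hx
  exact (hγ.eq x hx).symm

theorem _root_.GravCharge.isBigOPow_apply {A : TwoTensor 3} {B : Matrix (Fin 3) (Fin 3) ℝ}
    (h : Tendsto A (Bornology.cobounded (Coord 3)) (𝓝 B)) (i j : Fin 3) :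
    IsBigOPow (fun x => A x i j) 0 :=
  IsBigOPow.of_tendsto ((tendsto_pi_nhds.1 ((tendsto_pi_nhds.1 h) i)) j)

theorem isBigOPow_metric (hγ : IsAsymptoticallyFlat M R₀ γ h) (i j : Fin 3) :
    IsBigOPow (fun x => γ x i j) 0 :=
  isBigOPow_apply hγ.tendsto_metric i j

theorem isBigOPow_inv (hγ : IsAsymptoticallyFlat M R₀ γ h) (i j : Fin 3) :
    IsBigOPow (fun x => (γ x)⁻¹ i j) 0 :=
  isBigOPow_apply (tendsto_inv_one hγ.tendsto_metric) i j

theorem isBigOPow_sqrt_det (hγ : IsAsymptoticallyFlat M R₀ γ h) :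
    IsBigOPow (fun x => √(γ x).det) 0 := by
  have := ((continuous_id.matrix_det (A := fun A : Matrix (Fin 3) (Fin 3) ℝ => A)).sqrt.tendsto
    1).comp hγ.tendsto_metric
  exact IsBigOPow.of_tendsto this

/-- The derivatives of `h` decay like the Christoffel symbols of `η + h`. -/
theorem isBigOPow_pd (hγ : IsAsymptoticallyFlat M R₀ γ h)
    (hsymm : ∀ x ∈ exterior R₀, (γ x).IsSymm) {c : ℝ}
    (hΓ : ∀ a i j, IsBigOPow (christoffel (fun x => 1 + h x) a i j) c) (k i j : Fin 3) :
    IsBigOPow (pd k (fun y => h y i j)) c := by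
  have hm : ∀ a b, IsBigOPow (fun x => (1 + h x) a b) 0 := isBigOPow_apply hγ.tendsto_one_add
  -- Metric compatibility for η + h expresses ∂h through (η + h)Γ, and the factor η + h is bounded.
  have hO : IsBigOPow (fun x => ∑ a, (1 + h x) i a * christoffel (fun x => 1 + h x) a k j x
      + ∑ a, (1 + h x) j a * christoffel (fun x => 1 + h x) a k i x) c :=
    (IsBigOPow.sum fun a _ => (hm i a).bounded_mul (hΓ a k j)).add
      (IsBigOPow.sum fun a _ => (hm j a).bounded_mul (hΓ a k i))
  refine hO.congr' ?_
  have hdet : ∀ᶠ x in Bornology.cobounded (Coord 3), (1 + h x).det ≠ 0 := by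
    have := ((continuous_id.matrix_det (A := fun A : Matrix (Fin 3) (Fin 3) ℝ => A)).tendsto
      1).comp hγ.tendsto_one_add
    rw [Matrix.det_one] at this
    exact this.eventually_ne one_ne_zero
  -- Symmetry is known for γ and passes to h where the conformal factor is nonzero. A whole open
  -- exterior region is needed, since derivatives of h are compared.
  obtain ⟨R₁, -, hR₁⟩ := (Metric.hasBasis_cobounded_compl_closedBall (0 : Coord 3)).eventually_iff.1
    (((tendsto_conformalFactor M).eventually_ne one_ne_zero).and (eventually_mem_exterior R₀))
  filter_upwards [hdet, eventually_mem_exterior R₁] with x h0 hx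
  have hs : ∀ y ∈ exterior R₁, ∀ a b, h y a b = h y b a := by
    intro y hy a b
    obtain ⟨h1, h2⟩ := hR₁ (x := y) (by
      rw [Set.mem_compl_iff, mem_closedBall_zero_iff, not_le]; exact hy)
    have h3 := (hsymm y h2).apply a b
    rw [hγ.eq y h2] at h3
    have h4 : (1 : Matrix (Fin 3) (Fin 3) ℝ) b a + h y b a = (1 : Matrix (Fin 3) (Fin 3) ℝ) a b + h y a b :=
      mul_left_cancel₀ h1 h3
    rw [Matrix.isSymm_one.apply] at h4
    exact (add_left_cancel h4).symm
  have hp : ∀ k a b, pd k (fun y => (1 + h y) a b) x = pd k (fun y => h y a b) x := by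
    intro k a b
    simp only [pd, Matrix.add_apply, fderiv_const_add]
  have hps : ∀ k a b, pd k (fun y => h y a b) x = pd k (fun y => h y b a) x := fun k a b =>
    pd_congr_on (isOpen_exterior R₁) hx (fun y hy => hs y hy a b) k
  rw [sum_metric_mul_christoffel (g := fun x => 1 + h x) h0,
    sum_metric_mul_christoffel (g := fun x => 1 + h x) h0]
  simp only [hp]
  rw [hps k j i, hps j i k, hps i k j]
  ring

/-- Regularity is given for γ only; where the conformal factor φ is nonzero, h = φ⁻¹γ - 1. -/
theorem differentiableAt (hγ : IsAsymptoticallyFlat M R₀ γ h)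
    (hsmooth : SmoothMat γ (exterior R₀)) {x : Coord 3} (hx : x ∈ exterior R₀)
    (h0 : conformalFactor M x ≠ 0) (i j : Fin 3) : DifferentiableAt ℝ (fun y => h y i j) x := by
  have hφ := differentiableAt_conformalFactor M (x := x)
    (norm_pos_iff.1 (hγ.pos.trans hx))
  have hd : DifferentiableAt ℝ (fun y => (conformalFactor M y)⁻¹ * γ y i j
      - (1 : Matrix (Fin 3) (Fin 3) ℝ) i j) x :=
    ((hφ.inv h0).mul (hsmooth.differentiableAt (isOpen_exterior R₀) hx i j)).sub_const _
  refine hd.congr_of_eventuallyEq ?_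
  filter_upwards [(isOpen_exterior R₀).mem_nhds hx, hφ.continuousAt.eventually_ne h0] with y hy hy0
  rw [hγ.eq y hy, Matrix.smul_apply, smul_eq_mul, ← conformalFactor, inv_mul_cancel_left₀ hy0,
    Matrix.add_apply, add_sub_cancel_left]

end IsAsymptoticallyFlat

end

/-! ## The conformal Killing term -/

/-- Contraction of a symmetric trace-free array with the covariant derivative of a conformal
Killing field: only the deviation from conformal flatness contributes. -/
theorem sum_symm_traceFree_mul {A h D : Fin 3 → Fin 3 → ℝ} {dh : Fin 3 → Fin 3 → Fin 3 → ℝ}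
    {φ lam : ℝ} {dφ X : Fin 3 → ℝ} (hA : ∀ i k, A i k = A k i)
    (htr : ∑ i, ∑ k, A i k * ((if i = k then 1 else 0) + h i k) = 0)
    (hD : ∀ i k, D i k + D k i = lam * (if i = k then 1 else 0)) :
    ∑ i, ∑ k, A i k * ∑ j, ((1 / 2) *
      ((dφ i * ((if k = j then 1 else 0) + h k j) + φ * dh i k j)
        + (dφ j * ((if k = i then 1 else 0) + h k i) + φ * dh j k i)
        - (dφ k * ((if i = j then 1 else 0) + h i j) + φ * dh k i j)) * X j
      + φ * ((if k = j then 1 else 0) + h k j) * D i j)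
      = φ * ∑ i, ∑ k, A i k * ((1 / 2) * ∑ j, dh j k i * X j + ∑ j, h k j * D i j
        - (1 / 2) * lam * h i k) := by
  have h10 := hA 1 0
  have h20 := hA 2 0
  have h21 := hA 2 1
  have d00 := hD 0 0
  have d11 := hD 1 1
  have d22 := hD 2 2
  have d01 := hD 0 1
  have d02 := hD 0 2
  have d12 := hD 1 2
  simp [Fin.sum_univ_three, h10, h20, h21] at htr d00 d11 d22 d01 d02 d12 ⊢
  -- Symmetry of A cancels the terms with dφ i and dφ k. The rest of dφ multiplies the trace, and D
  -- symmetrizes to lam δ / 2 = lam (δ + h) / 2 - lam h / 2, whose first part is again the trace.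
  linear_combination ((1 / 2) * (dφ 0 * X 0 + dφ 1 * X 1 + dφ 2 * X 2) + (1 / 2) * φ * lam) * htr
    + (1 / 2) * φ * A 0 0 * d00 + (1 / 2) * φ * A 1 1 * d11 + (1 / 2) * φ * A 2 2 * d22
    + φ * A 0 1 * d01 + φ * A 0 2 * d02 + φ * A 1 2 * d12

section

namespace IsAsymptoticallyFlat

variable {M R₀ : ℝ} {γ h : TwoTensor 3}

theorem apply_eq (hγ : IsAsymptoticallyFlat M R₀ γ h) {x : Coord 3} (hx : x ∈ exterior R₀)
    (i j : Fin 3) : γ x i j = conformalFactor M x * ((if i = j then 1 else 0) + h x i j) := by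
  rw [hγ.eq x hx, Matrix.smul_apply, smul_eq_mul, Matrix.add_apply, Matrix.one_apply,
    conformalFactor]

theorem pd_eq (hγ : IsAsymptoticallyFlat M R₀ γ h) (hsmooth : SmoothMat γ (exterior R₀))
    {x : Coord 3} (hx : x ∈ exterior R₀) (h0 : conformalFactor M x ≠ 0) (a i j : Fin 3) :
    pd a (fun y => γ y i j) x
      = pd a (conformalFactor M) x * ((if i = j then 1 else 0) + h x i j)
        + conformalFactor M x * pd a (fun y => h y i j) x := by
  rw [pd_congr_on (isOpen_exterior R₀) hx (fun y hy => hγ.apply_eq hy i j)]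
  have hd := hγ.differentiableAt hsmooth hx h0 i j
  rw [pd_mul (differentiableAt_conformalFactor M (norm_pos_iff.1 (hγ.pos.trans hx)))
    (hd.const_add _)]
  simp only [pd, fderiv_const_add]

/-- The charge density of a conformal Killing field decays faster than that of a general field. -/
theorem isBigOPow_contraction (hγ : IsAsymptoticallyFlat M R₀ γ h)
    (hsmooth : SmoothMat γ (exterior R₀)) (hsymm : ∀ x ∈ exterior R₀, (γ x).IsSymm)
    (hdet : ∀ x ∈ exterior R₀, IsUnit (γ x).det) {X : Coord 3 → Coord 3}
    (hX : IsFlatConformalKilling (exterior R₀) X) {T : TwoTensor 3}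
    (hTsymm : ∀ x ∈ exterior R₀, ((γ x)⁻¹ * T x * (γ x)⁻¹).IsSymm)
    (hTtr : ∀ x ∈ exterior R₀, ((γ x)⁻¹ * T x).trace = 0) {c d q t s : ℝ} (hq : 0 ≤ q)
    (hOh : ∀ i j, IsBigOPow (fun x => h x i j) d)
    (hOΓ : ∀ a i j, IsBigOPow (christoffel (fun x => 1 + h x) a i j) c)
    (hOX : IsBigOPow X q) (hOT : ∀ i j, IsBigOPow (fun x => T x i j) t)
    (hc : t + c + q ≤ s) (hd : t + q + d ≤ s) :
    IsBigOPow (fun x => ∑ i, ∑ k, ((γ x)⁻¹ * T x * (γ x)⁻¹) i k * covVec γ X i k x) s := by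
  have hOA : ∀ i k, IsBigOPow (fun x => ((γ x)⁻¹ * T x * (γ x)⁻¹) i k) t := by
    intro i k
    simp only [Matrix.mul_apply]
    exact IsBigOPow.sum fun a _ => (IsBigOPow.sum fun b _ =>
      (hγ.isBigOPow_inv i b).bounded_mul (hOT b a)).mul_bounded (hγ.isBigOPow_inv a k)
  have hOD := hX.isBigOPow_pd hq hOX
  have hOdh := hγ.isBigOPow_pd hsymm hOΓ
  have hO : IsBigOPow (fun x => conformalFactor M x * ∑ i, ∑ k,
      ((γ x)⁻¹ * T x * (γ x)⁻¹) i k * ((1 / 2) * ∑ j, pd j (fun y => h y k i) x * X x j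
        + ∑ j, h x k j * pd i (fun y => X y j) x
        - (1 / 2) * (2 * pd 0 (fun y => X y 0) x) * h x i k)) s := by
    refine (IsBigOPow.of_tendsto (tendsto_conformalFactor M)).bounded_mul
      (IsBigOPow.sum fun i _ => IsBigOPow.sum fun k _ => ?_)
    -- The exponent s - t is what T = O(r^t) leaves for the other factor: ∂h · X needs c + q, and h
    -- · ∂X needs d + q.
    have h1 : IsBigOPow (fun x => (1 / 2) * ∑ j, pd j (fun y => h y k i) x * X x j) (s - t) :=
      IsBigOPow.const_mul _ (IsBigOPow.sum fun j _ =>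
        ((hOdh j k i).mul (hOX.component j)).mono (by linarith))
    have h2 : IsBigOPow (fun x => ∑ j, h x k j * pd i (fun y => X y j) x) (s - t) :=
      IsBigOPow.sum fun j _ => ((hOh k j).mul (hOD i j)).mono (by linarith)
    have h3 : IsBigOPow (fun x => (1 / 2) * (2 * pd 0 (fun y => X y 0) x) * h x i k) (s - t) :=
      ((((hOD 0 0).const_mul 2).const_mul (1 / 2)).mul (hOh i k)).mono (by linarith)
    exact ((hOA i k).mul ((h1.add h2).sub h3)).mono (by linarith)
  refine hO.congr' ?_
  filter_upwards [eventually_mem_exterior R₀,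
    (tendsto_conformalFactor M).eventually_ne one_ne_zero] with x hx h0
  have htr : ∑ i, ∑ k, ((γ x)⁻¹ * T x * (γ x)⁻¹) i k * ((if i = k then 1 else 0) + h x i k)
      = 0 := by
    have h1 : (((γ x)⁻¹ * T x * (γ x)⁻¹) * γ x).trace = 0 := by
      rw [Matrix.mul_assoc _ (γ x)⁻¹, Matrix.nonsing_inv_mul _ (hdet x hx), Matrix.mul_one, hTtr x hx]
    refine (mul_eq_zero.1 (?_ : conformalFactor M x * _ = 0)).resolve_left h0
    refine Eq.trans ?_ h1
    rw [Finset.mul_sum, Matrix.trace]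
    refine Finset.sum_congr rfl fun i _ => ?_
    rw [Matrix.diag_apply, Matrix.mul_apply, Finset.mul_sum]
    refine Finset.sum_congr rfl fun k _ => ?_
    rw [← (hsymm x hx).apply k i, hγ.apply_eq hx]
    ring
  rw [← sum_symm_traceFree_mul (D := fun i j => pd i (fun y => X y j) x)
    (h := fun i j => h x i j) (dh := fun a i j => pd a (fun y => h y i j) x)
    (dφ := fun a => pd a (conformalFactor M) x) (X := fun j => X x j)
    (fun i k => (hTsymm x hx).apply k i) htr (fun i k => hX.killing_eq hx i k)]
  simp only [covVec, hγ.pd_eq hsmooth hx h0, hγ.apply_eq hx]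

end IsAsymptoticallyFlat

/-! ### Convergence of the electric and magnetic charges -/

theorem sphereCharge_eq_sphereFlux (γ T : TwoTensor 3) (X : Coord 3 → Coord 3) :
    sphereCharge γ T X = sphereFlux (flux γ T X) := by
  funext r
  refine integral_congr_ae (Eventually.of_forall fun u => ?_)
  simp only [flux, Finset.mul_sum, Finset.sum_mul]
  exact Finset.sum_congr rfl fun i _ => Finset.sum_congr rfl fun j _ => by ring

variable {Λ : ℝ} {U : Set (Coord 4)} {g : TwoTensor 4}

/-- The time function `t` has timelike gradient wherever its level set is spacelike. -/
theorem IsVacuumSpacetime.inv_zero_zero_neg (hg : IsVacuumSpacetime Λ U g) {p : Coord 4}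
    (hp : p ∈ U) (hpos : 0 < (spatial (g p)).det) : (g p)⁻¹ 0 0 < 0 := by
  have hd := hg.det_neg hp
  rw [Matrix.inv_def, Matrix.smul_apply, Ring.inverse_eq_inv, smul_eq_mul,
    Matrix.adjugate_fin_succ_eq_det_submatrix]
  have : (g p).submatrix (Fin.succAbove 0) (Fin.succAbove 0) = spatial (g p) := by
    ext i j; simp [spatial]
  rw [this]
  simpa using mul_neg_of_neg_of_pos (inv_lt_zero.2 hd) hpos

/-- The sign of g^{00} is controlled on the slice only. It is an open condition, so the spacetime
may be shrunk to the open set where it holds. -/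
theorem IsVacuumSpacetime.isFoliatedVacuum (hg : IsVacuumSpacetime Λ U g) :
    IsFoliatedVacuum Λ {p ∈ U | (g p)⁻¹ 0 0 < 0} g where
  isOpen := by
    have h : SmoothMat (fun p => (g p)⁻¹) U :=
      SmoothMat.inv hg.smooth fun p hp => (hg.det_neg hp).ne
    exact (h 0 0).continuousOn.isOpen_inter_preimage hg.isOpen isOpen_Iio
  smooth μ ν := ContDiffOn.mono (hg.smooth μ ν) fun p hp => hp.1
  symm p hp := hg.symm p hp.1
  lorentzian p hp := hg.lorentzian p hp.1
  einstein p hp := hg.einstein p hp.1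
  inv_zero_zero_neg p hp := hp.2

namespace IsFoliatedVacuum

theorem normalWeylDual_eq_mul (hg : IsFoliatedVacuum Λ U g) {x : Coord 3} (hx : slice x ∈ U) :
    normalWeylDual g (slice x)
      = √(inducedMetric g x).det • (magneticPart g x * (inducedMetric g x)⁻¹) := by
  have hd : IsUnit (inducedMetric g x).det := (hg.sqrt_abs_det hx).2.ne'.isUnit
  have h := hg.sqrt_det_mul_magneticPart hx
  rw [← inducedMetric_eq] at h
  rw [← Matrix.smul_mul, h, Matrix.mul_assoc, Matrix.mul_nonsing_inv _ hd, Matrix.mul_one]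

theorem magneticPart_isSymm (hg : IsFoliatedVacuum Λ U g) {x : Coord 3} (hx : slice x ∈ U) :
    ((inducedMetric g x)⁻¹ * magneticPart g x * (inducedMetric g x)⁻¹).IsSymm := by
  have h := hg.inv_mul_normalWeylDual_isSymm hx
  rw [← inducedMetric_eq, hg.normalWeylDual_eq hx] at h
  have h0 : √(inducedMetric g x).det ≠ 0 := (Real.sqrt_pos.2 (hg.sqrt_abs_det hx).2).ne'
  rw [Matrix.IsSymm, Matrix.transpose_smul] at h
  exact smul_right_injective _ h0 h

theorem trace_magneticPart (hg : IsFoliatedVacuum Λ U g) {x : Coord 3} (hx : slice x ∈ U) :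
    ((inducedMetric g x)⁻¹ * magneticPart g x).trace = 0 := by
  have h := hg.trace_normalWeylDual hx
  have h0 : √(inducedMetric g x).det ≠ 0 := (Real.sqrt_pos.2 (hg.sqrt_abs_det hx).2).ne'
  rw [hg.normalWeylDual_eq_mul hx, Matrix.trace_smul, Matrix.trace_mul_comm] at h
  exact (smul_eq_zero.1 h).resolve_left h0

theorem electricPart_isSymm (hg : IsFoliatedVacuum Λ U g) {x : Coord 3} (hx : slice x ∈ U) :
    ((inducedMetric g x)⁻¹ * electricPart g x * (inducedMetric g x)⁻¹).IsSymm := by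
  have h1 : ((inducedMetric g x)⁻¹)ᵀ = (inducedMetric g x)⁻¹ := (hg.spatial_isSymm hx).inv
  have h2 : (electricPart g x)ᵀ = electricPart g x := by
    ext i j
    rw [Matrix.transpose_apply, electricPart_eq, electricPart_eq, hg.normalWeyl₂_symm hx]
  rw [Matrix.IsSymm, Matrix.transpose_mul, Matrix.transpose_mul, h1, h2, Matrix.mul_assoc]

theorem trace_electricPart (hg : IsFoliatedVacuum Λ U g) {x : Coord 3} (hx : slice x ∈ U) :
    ((inducedMetric g x)⁻¹ * electricPart g x).trace = 0 := by
  rw [← hg.trace_electric hx, Matrix.trace]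
  refine Finset.sum_congr rfl fun i _ => ?_
  rw [Matrix.diag_apply, Matrix.mul_apply]
  refine Finset.sum_congr rfl fun j _ => ?_
  rw [electricPart_eq, hg.normalWeyl₂_symm hx, inducedMetric_eq]

variable {M R₀ : ℝ} {h : TwoTensor 3}

/-- The duality between B and W_{iakl} nᵃ is invertible with bounded coefficients, so these
components decay at the rate of B. -/
theorem isBigOPow_normalWeyl (hg : IsFoliatedVacuum Λ U g)
    (hγ : IsAsymptoticallyFlat M R₀ (inducedMetric g) h) (hU : ∀ x ∈ exterior R₀, slice x ∈ U)
    {b : ℝ} (hOB : ∀ i j, IsBigOPow (fun x => magneticPart g x i j) b) (i k l : Fin 3) :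
    IsBigOPow (fun x => normalWeyl g (slice x) i k l) b := by
  have hdual : ∀ i m, IsBigOPow (fun x => normalWeyl g (slice x) i (m + 1) (m + 2)) b := by
    intro i m
    have hO : IsBigOPow (fun x => √(inducedMetric g x).det
        * ∑ a, magneticPart g x i a * (inducedMetric g x)⁻¹ a m) b :=
      hγ.isBigOPow_sqrt_det.bounded_mul (IsBigOPow.sum fun a _ =>
        (hOB i a).mul_bounded (hγ.isBigOPow_inv a m))
    refine hO.congr' ?_
    filter_upwards [eventually_mem_exterior R₀] with x hx
    have := congrFun (congrFun (hg.normalWeylDual_eq_mul (hU x hx)) i) m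
    rw [Matrix.smul_apply, Matrix.mul_apply, smul_eq_mul] at this
    exact this.symm
  have hanti : ∀ k l, IsBigOPow (fun x => normalWeyl g (slice x) i l k) b →
      IsBigOPow (fun x => normalWeyl g (slice x) i k l) b := by
    intro k l hO
    refine hO.neg.congr' ?_
    filter_upwards [eventually_mem_exterior R₀] with x hx
    exact (hg.normalWeyl_antisymm (hU x hx) i k l).symm
  have hdiag : ∀ k, IsBigOPow (fun x => normalWeyl g (slice x) i k k) b := by
    intro k
    refine IsBigOPow.congr' (Asymptotics.isBigO_zero _ _) ?_
    filter_upwards [eventually_mem_exterior R₀] with x hx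
    linarith [hg.normalWeyl_antisymm (hU x hx) i k k]
  have h01 := hdual i 2
  have h12 := hdual i 0
  have h20 := hdual i 1
  fin_cases k <;> fin_cases l
  exacts [hdiag 0, h01, hanti 0 2 h20, hanti 1 0 h01, hdiag 1, h12, h20, hanti 2 1 h12, hdiag 2]

/-- In dimension three the tangential Weyl components are bounded metric coefficients times E. -/
theorem isBigOPow_weyl_tangential (hg : IsFoliatedVacuum Λ U g)
    (hγ : IsAsymptoticallyFlat M R₀ (inducedMetric g) h) (hU : ∀ x ∈ exterior R₀, slice x ∈ U)
    {e : ℝ} (hOE : ∀ i j, IsBigOPow (fun x => electricPart g x i j) e) (i j k l : Fin 3) :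
    IsBigOPow (fun x => weyl g i.succ j.succ k.succ l.succ (slice x)) e := by
  have hm : ∀ i j k l, IsBigOPow (fun x => inducedMetric g x i j * electricPart g x k l) e :=
    fun i j k l => (hγ.isBigOPow_metric i j).bounded_mul (hOE k l)
  refine ((((hm i k j l).sub (hm i l j k)).sub (hm j k i l)).add (hm j l i k)).neg.congr' ?_
  filter_upwards [eventually_mem_exterior R₀] with x hx
  exact (hg.weyl_tangential (hU x hx) i j k l).symm

theorem smooth_inducedMetric (hg : IsFoliatedVacuum Λ U g) {S : Set (Coord 3)}
    (hU : ∀ x ∈ S, slice x ∈ U) : SmoothMat (inducedMetric g) S := fun i j =>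
  SmoothOn.comp_slice (hg.smooth i.succ j.succ) hU

variable {X : Coord 3 → Coord 3} {c d k e b q : ℝ}

/-- The two terms of the divergence identity are bounded separately: the conformal Killing term by
the first two rate conditions, the K · B · X term by the third. -/
theorem hasFiniteAsymptoticCharge_electricPart (hg : IsFoliatedVacuum Λ U g)
    (hγ : IsAsymptoticallyFlat M R₀ (inducedMetric g) h) (hU : ∀ x ∈ exterior R₀, slice x ∈ U)
    (hX : IsFlatConformalKilling (exterior R₀) X) (hq : 0 ≤ q)
    (hOh : ∀ i j, IsBigOPow (fun x => h x i j) d)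
    (hOΓ : ∀ a i j, IsBigOPow (christoffel (fun x => 1 + h x) a i j) c)
    (hOK : ∀ i j, IsBigOPow (fun x => extrinsicCurv g x i j) k)
    (hOE : ∀ i j, IsBigOPow (fun x => electricPart g x i j) e)
    (hOB : ∀ i j, IsBigOPow (fun x => magneticPart g x i j) b)
    (hOX : IsBigOPow X q) (h1 : e + c + q < -3) (h2 : e + q + d < -3) (h3 : q + k + b < -3) :
    HasFiniteAsymptoticCharge (inducedMetric g) (electricPart g) X := by
  -- One common rate s, the largest of the three exponents, serves for the whole divergence.
  obtain ⟨s, hs, hs1, hs2, hs3⟩ : ∃ s : ℝ, s < -3 ∧ e + c + q ≤ s ∧ e + q + d ≤ s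
      ∧ q + k + b ≤ s :=
    ⟨max (e + c + q) (max (e + q + d) (q + k + b)), by simp [h1, h2, h3], by simp, by simp,
      by simp⟩
  rw [HasFiniteAsymptoticCharge, sphereCharge_eq_sphereFlux]
  refine exists_tendsto_sphereFlux hγ.pos (hg.smooth_flux_electricPart hU hX.smooth) hs ?_
  have hO1 := hγ.isBigOPow_contraction (hg.smooth_inducedMetric hU)
    (fun x hx => hg.spatial_isSymm (hU x hx))
    (fun x hx => (hg.sqrt_abs_det (hU x hx)).2.ne'.isUnit) hX
    (fun x hx => hg.electricPart_isSymm (hU x hx)) (fun x hx => hg.trace_electricPart (hU x hx))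
    hq hOh hOΓ hOX hOE hs1 hs2
  have hO2 : IsBigOPow (fun x => ∑ j, (∑ i, ∑ k, (∑ l, (inducedMetric g x)⁻¹ i l
      * normalWeyl g (slice x) l k j) * (∑ m, (inducedMetric g x)⁻¹ k m * extrinsicCurv g x i m))
      * X x j) s := by
    refine IsBigOPow.mono (IsBigOPow.sum fun j _ => (IsBigOPow.sum fun i _ =>
      IsBigOPow.sum fun k _ => (IsBigOPow.sum fun l _ => (hγ.isBigOPow_inv i l).bounded_mul
        (hg.isBigOPow_normalWeyl hγ hU hOB l k j)).mul (IsBigOPow.sum fun m _ =>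
          (hγ.isBigOPow_inv k m).bounded_mul (hOK i m))).mul (hOX.component j)) ?_
    linarith
  refine (hγ.isBigOPow_sqrt_det.bounded_mul (hO1.sub hO2)).congr' ?_
  filter_upwards [eventually_mem_exterior R₀] with x hx
  exact (hg.divergence_flux_electricPart (isOpen_exterior R₀) hU hX.smooth hx).symm

/-- The same argument with E and B exchanged; the extrinsic curvature now meets the tangential Weyl
tensor, which decays like E. -/
theorem hasFiniteAsymptoticCharge_magneticPart (hg : IsFoliatedVacuum Λ U g)
    (hγ : IsAsymptoticallyFlat M R₀ (inducedMetric g) h) (hU : ∀ x ∈ exterior R₀, slice x ∈ U)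
    (hX : IsFlatConformalKilling (exterior R₀) X) (hq : 0 ≤ q)
    (hOh : ∀ i j, IsBigOPow (fun x => h x i j) d)
    (hOΓ : ∀ a i j, IsBigOPow (christoffel (fun x => 1 + h x) a i j) c)
    (hOK : ∀ i j, IsBigOPow (fun x => extrinsicCurv g x i j) k)
    (hOE : ∀ i j, IsBigOPow (fun x => electricPart g x i j) e)
    (hOB : ∀ i j, IsBigOPow (fun x => magneticPart g x i j) b)
    (hOX : IsBigOPow X q) (h1 : b + c + q < -3) (h2 : b + q + d < -3) (h3 : q + k + e < -3) :
    HasFiniteAsymptoticCharge (inducedMetric g) (magneticPart g) X := by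
  obtain ⟨s, hs, hs1, hs2, hs3⟩ : ∃ s : ℝ, s < -3 ∧ b + c + q ≤ s ∧ b + q + d ≤ s
      ∧ q + k + e ≤ s :=
    ⟨max (b + c + q) (max (b + q + d) (q + k + e)), by simp [h1, h2, h3], by simp, by simp,
      by simp⟩
  rw [HasFiniteAsymptoticCharge, sphereCharge_eq_sphereFlux]
  refine exists_tendsto_sphereFlux hγ.pos (hg.smooth_flux_magneticPart hU hX.smooth) hs ?_
  have hO1 := hγ.isBigOPow_contraction (hg.smooth_inducedMetric hU)
    (fun x hx => hg.spatial_isSymm (hU x hx))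
    (fun x hx => (hg.sqrt_abs_det (hU x hx)).2.ne'.isUnit) hX
    (fun x hx => hg.magneticPart_isSymm (hU x hx)) (fun x hx => hg.trace_magneticPart (hU x hx))
    hq hOh hOΓ hOX hOB hs1 hs2
  have hO2 : IsBigOPow (fun x => ∑ j, (∑ m : Fin 3, ∑ i, (∑ q, (inducedMetric g x)⁻¹ i q
      * extrinsicCurv g x m q) * weyl g (Fin.succ i) (Fin.succ j) (m + 1).succ (m + 2).succ
        (slice x)) * X x j) s := by
    refine IsBigOPow.mono (IsBigOPow.sum fun j _ => (IsBigOPow.sum fun m _ =>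
      IsBigOPow.sum fun i _ => (IsBigOPow.sum fun l _ => (hγ.isBigOPow_inv i l).bounded_mul
        (hOK m l)).mul (hg.isBigOPow_weyl_tangential hγ hU hOE i j (m + 1) (m + 2))).mul
          (hOX.component j)) ?_
    linarith
  refine ((hγ.isBigOPow_sqrt_det.bounded_mul hO1).add hO2).congr' ?_
  filter_upwards [eventually_mem_exterior R₀] with x hx
  exact (hg.divergence_flux_magneticPart (isOpen_exterior R₀) hU hX.smooth hx).symm

end IsFoliatedVacuum

end

end GravCharge

end

theorem theorem6p1
    -- a vacuum spacetime around the hypersurface `Σ = {t = 0}`, `r > R₀`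
    (Λ M R₀ : ℝ) (hR₀ : 0 < R₀)
    (U : Set (GravCharge.Coord 4)) (g : GravCharge.TwoTensor 4)
    (hg : GravCharge.IsVacuumSpacetime Λ U g)
    (hU : ∀ x ∈ GravCharge.exterior R₀, GravCharge.slice x ∈ U)
    (hγ : ∀ x ∈ GravCharge.exterior R₀, (GravCharge.inducedMetric g x).PosDef)
    -- `γ = (1 + M/2r)⁴ (η + h)`, asymptotically flat
    (h : GravCharge.TwoTensor 3)
    (hh : ∀ x ∈ GravCharge.exterior R₀,
      GravCharge.inducedMetric g x = (1 + M / (2 * ‖x‖)) ^ 4 • (1 + h x))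
    (hflat : ∀ i j, Filter.Tendsto (fun x => h x i j)
      (Bornology.cobounded (GravCharge.Coord 3)) (nhds 0))
    -- a conformal Killing field of `η`
    (X : GravCharge.Coord 3 → GravCharge.Coord 3)
    (hX : GravCharge.IsFlatConformalKilling (GravCharge.exterior R₀) X)
    -- the decay rates
    (c d k e b q : ℝ) (hq : q = 0 ∨ q = 1 ∨ q = 2) (hcd : c < d) (hd : d < 1)
    (hOh : ∀ i j, GravCharge.IsBigOPow (fun x => h x i j) d)
    (hOΓ : ∀ a i j, GravCharge.IsBigOPow
      (GravCharge.christoffel (fun x => 1 + h x) a i j) c)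
    (hOK : ∀ i j, GravCharge.IsBigOPow (fun x => GravCharge.extrinsicCurv g x i j) k)
    (hOE : ∀ i j, GravCharge.IsBigOPow (fun x => GravCharge.electricPart g x i j) e)
    (hOB : ∀ i j, GravCharge.IsBigOPow (fun x => GravCharge.magneticPart g x i j) b)
    (hOX : GravCharge.IsBigOPow X q) :
    (e + c + q < -3 → e + q + d < -3 → q + k + b < -3 →
      GravCharge.HasFiniteAsymptoticCharge
        (GravCharge.inducedMetric g) (GravCharge.electricPart g) X) ∧
    (b + c + q < -3 → b + q + d < -3 → q + k + e < -3 →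
      GravCharge.HasFiniteAsymptoticCharge
        (GravCharge.inducedMetric g) (GravCharge.magneticPart g) X) := by
  have hq0 : 0 ≤ q := by rcases hq with rfl | rfl | rfl <;> norm_num
  -- Positive definiteness of the induced metric makes the gradient of t timelike along the slice,
  -- so the slice lies in the shrunken spacetime.
  have hV : ∀ x ∈ GravCharge.exterior R₀,
      GravCharge.slice x ∈ {p ∈ U | (g p)⁻¹ 0 0 < 0} := fun x hx =>
    ⟨hU x hx, hg.inv_zero_zero_neg (hU x hx) (hγ x hx).det_pos⟩
  have hflat' : GravCharge.IsAsymptoticallyFlat M R₀ (GravCharge.inducedMetric g) h :=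
    ⟨hR₀, hh, hflat⟩
  exact ⟨hg.isFoliatedVacuum.hasFiniteAsymptoticCharge_electricPart hflat' hV hX hq0 hOh hOΓ hOK
      hOE hOB hOX,
    hg.isFoliatedVacuum.hasFiniteAsymptoticCharge_magneticPart hflat' hV hX hq0 hOh hOΓ hOK
      hOE hOB hOX⟩
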